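/- Let $\lambda>0$ and let $Y=\Lambda^2_-S^4$ be the total space of the bundle of anti-self-dual 2-forms over the round unit sphere $S^4\subset\mathbb R^5$ (oriented by the outward normal first). For a local oriented orthonormal coframe $e^1,\dots,e^4$ of $S^4$ put $\omega_1=e^{12}-e^{34}$, $\omega_2=e^{13}-e^{42}$, $\omega_3=e^{14}-e^{23}$, with fibre coordinates $(a_1,a_2,a_3)$, $r^2=\sum a_i^2$, $s_\lambda=(\lambda+r^2)^{1/4}$, and let $b_i=da_i+\sum_j a_j\pi^*\gamma_{ji}$, where $\nabla\omega_i=\sum_j\gamma_{ij}\otimes\omega_j$ for the Levi-Civita connection $\nabla$. The Bryant–Salamon torsion-free $G_2$-structure and its metric on $Y$ are $$\varphi_\lambda=2s_\lambda\sum_{i=1}^3 b_i\wedge\pi^*\omega_i+s_\lambda^{-3}\,b_1\wedge b_2\wedge b_3,\qquad g_\lambda=2s_\lambda^2\,g_{\mathcal H}+s_\lambda^{-2}\,g_{\mathcal V},$$ where $g_{\mathcal H}=\pi^*g_{S^4}$ and $g_{\mathcal V}=\sum_i b_i^2$. A 4-dimensional submanifold of $Y$ is called coassociative if, suitably oriented,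 it is calibrated by the Hodge dual $*\varphi_\lambda$, that is, $*\varphi_\lambda$ restricts to its volume form. Let $SO(3)\times SO(2)\subset SO(5)$ act on $S^4\subset\mathbb R^3\oplus\mathbb R^2$ in the standard way and on $Y$ by the lifted action. On $S^4\setminus\{x_5=\pm1\}$ use the fibre coordinates $(a_1,a_2,a_3)$ of the oriented orthonormal frame $$\begin{aligned}e_1&=\tfrac{(-x_2,x_1,-x_4,x_3,0)}{\sqrt{1-x_5^2}},\qquad e_2=\tfrac{(-x_3,x_4,x_1,-x_2,0)}{\sqrt{1-x_5^2}},\qquad e_3=\tfrac{(-x_4,-x_3,x_2,x_1,0)}{\sqrt{1-x_5^2}},\\ e_4&=\tfrac{(-x_1x_5,-x_2x_5,-x_3x_5,-x_4x_5,1-x_5^2)}{\sqrt{1-x_5^2}}.\end{aligned}$$ For $a_1\in\mathbb R$ and $0<x_1\le1$ let $$G(a_1,x_1)=a_1(\lambda+a_1^2)^{1/4}(2x_1^2-1)+\frac12\int_0^{a_1}\frac{x^2+2\lambda}{(\lambda+x^2)^{3/4}}\,dx,$$ and for $C\in\mathbb R$ let $$M_C=SO(3)\times SO(2)\cdot\Big\{\big((x_1,0,0,\sqrt{1-x_1^2},0),(a_1,0,0)\big):\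 G(a_1,x_1)=C,\ a_1\in\mathbb R,\ 0<x_1\le1\Big\}.$$ Let $M_C^{\pm}\subset M_C$ be the part with $\pm a_1>0$. Let $Z\cong S^4$ be the zero section of $Y$ and $\Sigma\subset Z$ the circle over $\{x_1=x_2=x_3=0\}$. 1. For every $C\in\mathbb R$, $M_C$ is an (embedded) coassociative submanifold of $(Y,\varphi_\lambda,g_\lambda)$. 2. If $C\ne0$, then $M_C$ is homeomorphic to $(S^2\times\mathbb R^2)\sqcup(S^2\times S^1\times\mathbb R_{>0})$. 3. If $C=0$, then $M_0\cup\Sigma$ is, as a set, the disjoint union of the three embedded coassociative submanifolds $Z$, $M_0^+$ and $M_0^-$, which are homeomorphic to $S^4$, $S^2\times S^1\times\mathbb R_{>0}$ and $S^2\times S^1\times\mathbb R_{>0}$, respectively. Moreover $M_0\cap Z=Z\setminus\Sigma$, and $M_0$ with its subspace topology is homeomorphic to $\big(S^4\setminus\{x_1=x_2=x_3=0\}\big)\sqcup(S^2\times S^1\times\mathbb R_{>0})\sqcup(S^2\times S^1\times\mathbb R_{>0})$. -/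

import Mathlib

open scoped ContDiff
open Matrix

-- Smoothness of maps into the space of 5 x 5 matrices refers to its topology as a
-- finite-dimensional real vector space; the choice of norm is immaterial.
attribute [local instance] Matrix.normedAddCommGroup Matrix.normedSpace

noncomputable section

namespace BryantSalamon

/-! ### The total space `Y` of the bundle of anti-self-dual 2-forms over the round 4-sphere

A 2-form on `T_x S⁴ = x^⊥` is extended by zero to `ℝ⁵ = ℝ x ⊕ x^⊥`, and is written as the
skew matrix `A` with `A(u, v) = uᵀ A v`. So `Y` is realised as a submanifold of
`ℝ⁵ × Mat₅(ℝ)`. -/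

/-- `ℝ⁵ × Mat₅(ℝ)`: pairs (base point, 2-form), and also the velocities of such pairs. -/
abbrev Ambient : Type := (Fin 5 → ℝ) × Matrix (Fin 5) (Fin 5) ℝ

/-- The totally antisymmetric symbol on `ℝ⁵`, with value `1` at `(0, 1, 2, 3, 4)`. -/
def eps (m i j k l : Fin 5) : ℝ :=
  (Matrix.of ![(Pi.single m 1 : Fin 5 → ℝ), Pi.single i 1, Pi.single j 1, Pi.single k 1,
    Pi.single l 1]).det

/-- For `|x| = 1` and a 2-form `A` on `x^⊥`: the Hodge star of `A` in `T_x S⁴ = x^⊥`. The volume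
form of `S⁴` is `vol(u₁, u₂, u₃, u₄) = det (x, u₁, u₂, u₃, u₄)` (outward normal first), and
`(⋆A)(u, v) = ½ ∑ vol(u, v, f_k, f_l) A(f_k, f_l)` over an orthonormal basis `f`. -/
def hodge (x : Fin 5 → ℝ) (A : Matrix (Fin 5) (Fin 5) ℝ) : Matrix (Fin 5) (Fin 5) ℝ :=
  Matrix.of fun i j => (1 / 2) * ∑ m, ∑ k, ∑ l, eps m i j k l * x m * A k l

/-- The total space of the bundle of anti-self-dual 2-forms over
`S⁴ = {x ∈ ℝ⁵ : |x| = 1}`. -/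
def Y : Set Ambient :=
  {p | p.1 ⬝ᵥ p.1 = 1 ∧ p.2ᵀ = -p.2 ∧ p.2 *ᵥ p.1 = 0 ∧ hodge p.1 p.2 = -p.2}

/-- The tangent space `T_p Y`, of dimension 7 for `p ∈ Y`: the solutions of the linearisation at
`p` of the equations that define `Y`. -/
def tangentY (p : Ambient) : Submodule ℝ Ambient where
  carrier := {U | p.1 ⬝ᵥ U.1 = 0 ∧ U.2ᵀ = -U.2 ∧ U.2 *ᵥ p.1 + p.2 *ᵥ U.1 = 0 ∧
    hodge U.1 p.2 + hodge p.1 U.2 = -U.2}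
  add_mem' := by
    rintro U V ⟨h1, h2, h3, h4⟩ ⟨k1, k2, k3, k4⟩
    refine ⟨?_, ?_, ?_, ?_⟩
    · simp [h1, k1]
    · simp only [Prod.snd_add, Matrix.transpose_add, h2, k2, neg_add]
    · calc (U + V).2 *ᵥ p.1 + p.2 *ᵥ (U + V).1
          = (U.2 *ᵥ p.1 + p.2 *ᵥ U.1) + (V.2 *ᵥ p.1 + p.2 *ᵥ V.1) := by
            simp only [Prod.snd_add, Prod.fst_add, Matrix.add_mulVec, Matrix.mulVec_add]; abel
        _ = 0 := by rw [h3, k3, add_zero]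
    · calc hodge (U + V).1 p.2 + hodge p.1 (U + V).2
          = (hodge U.1 p.2 + hodge p.1 U.2) + (hodge V.1 p.2 + hodge p.1 V.2) := by
            ext i j
            simp only [hodge, Matrix.add_apply, Matrix.of_apply, Prod.fst_add, Prod.snd_add,
              Pi.add_apply, mul_add, add_mul, Finset.sum_add_distrib]
            ring
        _ = -(U + V).2 := by rw [h4, k4, Prod.snd_add, neg_add]
  zero_mem' := by
    refine ⟨by simp, by simp, by simp, ?_⟩
    ext i j
    simp [hodge]
  smul_mem' := by
    rintro c U ⟨h1, h2, h3, h4⟩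
    refine ⟨?_, ?_, ?_, ?_⟩
    · simp [h1]
    · simp only [Prod.smul_snd, Matrix.transpose_smul, h2, smul_neg]
    · calc (c • U).2 *ᵥ p.1 + p.2 *ᵥ (c • U).1 = c • (U.2 *ᵥ p.1 + p.2 *ᵥ U.1) := by
            simp only [Prod.smul_snd, Prod.smul_fst, Matrix.smul_mulVec, Matrix.mulVec_smul,
              smul_add]
        _ = 0 := by rw [h3, smul_zero]
    · calc hodge (c • U).1 p.2 + hodge p.1 (c • U).2
          = c • (hodge U.1 p.2 + hodge p.1 U.2) := by
            ext i j
            simp only [hodge, Matrix.add_apply, Matrix.smul_apply, Matrix.of_apply, Prod.smul_fst,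
              Prod.smul_snd, Pi.smul_apply, smul_eq_mul, mul_add, Finset.mul_sum]
            congr 1 <;> refine Finset.sum_congr rfl fun m _ => Finset.sum_congr rfl fun k _ =>
              Finset.sum_congr rfl fun l _ => by ring
        _ = -(c • U).2 := by rw [h4, smul_neg, Prod.smul_snd]

/-- The zero section `S⁴ ⊂ Y`. -/
def zeroSection : Set Ambient := {p | p.1 ⬝ᵥ p.1 = 1 ∧ p.2 = 0}

/-! ### The Bryant-Salamon structures -/

/-- The fibre metric on 2-forms for which `e¹² - e³⁴, e¹³ - e⁴², e¹⁴ - e²³` is orthonormal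
(for every oriented orthonormal coframe). -/
def fibreInner (A B : Matrix (Fin 5) (Fin 5) ℝ) : ℝ := (1 / 4) * (Aᵀ * B).trace

/-- `s_λ = (λ + r²)^{1/4}`, with `r` the fibre norm. -/
def sFun (lam : ℝ) (p : Ambient) : ℝ := (lam + fibreInner p.2 p.2) ^ (1 / 4 : ℝ)

/-- The vertical part of `U ∈ T_p Y` (the connection map): the covariant derivative, for the
Levi-Civita connection of `S⁴ ⊂ ℝ⁵`, of a curve of 2-forms with velocity `U`. It is the
tangential part `P U₂ P` of the derivative, where `P = 1 - x xᵀ` projects `ℝ⁵` to `T_x S⁴`. In a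
local frame it equals `∑ b_i(U) ω_i`. The horizontal part of `U` is `U.1 ∈ T_x S⁴`. -/
def vert (p U : Ambient) : Matrix (Fin 5) (Fin 5) ℝ :=
  (1 - Matrix.vecMulVec p.1 p.1) * U.2 * (1 - Matrix.vecMulVec p.1 p.1)

/-- `dτ = ∑ b_i ∧ π^* ω_i`, for the tautological 2-form `τ`. -/
def dTau (p : Ambient) (U : Fin 3 → Ambient) : ℝ :=
  (U 1).1 ⬝ᵥ (vert p (U 0) *ᵥ (U 2).1) + (U 2).1 ⬝ᵥ (vert p (U 1) *ᵥ (U 0).1)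
    + (U 0).1 ⬝ᵥ (vert p (U 2) *ᵥ (U 1).1)

/-- `vol_𝒱 = b₁ ∧ b₂ ∧ b₃`, the volume form of the fibres. The matrices
`ω₁ = e¹² - e³⁴, ω₂ = e¹³ - e⁴², ω₃ = e¹⁴ - e²³` satisfy `ω_i² = -1` (on `T_x S⁴`) and
`ω₁ ω₂ = ω₃ = - ω₂ ω₁`, so `-¼ tr (A B C)` is the determinant of the coordinates of `A, B, C`
with respect to `ω₁, ω₂, ω₃`. -/
def volVert (p : Ambient) (U : Fin 3 → Ambient) : ℝ :=
  -(1 / 4) * (vert p (U 0) * vert p (U 1) * vert p (U 2)).trace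

/-- `φ_λ = 2 s_λ dτ + s_λ⁻³ vol_𝒱`. -/
def phi (lam : ℝ) (p : Ambient) (U : Fin 3 → Ambient) : ℝ :=
  2 * sFun lam p * dTau p U + (sFun lam p ^ 3)⁻¹ * volVert p U

/-- `g_λ = 2 s_λ² g_ℋ + s_λ⁻² g_𝒱`. -/
def metric (lam : ℝ) (p U V : Ambient) : ℝ :=
  2 * sFun lam p ^ 2 * (U.1 ⬝ᵥ V.1) + (sFun lam p ^ 2)⁻¹ * fibreInner (vert p U) (vert p V)

/-! ### Coassociative submanifolds -/

/-- The `k`-form `e^{I 0} ∧ ⋯ ∧ e^{I (k-1)}` on `ℝ⁷` (indices start at `0`). -/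
def coordForm {k : ℕ} (I : Fin k → Fin 7) (v : Fin k → Fin 7 → ℝ) : ℝ :=
  (Matrix.of fun a b => v a (I b)).det

/-- `φ₀ = e¹²³ + e¹⁴⁵ - e¹⁶⁷ + e²⁴⁶ + e²⁵⁷ + e³⁴⁷ - e³⁵⁶` on `ℝ⁷`. -/
def phi0 (v : Fin 3 → Fin 7 → ℝ) : ℝ :=
  coordForm ![0, 1, 2] v + coordForm ![0, 3, 4] v - coordForm ![0, 5, 6] v
    + coordForm ![1, 3, 5] v + coordForm ![1, 4, 6] v + coordForm ![2, 3, 6] v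
    - coordForm ![2, 4, 5] v

/-- `*φ₀ = e⁴⁵⁶⁷ + e²³⁶⁷ - e²³⁴⁵ + e¹³⁵⁷ + e¹³⁴⁶ + e¹²⁵⁶ - e¹²⁴⁷` on `ℝ⁷`. -/
def starPhi0 (v : Fin 4 → Fin 7 → ℝ) : ℝ :=
  coordForm ![3, 4, 5, 6] v + coordForm ![1, 2, 5, 6] v - coordForm ![1, 2, 3, 4] v
    + coordForm ![0, 2, 4, 6] v + coordForm ![0, 2, 3, 5] v + coordForm ![0, 1, 4, 5] v
    - coordForm ![0, 1, 3, 6] v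

/-- `F : T_p Y ≃ ℝ⁷` identifies `φ_λ` with `φ₀`. Such an `F` is unique up to the stabiliser `G₂`
of `φ₀`, which also fixes `*φ₀`; so the form `*φ_λ` on `T_p Y` is `F^* (*φ₀)`, for any `F`. -/
def IsG2Frame (lam : ℝ) (p : Ambient) (F : tangentY p ≃ₗ[ℝ] (Fin 7 → ℝ)) : Prop :=
  ∀ U : Fin 3 → tangentY p, phi lam p (fun i => (U i : Ambient)) = phi0 (fun i => F (U i))

/-- `W ⊆ T_p Y` is calibrated by `*φ_λ`: the restriction of `*φ_λ` to `W` is, up to sign, the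
volume form of `g_λ` on `W`, whose square is the Gram determinant. (On a submanifold with such
tangent spaces `*φ_λ` vanishes nowhere; it orients the submanifold, and is then equal to its
volume form.) -/
def IsCoassociativePlane (lam : ℝ) (p : Ambient) (W : Submodule ℝ Ambient) : Prop :=
  W ≤ tangentY p ∧ Module.finrank ℝ W = 4 ∧
    ∃ F : tangentY p ≃ₗ[ℝ] (Fin 7 → ℝ), IsG2Frame lam p F ∧
      ∀ v : Fin 4 → tangentY p, (∀ i, (v i : Ambient) ∈ W) →
        starPhi0 (fun i => F (v i)) ^ 2
          = (Matrix.of fun i j => metric lam p (v i : Ambient) (v j : Ambient)).det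

/-- `ψ : V → L` is a smooth local parametrisation of `L` by an open subset `V` of `ℝ⁴`: a smooth
immersion and a homeomorphism onto a relatively open subset of `L`. -/
def IsLocalParametrization (L : Set Ambient) (V : Set (Fin 4 → ℝ))
    (ψ : (Fin 4 → ℝ) → Ambient) : Prop :=
  IsOpen V ∧ ContDiffOn ℝ ∞ ψ V ∧ (∀ q ∈ V, Function.Injective (fderiv ℝ ψ q)) ∧
    Topology.IsEmbedding (V.domRestrict ψ) ∧ ∃ O : Set Ambient, IsOpen O ∧ ψ '' V = L ∩ O

/-- `L` is a coassociative submanifold of `(Y, φ_λ, g_λ)`: a (smooth, embedded) 4-dimensional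
submanifold whose tangent spaces are calibrated by `*φ_λ`. -/
def IsCoassociative (lam : ℝ) (L : Set Ambient) : Prop :=
  L ⊆ Y ∧ ∀ p ∈ L, ∃ (V : Set (Fin 4 → ℝ)) (ψ : (Fin 4 → ℝ) → Ambient),
    IsLocalParametrization L V ψ ∧ p ∈ ψ '' V ∧
      ∀ q ∈ V, IsCoassociativePlane lam (ψ q) (LinearMap.range (fderiv ℝ ψ q).toLinearMap)

/-! ### The local frame, the action and the sets `M_C` -/

/-- The oriented orthonormal frame `e₁, e₂, e₃, e₄` of `T_x S⁴` at points with `x₅ ≠ ±1`. -/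
def frame (x : Fin 5 → ℝ) : Fin 4 → Fin 5 → ℝ :=
  (√(1 - x 4 ^ 2))⁻¹ •
    ![![-x 1, x 0, -x 3, x 2, 0],
      ![-x 2, x 3, x 0, -x 1, 0],
      ![-x 3, -x 2, x 1, x 0, 0],
      ![-x 0 * x 4, -x 1 * x 4, -x 2 * x 4, -x 3 * x 4, 1 - x 4 ^ 2]]

/-- The 2-form `eⁱ ∧ eʲ` of the frame. -/
def frameForm (x : Fin 5 → ℝ) (i j : Fin 4) : Matrix (Fin 5) (Fin 5) ℝ :=
  Matrix.vecMulVec (frame x i) (frame x j) - Matrix.vecMulVec (frame x j) (frame x i)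

/-- The anti-self-dual frame `e¹² - e³⁴, e¹³ - e⁴², e¹⁴ - e²³`. -/
def omega (x : Fin 5 → ℝ) : Fin 3 → Matrix (Fin 5) (Fin 5) ℝ :=
  ![frameForm x 0 1 - frameForm x 2 3,
    frameForm x 0 2 - frameForm x 3 1,
    frameForm x 0 3 - frameForm x 1 2]

/-- The point of `Y` over `x` with fibre coordinates `(a₁, a₂, a₃)`. -/
def fibrePoint (x : Fin 5 → ℝ) (a : Fin 3 → ℝ) : Ambient := (x, ∑ i, a i • omega x i)

/-- The block diagonal matrix `diag(h, k)`, which embeds `SO(3) × SO(2)` in `SO(5)`. -/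
def blockEmbed (h : Matrix (Fin 3) (Fin 3) ℝ) (k : Matrix (Fin 2) (Fin 2) ℝ) :
    Matrix (Fin 5) (Fin 5) ℝ :=
  Matrix.reindex finSumFinEquiv finSumFinEquiv (Matrix.fromBlocks h 0 0 k)

/-- The lifted action of `g ∈ SO(5)`: `g · (x, A) = (g x, (g⁻¹)^* A)`. -/
def act (g : Matrix (Fin 5) (Fin 5) ℝ) (p : Ambient) : Ambient := (g *ᵥ p.1, g * p.2 * gᵀ)

/-- `G(a, x) = a (λ + a²)^{1/4} (2 x² - 1) + ½ ∫₀ᵃ (t² + 2λ) / (λ + t²)^{3/4} dt`. -/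
def G (lam a x : ℝ) : ℝ :=
  a * (lam + a ^ 2) ^ (1 / 4 : ℝ) * (2 * x ^ 2 - 1)
    + (1 / 2) * ∫ t in (0 : ℝ)..a, (t ^ 2 + 2 * lam) / (lam + t ^ 2) ^ (3 / 4 : ℝ)

/-- The `SO(3) × SO(2)`-orbit of the points `((x₁, 0, 0, √(1 - x₁²), 0), (a₁, 0, 0))` with
`G(a₁, x₁) = C`, `a₁ ∈ S` and `0 < x₁ ≤ 1`. -/
def orbitSet (lam C : ℝ) (S : Set ℝ) : Set Ambient :=
  {q | ∃ h ∈ Matrix.specialOrthogonalGroup (Fin 3) ℝ,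
    ∃ k ∈ Matrix.specialOrthogonalGroup (Fin 2) ℝ, ∃ a ∈ S, ∃ x : ℝ,
      0 < x ∧ x ≤ 1 ∧ G lam a x = C ∧
      q = act (blockEmbed h k) (fibrePoint ![x, 0, 0, √(1 - x ^ 2), 0] ![a, 0, 0])}

/-- `M_C`. -/
def M (lam C : ℝ) : Set Ambient := orbitSet lam C Set.univ

/-- The part of `M_C` with `a₁ > 0`. -/
def MPos (lam C : ℝ) : Set Ambient := orbitSet lam C (Set.Ioi 0)

/-- The part of `M_C` with `a₁ < 0`. -/
def MNeg (lam C : ℝ) : Set Ambient := orbitSet lam C (Set.Iio 0)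

/-- The unit sphere `Sⁿ` in `ℝⁿ⁺¹`. -/
abbrev Sph (n : ℕ) : Type := Metric.sphere (0 : EuclideanSpace ℝ (Fin (n + 1))) 1

/-- `S² × S¹ × ℝ_{>0}`. -/
abbrev SphereCircleRay : Type := Sph 2 × Sph 1 × Set.Ioi (0 : ℝ)

end BryantSalamon

end

/-! Write a point of the sphere as `(c u, w)` with `u` in `S²`, `w` in `ℝ²` and `c² + |w|² = 1`. The
group acts on `u` and `w` separately, and over such a point with `c > 0` the orbit of `a ω₁`
consists of `orbitPoint u w c a`. So `M_C` is the image of all `(u, w, c, a)` with `c > 0` and `G(a,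
c) = C` (`mem_orbitSet`). Moreover `G(a, c) = P(a) - 2 a s(a) (1 - c²)`, where `P` is odd with `P' =
2 s` (`G_eq`, `hasDerivAt_primP`).

Coassociativity is a pointwise statement about tangent planes. All the structures are
`SO(5)`-invariant (`hodge_act`, `phi_act`, `metric_act`), so every point can be moved over `(1, 0,
0, 0, 0)`, with fibre part `a ω₁`. There explicit coordinates give a `G₂`-frame
(`isG2Frame_baseFrame`). The candidate plane is spanned by two `SO(3)`-directions, one angular
direction of `ℝ²`, and one direction in the `(c, a)`-variables. The last one is dictated by `dG =
0`, and it is exactly the one for which the calibration identity holds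
(`isCoassociativePlane_basePlane`). Differentiating the constraints along `M_C` shows that its
tangent vectors lie in this plane (`exists_plane`, `isCoassociativePlane_of_orbitPoint`); equality
follows by dimension.

For the global shape, fix the sign `ε` of `a` and put `α = ε a`, `σ = ε C`. Since `1 - c² = |w|²`,
the equation becomes `P(α) = σ + 2 α s(α) |w|²`. With `W = √(2 α s(α)) w` it is `P(α) = σ + |W|²`,
and as `P` is a diffeomorphism of `ℝ`, `α` is a smooth function of `W`. This also removes any need
for the implicit function theorem: `(u, W)` parametrises the part of sign `ε`, with explicit inverse
(`recover_param`, `coord_mem`). The condition `c > 0` becomes `Q(α) < σ` with `Q(α) = P(α) - 2 α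
s(α)`. As `Q` decreases strictly from `0` to `-∞` on `[0, ∞)`, this holds for every `W` if `σ > 0`,
and cuts out the exterior of a closed disc (a point if `σ = 0`) if `σ ≤ 0`. This yields `S² × ℝ²`
and `S² × S¹ × ℝ_{>0}`.

If `C ≠ 0` then `a` never vanishes on `M_C`, and the two signs give the two pieces. If `C = 0`, the
points with `a = 0` form the zero section without the circle. To see that this piece is open in
`M_0`, one uses that `Q` is `O(a³)` at `0`: on the other pieces `2 λ c² ≤ a²` (`neg_primQ_le`,
`mul_pow_four_lt`), so these can approach the zero section only at the circle `c = 0`. -/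

noncomputable section

namespace BryantSalamon

/-! ### ### One-variable analysis of `G` -/

/-- `s_λ` as a function of the fibre coordinate `a`. -/
def sRad (lam a : ℝ) : ℝ := (lam + a ^ 2) ^ (1 / 4 : ℝ)

lemma base_pos {lam : ℝ} (hlam : 0 < lam) (a : ℝ) : 0 < lam + a ^ 2 := by positivity

lemma sRad_pos {lam : ℝ} (hlam : 0 < lam) (a : ℝ) : 0 < sRad lam a :=
  Real.rpow_pos_of_pos (base_pos hlam a) _

lemma sRad_pow_four {lam : ℝ} (hlam : 0 < lam) (a : ℝ) : sRad lam a ^ 4 = lam + a ^ 2 := by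
  rw [sRad, ← Real.rpow_natCast, ← Real.rpow_mul (base_pos hlam a).le]
  norm_num

lemma sRad_neg (lam a : ℝ) : sRad lam (-a) = sRad lam a := by simp [sRad]

lemma contDiff_sRad {lam : ℝ} (hlam : 0 < lam) : ContDiff ℝ ∞ (sRad lam) := by
  unfold sRad
  exact ContDiff.rpow_const_of_ne (by fun_prop) fun a => (base_pos hlam a).ne'

lemma rpow_three_quarters {lam : ℝ} (hlam : 0 < lam) (a : ℝ) :
    (lam + a ^ 2) ^ (3 / 4 : ℝ) = sRad lam a ^ 3 := by
  rw [sRad, ← Real.rpow_natCast _ 3, ← Real.rpow_mul (base_pos hlam a).le]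
  norm_num

lemma hasDerivAt_sRad {lam : ℝ} (hlam : 0 < lam) (a : ℝ) :
    HasDerivAt (sRad lam) (a / (2 * sRad lam a ^ 3)) a := by
  have h1 : HasDerivAt (fun a : ℝ => lam + a ^ 2) (2 * a) a := by
    simpa using (hasDerivAt_pow 2 a).const_add lam
  have h2 := h1.rpow_const (p := (1 / 4 : ℝ)) (Or.inl (base_pos hlam a).ne')
  refine h2.congr_deriv ?_
  rw [← rpow_three_quarters hlam, show (1 / 4 - 1 : ℝ) = -(3 / 4) by norm_num,
    Real.rpow_neg (base_pos hlam a).le]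
  ring

/-- The value of `G` at `x = 1`. -/
def primP (lam a : ℝ) : ℝ :=
  a * sRad lam a + (1 / 2) * ∫ t in (0 : ℝ)..a, (t ^ 2 + 2 * lam) / sRad lam t ^ 3

lemma G_eq {lam : ℝ} (hlam : 0 < lam) (a x : ℝ) :
    G lam a x = primP lam a - 2 * a * sRad lam a * (1 - x ^ 2) := by
  simp only [G, primP, rpow_three_quarters hlam]
  rw [← sRad]
  ring

lemma primP_zero (lam : ℝ) : primP lam 0 = 0 := by simp [primP]

/-- The two terms contribute `s + a² / (2 s³)` and `(a² + 2λ) / (2 s³)`; as `s⁴ = λ + a²`, the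
fractions add up to another `s`. -/
lemma hasDerivAt_primP {lam : ℝ} (hlam : 0 < lam) (a : ℝ) :
    HasDerivAt (primP lam) (2 * sRad lam a) a := by
  have hc : Continuous fun t : ℝ => (t ^ 2 + 2 * lam) / sRad lam t ^ 3 :=
    Continuous.div (by fun_prop) ((contDiff_sRad hlam).continuous.pow 3)
      fun t => (pow_pos (sRad_pos hlam t) 3).ne'
  have h1 := intervalIntegral.integral_hasDerivAt_right (hc.intervalIntegrable 0 a)
    (hc.stronglyMeasurableAtFilter _ _) hc.continuousAt
  have h2 := ((hasDerivAt_id a).mul (hasDerivAt_sRad hlam a)).add (h1.const_mul (1 / 2))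
  refine h2.congr_deriv ?_
  have := sRad_pos hlam a
  have h4 := sRad_pow_four hlam a
  simp only [id]
  field_simp
  linear_combination (-2) * h4

lemma contDiff_primP {lam : ℝ} (hlam : 0 < lam) : ContDiff ℝ ∞ (primP lam) := by
  rw [contDiff_infty_iff_deriv]
  refine ⟨fun a => (hasDerivAt_primP hlam a).differentiableAt, ?_⟩
  rw [show deriv (primP lam) = fun a => 2 * sRad lam a from
    funext fun a => (hasDerivAt_primP hlam a).deriv]
  exact contDiff_const.mul (contDiff_sRad hlam)

lemma strictMono_primP {lam : ℝ} (hlam : 0 < lam) : StrictMono (primP lam) :=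
  strictMono_of_deriv_pos fun a => by
    rw [(hasDerivAt_primP hlam a).deriv]
    have := sRad_pos hlam a
    positivity

lemma primP_neg {lam : ℝ} (a : ℝ) : primP lam (-a) = -primP lam a := by
  have h : ∀ t, (t ^ 2 + 2 * lam) / sRad lam t ^ 3
      = (fun t => (t ^ 2 + 2 * lam) / sRad lam t ^ 3) (-t) := fun t => by
    simp [sRad_neg]
  have h2 : ∫ t in (0 : ℝ)..(-a), (t ^ 2 + 2 * lam) / sRad lam t ^ 3
      = -∫ t in (0 : ℝ)..a, (t ^ 2 + 2 * lam) / sRad lam t ^ 3 := by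
    rw [intervalIntegral.integral_congr (fun t _ => h t),
      intervalIntegral.integral_comp_neg fun t => (t ^ 2 + 2 * lam) / sRad lam t ^ 3,
      intervalIntegral.integral_symm]
    simp
  simp only [primP, sRad_neg, h2]
  ring

lemma le_sRad {lam : ℝ} (hlam : 0 < lam) (a : ℝ) : sRad lam 0 ≤ sRad lam a := by
  refine Real.rpow_le_rpow (by simpa using hlam.le) ?_ (by norm_num)
  nlinarith [sq_nonneg a]

/-- The slope `2 s(a)` is at least `2 s(0)`. This makes `primP` proper, hence a homeomorphism of the
line. -/
lemma linear_le_primP {lam : ℝ} (hlam : 0 < lam) {a : ℝ} (ha : 0 ≤ a) :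
    2 * sRad lam 0 * a ≤ primP lam a := by
  have hd : ∀ a, HasDerivAt (fun a => primP lam a - 2 * sRad lam 0 * a)
      (2 * sRad lam a - 2 * sRad lam 0) a := fun a => by
    exact ((hasDerivAt_primP hlam a).sub
      ((hasDerivAt_id a).const_mul (2 * sRad lam 0))).congr_deriv (by simp)
  have hm : Monotone (fun a => primP lam a - 2 * sRad lam 0 * a) :=
    monotone_of_deriv_nonneg (fun a => (hd a).differentiableAt) fun a => by
      rw [(hd a).deriv]
      linarith [le_sRad hlam a]
  have := hm ha
  simp only [primP_zero] at this
  linarith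

lemma surjective_primP {lam : ℝ} (hlam : 0 < lam) : Function.Surjective (primP lam) := by
  have h0 := sRad_pos hlam 0
  have htop : Filter.Tendsto (primP lam) Filter.atTop Filter.atTop :=
    Filter.tendsto_atTop_mono' _
      (Filter.eventually_ge_atTop 0 |>.mono fun a ha => linear_le_primP hlam ha)
      (Filter.tendsto_id.const_mul_atTop (by positivity))
  have hbot : Filter.Tendsto (primP lam) Filter.atBot Filter.atBot := by
    have := Filter.tendsto_neg_atTop_atBot.comp (htop.comp Filter.tendsto_neg_atBot_atTop)
    refine this.congr fun a => ?_
    simp [primP_neg]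
  exact (contDiff_primP hlam).continuous.surjective htop hbot

/-- `primP` as a homeomorphism of `ℝ`. -/
def primPHomeo {lam : ℝ} (hlam : 0 < lam) : ℝ ≃ₜ ℝ :=
  ((strictMono_primP hlam).orderIsoOfSurjective _ (surjective_primP hlam)).toHomeomorph

/-- The inverse of `primP`. -/
def invP {lam : ℝ} (hlam : 0 < lam) : ℝ → ℝ := (primPHomeo hlam).symm

lemma primP_invP {lam : ℝ} (hlam : 0 < lam) (t : ℝ) : primP lam (invP hlam t) = t :=
  (primPHomeo hlam).apply_symm_apply t

lemma invP_primP {lam : ℝ} (hlam : 0 < lam) (a : ℝ) : invP hlam (primP lam a) = a :=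
  (primPHomeo hlam).symm_apply_apply a

lemma contDiff_invP {lam : ℝ} (hlam : 0 < lam) : ContDiff ℝ ∞ (invP hlam) := by
  refine (primPHomeo hlam).contDiff_symm_deriv (f' := fun a => 2 * sRad lam a) ?_ ?_ ?_
  · intro a
    have := sRad_pos hlam a
    positivity
  · exact fun a => hasDerivAt_primP hlam a
  · exact contDiff_primP hlam

/-- The limit of `G` as `x → 0`. -/
def primQ (lam a : ℝ) : ℝ := primP lam a - 2 * a * sRad lam a

lemma primQ_zero (lam : ℝ) : primQ lam 0 = 0 := by simp [primQ, primP_zero]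

lemma hasDerivAt_primQ {lam : ℝ} (hlam : 0 < lam) (a : ℝ) :
    HasDerivAt (primQ lam) (-(a ^ 2 / sRad lam a ^ 3)) a := by
  have h2 := (hasDerivAt_primP hlam a).sub
    (((hasDerivAt_id a).const_mul 2).mul (hasDerivAt_sRad hlam a))
  refine h2.congr_deriv ?_
  have := sRad_pos hlam a
  simp only [id]
  field_simp
  ring

/-- The derivative vanishes at `0`, but only the interior of the half-line matters. This
monotonicity decides the topology of the pieces of `M_C`. -/
lemma strictAntiOn_primQ {lam : ℝ} (hlam : 0 < lam) : StrictAntiOn (primQ lam) (Set.Ici 0) := by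
  refine strictAntiOn_of_deriv_neg (convex_Ici 0)
    (fun a _ => (hasDerivAt_primQ hlam a).continuousAt.continuousWithinAt) fun a ha => ?_
  rw [interior_Ici, Set.mem_Ioi] at ha
  rw [(hasDerivAt_primQ hlam a).deriv]
  have := sRad_pos hlam a
  have : 0 < a ^ 2 / sRad lam a ^ 3 := by positivity
  linarith

/-- Near `a = 0` the function `primQ` is `O(a³)`. -/
lemma neg_primQ_le {lam : ℝ} (hlam : 0 < lam) {a : ℝ} (ha : 0 ≤ a) :
    -primQ lam a * lam ≤ a ^ 3 * sRad lam a := by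
  have h0 : ∀ a, HasDerivAt (fun a => primQ lam a * lam + a ^ 3 * sRad lam a)
      (-(a ^ 2 / sRad lam a ^ 3) * lam
        + (3 * a ^ 2 * sRad lam a + a ^ 3 * (a / (2 * sRad lam a ^ 3)))) a := fun a => by
    exact (((hasDerivAt_primQ hlam a).mul_const lam).add
      ((hasDerivAt_pow 3 a).mul (hasDerivAt_sRad hlam a))).congr_deriv (by simp)
  have hm : Monotone (fun a => primQ lam a * lam + a ^ 3 * sRad lam a) :=
    monotone_of_deriv_nonneg (fun a => (h0 a).differentiableAt) fun a => by
      rw [(h0 a).deriv]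
      have h1 := sRad_pos hlam a
      have h4 := sRad_pow_four hlam a
      have : -(a ^ 2 / sRad lam a ^ 3) * lam
        + (3 * a ^ 2 * sRad lam a + a ^ 3 * (a / (2 * sRad lam a ^ 3)))
        -- Over the common denominator `2 s³`, with `s⁴ = λ + a²`, the numerator is `-2λa² + 6a²(λ +
        -- a²) + a⁴`.
        = a ^ 2 * (4 * lam + 7 * a ^ 2) / (2 * sRad lam a ^ 3) := by
        field_simp
        linear_combination 6 * a ^ 2 * h4
      rw [this]
      positivity
  have := hm ha
  simp only [primQ_zero] at this
  nlinarith

lemma exists_primQ_eq {lam : ℝ} (hlam : 0 < lam) {t : ℝ} (ht : t ≤ 0) :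
    ∃ a, 0 ≤ a ∧ primQ lam a = t := by
  -- For `a ≥ λ + 1` one has `λ ≤ a²`, so `s⁴ ≤ 2a²` and the slope `-a² / s³` is at most `-s / 2 ≤
  -- -s(0) / 2`. So `primQ` decreases at least linearly from `m` on.
  set m := lam + 1 with hm
  have hcont : Continuous (primQ lam) :=
    continuous_iff_continuousAt.2 fun a => (hasDerivAt_primQ hlam a).continuousAt
  have h00 := sRad_pos hlam 0
  have hb : ∀ a, m ≤ a → primQ lam a ≤ - (sRad lam 0 / 2) * (a - m) := by
    intro a ha
    have hd : ∀ a, HasDerivAt (fun a => primQ lam a + (sRad lam 0 / 2) * (a - m))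
        (-(a ^ 2 / sRad lam a ^ 3) + sRad lam 0 / 2) a := fun a => by
      exact ((hasDerivAt_primQ hlam a).add
        (((hasDerivAt_id a).sub_const m).const_mul (sRad lam 0 / 2))).congr_deriv (by simp)
    have hanti : AntitoneOn (fun a => primQ lam a + (sRad lam 0 / 2) * (a - m)) (Set.Ici m) := by
      refine antitoneOn_of_deriv_nonpos (convex_Ici m)
        (fun a _ => (hd a).continuousAt.continuousWithinAt)
        (fun a _ => (hd a).differentiableAt.differentiableWithinAt) fun a ha => ?_
      rw [interior_Ici, Set.mem_Ioi] at ha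
      rw [(hd a).deriv]
      have h1 := sRad_pos hlam a
      have h4 := sRad_pow_four hlam a
      have hle := le_sRad hlam a
      have : sRad lam a / 2 ≤ a ^ 2 / sRad lam a ^ 3 := by
        rw [div_le_div_iff₀ (by norm_num) (by positivity)]
        nlinarith
      linarith
    have h1 := hanti (Set.self_mem_Ici) ha ha
    have h2 : primQ lam m ≤ primQ lam 0 :=
      (strictAntiOn_primQ hlam).antitoneOn (Set.self_mem_Ici)
        (show (0 : ℝ) ≤ m by positivity) (show (0 : ℝ) ≤ m by positivity)
    rw [primQ_zero] at h2
    simp only [sub_self, mul_zero, add_zero] at h1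
    linarith
  -- Chosen so that the linear upper bound `hb` equals `t` at `b`; the intermediate value theorem
  -- then applies on `[0, b]`.
  set b := m + 2 * (-t) / sRad lam 0 with hbdef
  have hmb : m ≤ b := by
    have : 0 ≤ 2 * (-t) / sRad lam 0 := div_nonneg (by linarith) h00.le
    linarith
  have hQb : primQ lam b ≤ t := by
    refine (hb b hmb).trans (le_of_eq ?_)
    rw [hbdef]
    field_simp
    ring
  have hb0 : 0 ≤ b := le_trans (by positivity) hmb
  obtain ⟨a, ha, hat⟩ := intermediate_value_Icc' hb0 hcont.continuousOn
    (show t ∈ Set.Icc (primQ lam b) (primQ lam 0) from ⟨hQb, by rwa [primQ_zero]⟩)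
  exact ⟨a, ha.1, hat⟩

/-! ### Equivariance under `SO(5)` -/

/-- The determinant of five vectors in `ℝ⁵`. -/
def vol (v : Fin 5 → Fin 5 → ℝ) : ℝ := (Matrix.of v).det

lemma linear_expand {n : ℕ} (f : (Fin n → ℝ) →ₗ[ℝ] ℝ) (v : Fin n → ℝ) :
    f v = ∑ i, v i * f (Pi.single i 1) := by
  conv_lhs => rw [← Finset.univ_sum_single v]
  rw [map_sum]
  refine Finset.sum_congr rfl fun i _ => ?_
  rw [← smul_eq_mul, ← map_smul, ← Pi.single_smul, smul_eq_mul, mul_one]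

/-- `vol` is linear in each slot. -/
lemma vol_update (v : Fin 5 → Fin 5 → ℝ) (a : Fin 5) (u : Fin 5 → ℝ) :
    vol (Function.update v a u)
      = ∑ p, u p * vol (Function.update v a (Pi.single p 1)) := by
  let f : (Fin 5 → ℝ) →ₗ[ℝ] ℝ :=
    { toFun := fun u => vol (Function.update v a u)
      map_add' := fun x y => Matrix.det_updateRow_add (Matrix.of v) a x y
      map_smul' := fun c x => Matrix.det_updateRow_smul (Matrix.of v) a c x }
  exact linear_expand f u

lemma update_vec_zero (x u v y z t : Fin 5 → ℝ) :
    Function.update ![x, u, v, y, z] 0 t = ![t, u, v, y, z] := by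
  funext i; fin_cases i <;> rfl

lemma update_vec_one (x u v y z t : Fin 5 → ℝ) :
    Function.update ![x, u, v, y, z] 1 t = ![x, t, v, y, z] := by
  funext i; fin_cases i <;> rfl

lemma update_vec_two (x u v y z t : Fin 5 → ℝ) :
    Function.update ![x, u, v, y, z] 2 t = ![x, u, t, y, z] := by
  funext i; fin_cases i <;> rfl

lemma update_vec_three (x u v y z t : Fin 5 → ℝ) :
    Function.update ![x, u, v, y, z] 3 t = ![x, u, v, t, z] := by
  funext i; fin_cases i <;> rfl

lemma update_vec_four (x u v y z t : Fin 5 → ℝ) :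
    Function.update ![x, u, v, y, z] 4 t = ![x, u, v, y, t] := by
  funext i; fin_cases i <;> rfl

lemma vol_slot_zero (x u v y z : Fin 5 → ℝ) :
    vol ![x, u, v, y, z] = ∑ p, x p * vol ![Pi.single p 1, u, v, y, z] := by
  simpa only [update_vec_zero] using vol_update ![x, u, v, y, z] 0 x

lemma vol_slot_one (x u v y z : Fin 5 → ℝ) :
    vol ![x, u, v, y, z] = ∑ p, u p * vol ![x, Pi.single p 1, v, y, z] := by
  simpa only [update_vec_one] using vol_update ![x, u, v, y, z] 1 u

lemma vol_slot_two (x u v y z : Fin 5 → ℝ) :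
    vol ![x, u, v, y, z] = ∑ p, v p * vol ![x, u, Pi.single p 1, y, z] := by
  simpa only [update_vec_two] using vol_update ![x, u, v, y, z] 2 v

lemma vol_slot_three (x u v y z : Fin 5 → ℝ) :
    vol ![x, u, v, y, z] = ∑ p, y p * vol ![x, u, v, Pi.single p 1, z] := by
  simpa only [update_vec_three] using vol_update ![x, u, v, y, z] 3 y

lemma vol_slot_four (x u v y z : Fin 5 → ℝ) :
    vol ![x, u, v, y, z] = ∑ p, z p * vol ![x, u, v, y, Pi.single p 1] := by
  simpa only [update_vec_four] using vol_update ![x, u, v, y, z] 4 z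

lemma vol_mulVec (g : Matrix (Fin 5) (Fin 5) ℝ) (v : Fin 5 → Fin 5 → ℝ) :
    vol (fun a => g *ᵥ v a) = g.det * vol v := by
  have : Matrix.of (fun a => g *ᵥ v a) = Matrix.of v * gᵀ := by
    ext i j
    simp [Matrix.mul_apply, Matrix.mulVec, dotProduct, mul_comm]
  rw [vol, this, Matrix.det_mul, Matrix.det_transpose, mul_comm, vol]

lemma hodge_apply (x : Fin 5 → ℝ) (A : Matrix (Fin 5) (Fin 5) ℝ) (i j : Fin 5) :
    hodge x A i j = (1 / 2) * ∑ k, ∑ l,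
      A k l * vol ![x, Pi.single i 1, Pi.single j 1, Pi.single k 1, Pi.single l 1] := by
  simp only [hodge, Matrix.of_apply]
  congr 1
  rw [Finset.sum_comm]
  refine Finset.sum_congr rfl fun k _ => ?_
  rw [Finset.sum_comm]
  refine Finset.sum_congr rfl fun l _ => ?_
  rw [vol_slot_zero, Finset.mul_sum]
  refine Finset.sum_congr rfl fun m _ => ?_
  rw [eps, vol]
  ring

lemma transpose_mul_of_special {n : ℕ} {g : Matrix (Fin n) (Fin n) ℝ}
    (hg : g ∈ Matrix.specialOrthogonalGroup (Fin n) ℝ) : gᵀ * g = 1 := by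
  have := (Matrix.mem_orthogonalGroup_iff' ..).1 (Matrix.mem_specialOrthogonalGroup_iff.1 hg).1
  simpa using this

lemma mul_transpose_of_special {n : ℕ} {g : Matrix (Fin n) (Fin n) ℝ}
    (hg : g ∈ Matrix.specialOrthogonalGroup (Fin n) ℝ) : g * gᵀ = 1 := by
  have := (Matrix.mem_orthogonalGroup_iff ..).1 (Matrix.mem_specialOrthogonalGroup_iff.1 hg).1
  simpa using this

lemma mem_special_of {n : ℕ} {g : Matrix (Fin n) (Fin n) ℝ} (h : gᵀ * g = 1) (hd : g.det = 1) :
    g ∈ Matrix.specialOrthogonalGroup (Fin n) ℝ :=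
  Matrix.mem_specialOrthogonalGroup_iff.2 ⟨(Matrix.mem_orthogonalGroup_iff' ..).2 h, hd⟩

lemma transpose_mem_special {n : ℕ} {g : Matrix (Fin n) (Fin n) ℝ}
    (hg : g ∈ Matrix.specialOrthogonalGroup (Fin n) ℝ) :
    gᵀ ∈ Matrix.specialOrthogonalGroup (Fin n) ℝ :=
  mem_special_of (by rw [transpose_transpose, mul_transpose_of_special hg])
    (by rw [det_transpose, (Matrix.mem_specialOrthogonalGroup_iff.1 hg).2])

variable {g : Matrix (Fin 5) (Fin 5) ℝ}

/-- Naturality of the Hodge star reduces to `det g = 1`. On the left `g` is moved from `A` into the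
last two slots of `vol`, on the right into the second and third slots as `gᵀ`; applying `g` to all
five vectors turns one into the other (`key`). -/
lemma hodge_act (hg : g ∈ Matrix.specialOrthogonalGroup (Fin 5) ℝ) (x : Fin 5 → ℝ)
    (A : Matrix (Fin 5) (Fin 5) ℝ) :
    hodge (g *ᵥ x) (g * A * gᵀ) = g * hodge x A * gᵀ := by
  have hgg := mul_transpose_of_special hg
  have hdet := (Matrix.mem_specialOrthogonalGroup_iff.1 hg).2
  ext i j
  have hrow : ∀ i, g *ᵥ (gᵀ *ᵥ Pi.single i 1) = Pi.single i 1 := fun i => by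
    rw [mulVec_mulVec, hgg, one_mulVec]
  have key : ∀ k l, vol ![g *ᵥ x, Pi.single i 1, Pi.single j 1, g *ᵥ Pi.single k 1,
      g *ᵥ Pi.single l 1] = vol ![x, gᵀ *ᵥ Pi.single i 1, gᵀ *ᵥ Pi.single j 1, Pi.single k 1,
      Pi.single l 1] := fun k l => by
    have := vol_mulVec g ![x, gᵀ *ᵥ Pi.single i 1, gᵀ *ᵥ Pi.single j 1, Pi.single k 1,
      Pi.single l 1]
    rw [hdet, one_mul] at this
    rw [← this]
    congr 1
    funext a
    fin_cases a
    exacts [rfl, (hrow i).symm, (hrow j).symm, rfl, rfl]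
  have hcol : ∀ p q, (g *ᵥ Pi.single p 1) q = g q p := fun p q => by simp
  have hcol' : ∀ p q, (gᵀ *ᵥ Pi.single p 1) q = g p q := fun p q => by simp
  have lhs : hodge (g *ᵥ x) (g * A * gᵀ) i j = (1 / 2) * ∑ p, ∑ q, A p q *
      vol ![g *ᵥ x, Pi.single i 1, Pi.single j 1, g *ᵥ Pi.single p 1, g *ᵥ Pi.single q 1] := by
    rw [hodge_apply]
    congr 1
    calc _ = ∑ k, ∑ l, ∑ q, ∑ p, g k p * A p q * g l q * vol ![g *ᵥ x, Pi.single i 1,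
          Pi.single j 1, Pi.single k 1, Pi.single l 1] := by
          simp only [Matrix.mul_apply, transpose_apply, Finset.sum_mul]
      _ = ∑ p, ∑ q, ∑ k, ∑ l, g k p * A p q * g l q * vol ![g *ᵥ x, Pi.single i 1,
          Pi.single j 1, Pi.single k 1, Pi.single l 1] := by
          simp only [Fin.sum_univ_five]
          ring
      _ = _ := by
          refine Finset.sum_congr rfl fun p _ => Finset.sum_congr rfl fun q _ => ?_
          rw [vol_slot_three, Finset.mul_sum]
          refine Finset.sum_congr rfl fun k _ => ?_
          rw [vol_slot_four, Finset.mul_sum, Finset.mul_sum]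
          refine Finset.sum_congr rfl fun l _ => ?_
          rw [hcol, hcol]
          ring
  have rhs : (g * hodge x A * gᵀ) i j = (1 / 2) * ∑ p, ∑ q, A p q *
      vol ![x, gᵀ *ᵥ Pi.single i 1, gᵀ *ᵥ Pi.single j 1, Pi.single p 1, Pi.single q 1] := by
    have h1 : ∀ p q, vol ![x, gᵀ *ᵥ Pi.single i 1, gᵀ *ᵥ Pi.single j 1, Pi.single p 1,
        Pi.single q 1] = ∑ l, ∑ k, g i k * g j l *
          vol ![x, Pi.single k 1, Pi.single l 1, Pi.single p 1, Pi.single q 1] := fun p q => by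
      rw [vol_slot_two]
      refine Finset.sum_congr rfl fun l _ => ?_
      rw [vol_slot_one, Finset.mul_sum]
      refine Finset.sum_congr rfl fun k _ => ?_
      rw [hcol', hcol']
      ring
    simp only [h1, Matrix.mul_apply, transpose_apply, Finset.sum_mul, hodge_apply, Finset.mul_sum]
    calc _ = ∑ l, ∑ p, ∑ k, ∑ q, g i k * (1 / 2 * (A p q * vol ![x, Pi.single k 1, Pi.single l 1,
          Pi.single p 1, Pi.single q 1])) * g j l :=
          Finset.sum_congr rfl fun l _ => Finset.sum_comm
      _ = ∑ p, ∑ l, ∑ q, ∑ k, g i k * (1 / 2 * (A p q * vol ![x, Pi.single k 1, Pi.single l 1,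
          Pi.single p 1, Pi.single q 1])) * g j l := by
          rw [Finset.sum_comm]
          exact Finset.sum_congr rfl fun l _ => Finset.sum_congr rfl fun p _ => Finset.sum_comm
      _ = _ := by
          refine Finset.sum_congr rfl fun p _ => ?_
          rw [Finset.sum_comm]
          refine Finset.sum_congr rfl fun q _ => Finset.sum_congr rfl fun l _ =>
            Finset.sum_congr rfl fun k _ => ?_
          ring
  rw [lhs, rhs]
  simp only [key]

lemma dotProduct_mulVec_special {n : ℕ} {g : Matrix (Fin n) (Fin n) ℝ}
    (hg : g ∈ Matrix.specialOrthogonalGroup (Fin n) ℝ)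
    (x y : Fin n → ℝ) : (g *ᵥ x) ⬝ᵥ (g *ᵥ y) = x ⬝ᵥ y := by
  rw [dotProduct_mulVec, vecMul_mulVec, transpose_mul_of_special hg, vecMul_one]

/-- `act g` as a linear map. -/
def actLin (g : Matrix (Fin 5) (Fin 5) ℝ) : Ambient →ₗ[ℝ] Ambient where
  toFun := act g
  map_add' p q := by simp [act, mulVec_add, mul_add, add_mul]
  map_smul' c p := by simp [act, mulVec_smul]

lemma act_act (g g' : Matrix (Fin 5) (Fin 5) ℝ) (p : Ambient) :
    act g (act g' p) = act (g * g') p := by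
  simp [act, Matrix.mul_assoc]

lemma act_one (p : Ambient) : act 1 p = p := by simp [act]

/-- The action of an element of `SO(5)` as a linear equivalence. -/
def actEquiv (hg : g ∈ Matrix.specialOrthogonalGroup (Fin 5) ℝ) : Ambient ≃ₗ[ℝ] Ambient :=
  LinearEquiv.ofLinearMap (actLin g) (actLin gᵀ)
    (LinearMap.ext fun p => by
      change act g (act gᵀ p) = p
      rw [act_act, mul_transpose_of_special hg, act_one])
    (LinearMap.ext fun p => by
      change act gᵀ (act g p) = p
      rw [act_act, transpose_mul_of_special hg, act_one])

lemma transpose_conj (A : Matrix (Fin 5) (Fin 5) ℝ) : (g * A * gᵀ)ᵀ = g * Aᵀ * gᵀ := by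
  simp [Matrix.mul_assoc]

lemma conj_mulVec (hg : g ∈ Matrix.specialOrthogonalGroup (Fin 5) ℝ)
    (A : Matrix (Fin 5) (Fin 5) ℝ) (x : Fin 5 → ℝ) :
    (g * A * gᵀ) *ᵥ (g *ᵥ x) = g *ᵥ (A *ᵥ x) := by
  rw [mulVec_mulVec, mulVec_mulVec, Matrix.mul_assoc, transpose_mul_of_special hg,
    Matrix.mul_one]

lemma conj_mul (hg : g ∈ Matrix.specialOrthogonalGroup (Fin 5) ℝ)
    (A B : Matrix (Fin 5) (Fin 5) ℝ) :
    (g * A * gᵀ) * (g * B * gᵀ) = g * (A * B) * gᵀ := by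
  calc _ = g * A * (gᵀ * g) * B * gᵀ := by simp only [Matrix.mul_assoc]
    _ = _ := by rw [transpose_mul_of_special hg, Matrix.mul_one]; simp only [Matrix.mul_assoc]

lemma trace_conj (hg : g ∈ Matrix.specialOrthogonalGroup (Fin 5) ℝ)
    (A : Matrix (Fin 5) (Fin 5) ℝ) : (g * A * gᵀ).trace = A.trace := by
  rw [Matrix.trace_mul_comm, ← Matrix.mul_assoc, transpose_mul_of_special hg, Matrix.one_mul]

lemma act_mem_Y (hg : g ∈ Matrix.specialOrthogonalGroup (Fin 5) ℝ) {p : Ambient} (hp : p ∈ Y) :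
    act g p ∈ Y := by
  obtain ⟨h1, h2, h3, h4⟩ := hp
  refine ⟨?_, ?_, ?_, ?_⟩ <;> simp only [act]
  · rw [dotProduct_mulVec_special hg, h1]
  · rw [transpose_conj, h2]; simp
  · rw [conj_mulVec hg, h3, mulVec_zero]
  · rw [hodge_act hg, h4]; simp

lemma act_mem_tangentY (hg : g ∈ Matrix.specialOrthogonalGroup (Fin 5) ℝ) {p U : Ambient}
    (hU : U ∈ tangentY p) : act g U ∈ tangentY (act g p) := by
  obtain ⟨h1, h2, h3, h4⟩ := hU
  refine ⟨?_, ?_, ?_, ?_⟩ <;> simp only [act]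
  · rw [dotProduct_mulVec_special hg, h1]
  · rw [transpose_conj, h2]; simp
  · rw [conj_mulVec hg, conj_mulVec hg, ← mulVec_add, h3, mulVec_zero]
  · rw [hodge_act hg, hodge_act hg, ← Matrix.add_mul, ← Matrix.mul_add, h4]; simp

lemma act_transpose_act (hg : g ∈ Matrix.specialOrthogonalGroup (Fin 5) ℝ) (p : Ambient) :
    act gᵀ (act g p) = p := by
  rw [act_act, transpose_mul_of_special hg, act_one]

lemma act_act_transpose (hg : g ∈ Matrix.specialOrthogonalGroup (Fin 5) ℝ) (p : Ambient) :
    act g (act gᵀ p) = p := by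
  rw [act_act, mul_transpose_of_special hg, act_one]

/-- The action of `g` on tangent spaces. -/
def actTangent (hg : g ∈ Matrix.specialOrthogonalGroup (Fin 5) ℝ) (p : Ambient) :
    tangentY p ≃ₗ[ℝ] tangentY (act g p) :=
  LinearEquiv.ofLinearMap
    ((actLin g).restrict fun _ hU => act_mem_tangentY hg hU)
    ((actLin gᵀ).restrict fun _ hU => by
      have := act_mem_tangentY (transpose_mem_special hg) hU
      rwa [act_transpose_act hg] at this)
    (LinearMap.ext fun U => Subtype.ext (act_act_transpose hg U.1))
    (LinearMap.ext fun U => Subtype.ext (act_transpose_act hg U.1))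

lemma actTangent_symm_apply (hg : g ∈ Matrix.specialOrthogonalGroup (Fin 5) ℝ) (p : Ambient)
    (U : tangentY (act g p)) : act g ((actTangent hg p).symm U : Ambient) = U :=
  act_act_transpose hg U.1

lemma vert_act (hg : g ∈ Matrix.specialOrthogonalGroup (Fin 5) ℝ) (p U : Ambient) :
    vert (act g p) (act g U) = g * vert p U * gᵀ := by
  have h : (1 - vecMulVec (g *ᵥ p.1) (g *ᵥ p.1) : Matrix (Fin 5) (Fin 5) ℝ)
      = g * (1 - vecMulVec p.1 p.1) * gᵀ := by
    rw [Matrix.mul_sub, Matrix.sub_mul, Matrix.mul_one, mul_transpose_of_special hg,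
      mul_vecMulVec, vecMulVec_mul, vecMul_transpose]
  simp only [vert, act, h, conj_mul hg]

lemma fibreInner_conj (hg : g ∈ Matrix.specialOrthogonalGroup (Fin 5) ℝ)
    (A B : Matrix (Fin 5) (Fin 5) ℝ) :
    fibreInner (g * A * gᵀ) (g * B * gᵀ) = fibreInner A B := by
  simp only [fibreInner, transpose_conj, conj_mul hg, trace_conj hg]

lemma sFun_act (hg : g ∈ Matrix.specialOrthogonalGroup (Fin 5) ℝ) (lam : ℝ) (p : Ambient) :
    sFun lam (act g p) = sFun lam p := by
  simp only [sFun, act, fibreInner_conj hg]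

lemma phi_act (hg : g ∈ Matrix.specialOrthogonalGroup (Fin 5) ℝ) (lam : ℝ) (p : Ambient)
    (U : Fin 3 → Ambient) : phi lam (act g p) (fun i => act g (U i)) = phi lam p U := by
  have h1 : ∀ i j k, (act g (U i)).1 ⬝ᵥ (vert (act g p) (act g (U j)) *ᵥ (act g (U k)).1)
      = (U i).1 ⬝ᵥ (vert p (U j) *ᵥ (U k).1) := fun i j k => by
    rw [vert_act hg]
    simp only [act]
    rw [conj_mulVec hg, dotProduct_mulVec_special hg]
  simp only [phi, dTau, volVert, sFun_act hg, h1]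
  simp only [vert_act hg, conj_mul hg, trace_conj hg]

lemma metric_act (hg : g ∈ Matrix.specialOrthogonalGroup (Fin 5) ℝ) (lam : ℝ)
    (p U V : Ambient) : metric lam (act g p) (act g U) (act g V) = metric lam p U V := by
  simp only [metric, sFun_act hg, vert_act hg, fibreInner_conj hg]
  simp only [act, dotProduct_mulVec_special hg]

/-- A `G₂`-frame at `p` composed with the inverse action is a `G₂`-frame at `act g p`, since `phi`
is invariant; the Gram determinant is unchanged since `metric` is. -/
lemma IsCoassociativePlane.act {lam : ℝ} {p : Ambient} {W : Submodule ℝ Ambient}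
    (hg : g ∈ Matrix.specialOrthogonalGroup (Fin 5) ℝ) (h : IsCoassociativePlane lam p W) :
    IsCoassociativePlane lam (act g p) (W.map (actLin g)) := by
  obtain ⟨hW, hfin, F, hF, hcal⟩ := h
  refine ⟨?_, ?_, (actTangent hg p).symm.trans F, ?_, ?_⟩
  · rintro _ ⟨U, hU, rfl⟩
    exact act_mem_tangentY hg (hW hU)
  · rw [← hfin]
    exact LinearEquiv.finrank_map_eq (actEquiv hg) W
  · intro U
    have := phi_act hg lam p fun i => ((actTangent hg p).symm (U i) : Ambient)
    simp only [actTangent_symm_apply] at this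
    rw [this]
    exact hF fun i => (actTangent hg p).symm (U i)
  · intro v hv
    have hv' : ∀ i, ((actTangent hg p).symm (v i) : Ambient) ∈ W := fun i => by
      obtain ⟨U, hU, hUv⟩ := hv i
      have : ((actTangent hg p).symm (v i) : Ambient) = U := by
        change BryantSalamon.act gᵀ (v i : Ambient) = U
        rw [← hUv]
        exact act_transpose_act hg U
      rwa [this]
    refine (hcal (fun i => (actTangent hg p).symm (v i)) hv').trans ?_
    congr 2
    funext i j
    rw [← metric_act hg, actTangent_symm_apply, actTangent_symm_apply]

/-! ### ### The Hodge star in coordinates -/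

/-- The sign of `b - a`. -/
def sgn (a b : Fin 5) : ℤ := if a < b then 1 else if a = b then 0 else -1

lemma sgn_swap : ∀ a b, sgn a b = -sgn b a := by decide

lemma sgn_self (a : Fin 5) : sgn a a = 0 := by simp [sgn]

/-- The sign of the permutation `(0, 1, 2, 3, 4) ↦ (m, i, j, k, l)`, and `0` if this is not a
permutation. -/
def signProd (m i j k l : Fin 5) : ℤ :=
  sgn m i * sgn m j * sgn m k * sgn m l * sgn i j * sgn i k * sgn i l * sgn j k * sgn j l *
    sgn k l

lemma signProd_eq_zero {m i j k l : Fin 5} (h : ¬ Function.Injective ![m, i, j, k, l]) :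
    signProd m i j k l = 0 := by
  by_contra h2
  apply h
  have : m ≠ i ∧ m ≠ j ∧ m ≠ k ∧ m ≠ l ∧ i ≠ j ∧ i ≠ k ∧ i ≠ l ∧ j ≠ k ∧ j ≠ l ∧ k ≠ l := by
    refine ⟨?_, ?_, ?_, ?_, ?_, ?_, ?_, ?_, ?_, ?_⟩ <;> rintro rfl <;>
      simp [signProd, sgn_self] at h2
  obtain ⟨h1, h2, h3, h4, h5, h6, h7, h8, h9, h10⟩ := this
  intro a b hab
  fin_cases a <;> fin_cases b <;> simp_all

-- Each inversion of `σ` contributes one factor `-1`. The 120 permutations are checked by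
-- evaluation.
set_option maxRecDepth 100000 in
lemma sign_eq_signProd : ∀ σ : Equiv.Perm (Fin 5),
    (Equiv.Perm.sign σ : ℤ) = signProd (σ 0) (σ 1) (σ 2) (σ 3) (σ 4) := by
  decide

/-- The determinant is that of the identity with its rows selected by `(m, i, j, k, l)`. The product
formula is computable, so that `simp` can evaluate single entries of the star. -/
lemma eps_eq (m i j k l : Fin 5) : eps m i j k l = signProd m i j k l := by
  have h0 : (Matrix.of ![(Pi.single m 1 : Fin 5 → ℝ), Pi.single i 1, Pi.single j 1, Pi.single k 1,
    Pi.single l 1]) = (1 : Matrix (Fin 5) (Fin 5) ℝ).submatrix ![m, i, j, k, l] id := by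
    ext a b
    fin_cases a <;> simp [Matrix.one_apply, Pi.single_apply, eq_comm (a := b)] <;>
      (split_ifs <;> simp_all)
  rw [eps, h0]
  by_cases h : Function.Injective ![m, i, j, k, l]
  · have hb : Function.Bijective ![m, i, j, k, l] := Finite.injective_iff_bijective.1 h
    have h2 := Matrix.det_permute (Equiv.ofBijective _ hb) (1 : Matrix (Fin 5) (Fin 5) ℝ)
    rw [det_one, mul_one, sign_eq_signProd] at h2
    exact h2
  · rw [signProd_eq_zero h]
    simp only [Function.Injective, not_forall] at h
    obtain ⟨a, b, hab, hne⟩ := h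
    rw [Int.cast_zero]
    refine Matrix.det_zero_of_row_eq hne ?_
    funext c
    exact congrFun (congrArg (1 : Matrix (Fin 5) (Fin 5) ℝ) hab) c

lemma skew_apply {A : Matrix (Fin 5) (Fin 5) ℝ} (hA : Aᵀ = -A) (i j : Fin 5) :
    A i j = -A j i := by
  simpa using congrFun (congrFun hA j) i

lemma hodge_swap (x : Fin 5 → ℝ) (A : Matrix (Fin 5) (Fin 5) ℝ) (i j : Fin 5) :
    hodge x A i j = -hodge x A j i := by
  simp only [hodge, Matrix.of_apply, ← mul_neg, ← Finset.sum_neg_distrib]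
  refine congrArg _ ?_
  refine Finset.sum_congr rfl fun m _ => Finset.sum_congr rfl fun k _ =>
    Finset.sum_congr rfl fun l _ => ?_
  rw [eps_eq, eps_eq, signProd, signProd, sgn_swap i j]
  push_cast
  ring

/-- Swapping `k` and `l` changes the sign of both factors, so every pair is counted twice; this
absorbs the factor `1 / 2`. -/
lemma hodge_apply_of_skew (x : Fin 5 → ℝ) {A : Matrix (Fin 5) (Fin 5) ℝ} (hA : Aᵀ = -A)
    (i j : Fin 5) : hodge x A i j = ∑ m, x m *
      (signProd m i j 0 1 * A 0 1 + signProd m i j 0 2 * A 0 2 + signProd m i j 0 3 * A 0 3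
      + signProd m i j 0 4 * A 0 4 + signProd m i j 1 2 * A 1 2 + signProd m i j 1 3 * A 1 3
      + signProd m i j 1 4 * A 1 4 + signProd m i j 2 3 * A 2 3 + signProd m i j 2 4 * A 2 4
      + signProd m i j 3 4 * A 3 4) := by
  have h : ∀ k l m, (signProd m i j l k : ℝ) * A l k = signProd m i j k l * A k l := by
    intro k l m
    rw [skew_apply hA l k, signProd, signProd, sgn_swap l k]
    push_cast
    ring
  have h0 : ∀ k m, (signProd m i j k k : ℝ) = 0 := fun k m => by simp [signProd, sgn_self]
  simp only [hodge, Matrix.of_apply, Finset.mul_sum]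
  refine Finset.sum_congr rfl fun m _ => ?_
  simp only [eps_eq, Fin.sum_univ_five, h0]
  linear_combination (x m / 2) * (h 0 1 m + h 0 2 m + h 0 3 m + h 0 4 m + h 1 2 m + h 1 3 m
    + h 1 4 m + h 2 3 m + h 2 4 m + h 3 4 m)

/-- The Hodge star in coordinates. -/
lemma hodge_entries (x : Fin 5 → ℝ) {A : Matrix (Fin 5) (Fin 5) ℝ} (hA : Aᵀ = -A) :
    hodge x A 0 1 = x 2 * A 3 4 - x 3 * A 2 4 + x 4 * A 2 3 ∧
    hodge x A 0 2 = -(x 1 * A 3 4 - x 3 * A 1 4 + x 4 * A 1 3) ∧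
    hodge x A 0 3 = x 1 * A 2 4 - x 2 * A 1 4 + x 4 * A 1 2 ∧
    hodge x A 0 4 = -(x 1 * A 2 3 - x 2 * A 1 3 + x 3 * A 1 2) ∧
    hodge x A 1 2 = x 0 * A 3 4 - x 3 * A 0 4 + x 4 * A 0 3 ∧
    hodge x A 1 3 = -(x 0 * A 2 4 - x 2 * A 0 4 + x 4 * A 0 2) ∧
    hodge x A 1 4 = x 0 * A 2 3 - x 2 * A 0 3 + x 3 * A 0 2 ∧
    hodge x A 2 3 = x 0 * A 1 4 - x 1 * A 0 4 + x 4 * A 0 1 ∧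
    hodge x A 2 4 = -(x 0 * A 1 3 - x 1 * A 0 3 + x 3 * A 0 1) ∧
    hodge x A 3 4 = x 0 * A 1 2 - x 1 * A 0 2 + x 2 * A 0 1 := by
  refine ⟨?_, ?_, ?_, ?_, ?_, ?_, ?_, ?_, ?_, ?_⟩ <;> rw [hodge_apply_of_skew x hA] <;>
    simp [Fin.sum_univ_five, signProd, sgn] <;> ring

/-! ### The tangent space at a point over `(1, 0, 0, 0, 0)` -/

/-- The anti-self-dual form `∑ b_i ω_i` at `(1, 0, 0, 0, 0)`. -/
def baseForm (b : Fin 3 → ℝ) : Matrix (Fin 5) (Fin 5) ℝ :=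
  !![0, 0, 0, 0, 0; 0, 0, b 0, b 1, b 2; 0, -b 0, 0, -b 2, b 1; 0, -b 1, b 2, 0, -b 0;
    0, -b 2, -b 1, b 0, 0]

/-- The point `a ω₁` over `(1, 0, 0, 0, 0)`. -/
def basePoint (a : ℝ) : Ambient := (![1, 0, 0, 0, 0], baseForm ![a, 0, 0])

/-- The tangent vector at `basePoint a` with vertical part `y₀ ω₁ + y₁ ω₂ + y₂ ω₃` and horizontal
part `(0, y₃, y₄, y₅, y₆)`. -/
def baseTangent (a : ℝ) : (Fin 7 → ℝ) →ₗ[ℝ] Ambient where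
  toFun y := (![0, y 3, y 4, y 5, y 6],
    !![0, a * y 4, -(a * y 3), -(a * y 6), a * y 5; -(a * y 4), 0, y 0, y 1, y 2;
      a * y 3, -y 0, 0, -y 2, y 1; a * y 6, -y 1, y 2, 0, -y 0;
      -(a * y 5), -y 2, -y 1, y 0, 0])
  map_add' y z := by
    refine Prod.ext ?_ ?_
    · funext i; fin_cases i <;> simp
    · ext i j; fin_cases i <;> fin_cases j <;> simp <;> ring
  map_smul' r y := by
    refine Prod.ext ?_ ?_
    · funext i; fin_cases i <;> simp
    · ext i j; fin_cases i <;> fin_cases j <;> simp <;> ring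

lemma baseForm_skew (b : Fin 3 → ℝ) : (baseForm b)ᵀ = -baseForm b := by
  ext i j; fin_cases i <;> fin_cases j <;> simp [baseForm]

lemma basePoint_mem_Y (a : ℝ) : basePoint a ∈ Y := by
  refine ⟨?_, baseForm_skew _, ?_, ?_⟩
  · simp [basePoint, dotProduct, Fin.sum_univ_five]
  · funext i; fin_cases i <;> simp [basePoint, baseForm, mulVec, dotProduct, Fin.sum_univ_five]
  · have h := hodge_entries (basePoint a).1 (baseForm_skew ![a, 0, 0])
    obtain ⟨h01, h02, h03, h04, h12, h13, h14, h23, h24, h34⟩ := h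
    have hd : ∀ i, hodge (basePoint a).1 (baseForm ![a, 0, 0]) i i = 0 := fun i => by
      linarith [hodge_swap (basePoint a).1 (baseForm ![a, 0, 0]) i i]
    have hs := hodge_swap (basePoint a).1 (baseForm ![a, 0, 0])
    change hodge (basePoint a).1 (baseForm ![a, 0, 0]) = -baseForm ![a, 0, 0]
    ext i j
    fin_cases i <;> fin_cases j <;>
      simp only [Fin.zero_eta, Fin.mk_one, Fin.reduceFinMk, hd, h01, h02, h03, h04, h12, h13, h14,
        h23, h24, h34, hs 1 0, hs 2 0, hs 3 0, hs 4 0, hs 2 1, hs 3 1, hs 4 1, hs 3 2, hs 4 2,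
        hs 4 3] <;>
      simp [basePoint, baseForm]

lemma baseTangent_skew (a : ℝ) (y : Fin 7 → ℝ) : (baseTangent a y).2ᵀ = -(baseTangent a y).2 := by
  ext i j; fin_cases i <;> fin_cases j <;> simp [baseTangent]

/-- The entries with an index `0` are those that the linearisation of `A x = 0` prescribes in terms
of the horizontal part; the remaining block is anti-self-dual. -/
lemma baseTangent_mem (a : ℝ) (y : Fin 7 → ℝ) : baseTangent a y ∈ tangentY (basePoint a) := by
  refine ⟨?_, baseTangent_skew a y, ?_, ?_⟩
  · simp [basePoint, baseTangent, dotProduct, Fin.sum_univ_five]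
  · funext i
    fin_cases i <;>
      simp [basePoint, baseForm, baseTangent, mul_comm]
  · obtain ⟨h01, h02, h03, h04, h12, h13, h14, h23, h24, h34⟩ :=
      hodge_entries (baseTangent a y).1 (baseForm_skew ![a, 0, 0])
    obtain ⟨k01, k02, k03, k04, k12, k13, k14, k23, k24, k34⟩ :=
      hodge_entries (basePoint a).1 (baseTangent_skew a y)
    have hs := hodge_swap (baseTangent a y).1 (baseForm ![a, 0, 0])
    have ks := hodge_swap (basePoint a).1 (baseTangent a y).2
    have hd : ∀ i, hodge (baseTangent a y).1 (baseForm ![a, 0, 0]) i i = 0 := fun i => by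
      linarith [hs i i]
    have kd : ∀ i, hodge (basePoint a).1 (baseTangent a y).2 i i = 0 := fun i => by
      linarith [ks i i]
    change hodge (baseTangent a y).1 (baseForm ![a, 0, 0])
      + hodge (basePoint a).1 (baseTangent a y).2 = -(baseTangent a y).2
    ext i j
    rw [Matrix.add_apply]
    fin_cases i <;> fin_cases j <;>
      simp only [Fin.zero_eta, Fin.mk_one, Fin.reduceFinMk, hd, h01, h02, h03, h04, h12, h13, h14,
        h23, h24, h34, hs 1 0, hs 2 0, hs 3 0, hs 4 0, hs 2 1, hs 3 1, hs 4 1, hs 3 2, hs 4 2,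
        hs 4 3, kd, k01, k02, k03, k04, k12, k13, k14,
        k23, k24, k34, ks 1 0, ks 2 0, ks 3 0, ks 4 0, ks 2 1, ks 3 1, ks 4 1, ks 3 2, ks 4 2,
        ks 4 3] <;>
      simp [basePoint, baseForm, baseTangent, mul_comm]

/-- The vertical and horizontal coordinates of a tangent vector at `basePoint a`. -/
def baseCoords (U : Ambient) : Fin 7 → ℝ :=
  ![U.2 1 2, U.2 1 3, U.2 1 4, U.1 1, U.1 2, U.1 3, U.1 4]

lemma baseCoords_baseTangent (a : ℝ) (y : Fin 7 → ℝ) : baseCoords (baseTangent a y) = y := by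
  funext i; fin_cases i <;> simp [baseCoords, baseTangent]

/-- The linearised equations leave no freedom beyond these seven coordinates: anti-self-duality ties
the entries `34`, `24`, `23` to `12`, `13`, `14`, and the linearisation of `A x = 0` gives the row
and column of index `0`. -/
lemma baseTangent_baseCoords {a : ℝ} {U : Ambient} (hU : U ∈ tangentY (basePoint a)) :
    baseTangent a (baseCoords U) = U := by
  obtain ⟨h1, h2, h3, h4⟩ := hU
  have hs := skew_apply h2
  have hd : ∀ i, U.2 i i = 0 := fun i => by linarith [hs i i]
  have e12 := congrFun (congrFun h4 1) 2
  have e13 := congrFun (congrFun h4 1) 3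
  have e14 := congrFun (congrFun h4 1) 4
  have h3' := congrFun h3
  obtain ⟨-, -, -, -, k12, k13, k14, -⟩ := hodge_entries (basePoint a).1 h2
  obtain ⟨-, -, -, -, l12, l13, l14, -⟩ := hodge_entries U.1 (baseForm_skew ![a, 0, 0])
  change (hodge U.1 (baseForm ![a, 0, 0]) 1 2 + _ : ℝ) = _ at e12
  change (hodge U.1 (baseForm ![a, 0, 0]) 1 3 + _ : ℝ) = _ at e13
  change (hodge U.1 (baseForm ![a, 0, 0]) 1 4 + _ : ℝ) = _ at e14
  rw [k12, l12] at e12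
  rw [k13, l13] at e13
  rw [k14, l14] at e14
  simp [basePoint, dotProduct, Fin.sum_univ_five] at h1
  have h31 := h3' 1
  have h32 := h3' 2
  have h33 := h3' 3
  have h34 := h3' 4
  simp [basePoint, baseForm, mulVec, dotProduct, Fin.sum_univ_five, h1] at e12 e13 e14 h31 h32
  simp [basePoint, baseForm, mulVec, dotProduct, Fin.sum_univ_five] at h33 h34
  refine Prod.ext ?_ ?_
  · funext i; fin_cases i <;> simp [baseCoords, baseTangent, h1]
  · ext i j
    fin_cases i <;> fin_cases j <;> simp [baseCoords, baseTangent] <;>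
      linarith [hd 0, hd 1, hd 2, hd 3, hd 4, hs 0 1, hs 0 2, hs 0 3, hs 0 4, hs 1 2, hs 1 3,
        hs 1 4, hs 2 3, hs 2 4, hs 3 4]

lemma vert_baseTangent (a : ℝ) (y : Fin 7 → ℝ) :
    vert (basePoint a) (baseTangent a y) = baseForm ![y 0, y 1, y 2] := by
  have h : (1 - vecMulVec (basePoint a).1 (basePoint a).1 : Matrix (Fin 5) (Fin 5) ℝ)
      = Matrix.diagonal ![0, 1, 1, 1, 1] := by
    ext i j
    fin_cases i <;> fin_cases j <;> simp [basePoint]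
  rw [vert, h]
  ext i j
  rw [mul_diagonal, diagonal_mul]
  fin_cases i <;> fin_cases j <;> simp [baseTangent, baseForm]

lemma fibreInner_baseForm (b c : Fin 3 → ℝ) :
    fibreInner (baseForm b) (baseForm c) = b 0 * c 0 + b 1 * c 1 + b 2 * c 2 := by
  simp [fibreInner, Matrix.trace, Matrix.mul_apply, Fin.sum_univ_five, baseForm]
  ring

lemma sFun_basePoint (lam a : ℝ) : sFun lam (basePoint a) = sRad lam a := by
  rw [sFun, basePoint, fibreInner_baseForm, sRad]
  simp [sq]

lemma metric_baseTangent (lam a : ℝ) (y z : Fin 7 → ℝ) :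
    metric lam (basePoint a) (baseTangent a y) (baseTangent a z)
      = 2 * sRad lam a ^ 2 * (y 3 * z 3 + y 4 * z 4 + y 5 * z 5 + y 6 * z 6)
        + (sRad lam a ^ 2)⁻¹ * (y 0 * z 0 + y 1 * z 1 + y 2 * z 2) := by
  rw [metric, vert_baseTangent, vert_baseTangent, fibreInner_baseForm, sFun_basePoint]
  simp [baseTangent, dotProduct, Fin.sum_univ_five]

lemma phi_baseTangent (lam a : ℝ) (y : Fin 3 → Fin 7 → ℝ) :
    phi lam (basePoint a) (fun i => baseTangent a (y i))
      = 2 * sRad lam a * (coordForm ![0, 3, 4] y - coordForm ![0, 5, 6] y + coordForm ![1, 3, 5] y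
        + coordForm ![1, 4, 6] y + coordForm ![2, 3, 6] y - coordForm ![2, 4, 5] y)
        + (sRad lam a ^ 3)⁻¹ * coordForm ![0, 1, 2] y := by
  have h1 : dTau (basePoint a) (fun i => baseTangent a (y i))
      = coordForm ![0, 3, 4] y - coordForm ![0, 5, 6] y + coordForm ![1, 3, 5] y
        + coordForm ![1, 4, 6] y + coordForm ![2, 3, 6] y - coordForm ![2, 4, 5] y := by
    simp only [dTau, vert_baseTangent]
    simp [baseTangent, baseForm, mulVec, dotProduct, Fin.sum_univ_five, coordForm, det_fin_three]
    ring
  have h2 : volVert (basePoint a) (fun i => baseTangent a (y i)) = coordForm ![0, 1, 2] y := by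
    simp only [volVert, vert_baseTangent]
    simp [baseForm, Matrix.trace, Fin.sum_univ_five, coordForm, det_fin_three]
    ring
  rw [phi, h1, h2, sFun_basePoint]

/-! ### ### The `G₂`-frame and the calibrated planes at base points -/

/-- The scaling that makes the coordinates at a base point orthonormal. -/
def scaling (s : ℝ) : Fin 7 → ℝ := ![s⁻¹, s⁻¹, s⁻¹, √2 * s, √2 * s, √2 * s, √2 * s]

lemma scaling_ne_zero {s : ℝ} (hs : 0 < s) (i : Fin 7) : scaling s i ≠ 0 := by
  fin_cases i <;> simp [scaling, hs.ne']

/-- A `G₂`-frame at `basePoint a`. -/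
def baseFrame {lam : ℝ} (hlam : 0 < lam) (a : ℝ) :
    tangentY (basePoint a) ≃ₗ[ℝ] (Fin 7 → ℝ) where
  toFun U := fun i => scaling (sRad lam a) i * baseCoords U i
  map_add' U V := by funext i; fin_cases i <;> simp [baseCoords, mul_add]
  map_smul' c U := by funext i; fin_cases i <;> simp [baseCoords] <;> ring
  invFun z := ⟨baseTangent a fun i => (scaling (sRad lam a) i)⁻¹ * z i, baseTangent_mem a _⟩
  left_inv U := by
    refine Subtype.ext ?_
    have : (fun i => (scaling (sRad lam a) i)⁻¹ * (scaling (sRad lam a) i * baseCoords U i))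
        = baseCoords U := by
      funext i
      rw [inv_mul_cancel_left₀ (scaling_ne_zero (sRad_pos hlam a) i)]
    simp only [this]
    exact baseTangent_baseCoords U.2
  right_inv z := by
    funext i
    change scaling (sRad lam a) i * baseCoords (baseTangent a _) i = z i
    rw [baseCoords_baseTangent, mul_inv_cancel_left₀ (scaling_ne_zero (sRad_pos hlam a) i)]

lemma coordForm_scale {k : ℕ} (I : Fin k → Fin 7) (c : Fin 7 → ℝ) (v : Fin k → Fin 7 → ℝ) :
    coordForm I (fun a i => c i * v a i) = (∏ b, c (I b)) * coordForm I v := by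
  simp only [coordForm]
  exact Matrix.det_mul_row (fun b => c (I b)) (Matrix.of fun a b => v a (I b))

/-- The terms of `phi0` with one vertical and two horizontal indices acquire `s⁻¹ (√2 s)² = 2 s`,
and the purely vertical term acquires `s⁻³`, as in `phi_baseTangent`. -/
lemma isG2Frame_baseFrame {lam : ℝ} (hlam : 0 < lam) (a : ℝ) :
    IsG2Frame lam (basePoint a) (baseFrame hlam a) := by
  intro U
  have hU : (fun i => (U i : Ambient)) = fun i => baseTangent a (baseCoords (U i)) :=
    funext fun i => (baseTangent_baseCoords (U i).2).symm
  have hF : (fun i => baseFrame hlam a (U i))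
      = fun i j => scaling (sRad lam a) j * baseCoords (U i) j := rfl
  have hs := sRad_pos hlam a
  have h2 : √2 * √2 = 2 := Real.mul_self_sqrt (by norm_num)
  have h2' : (sRad lam a)⁻¹ * (√2 * sRad lam a * (√2 * sRad lam a)) = 2 * sRad lam a := by
    field_simp
    linear_combination h2
  rw [hU, hF, phi_baseTangent]
  simp only [phi0, coordForm_scale]
  simp [Fin.prod_univ_three, scaling]
  rw [← h2']
  ring

/-- To verify that a 4-plane is calibrated, a basis suffices. -/
lemma isCoassociativePlane_of_basis {lam : ℝ} {p : Ambient}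
    {F : tangentY p ≃ₗ[ℝ] (Fin 7 → ℝ)} (hF : IsG2Frame lam p F) (w : Fin 4 → tangentY p)
    (hw : LinearIndependent ℝ fun i => (w i : Ambient))
    (h : starPhi0 (fun i => F (w i)) ^ 2
      = (Matrix.of fun i j => metric lam p (w i : Ambient) (w j : Ambient)).det) :
    IsCoassociativePlane lam p (Submodule.span ℝ (Set.range fun i => (w i : Ambient))) := by
  refine ⟨?_, ?_, F, hF, ?_⟩
  · rw [Submodule.span_le]
    rintro _ ⟨i, rfl⟩
    exact (w i).2
  · rw [finrank_span_eq_card hw, Fintype.card_fin]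
  · intro v hv
    have hv' : ∀ i, ∃ b : Fin 4 → ℝ, ∑ j, b j • (w j : Ambient) = v i := fun i =>
      (Submodule.mem_span_range_iff_exists_fun ℝ).1 (hv i)
    choose B hB using hv'
    have hB' : ∀ i, v i = ∑ j, B i j • w j := fun i => by
      refine Subtype.ext ?_
      rw [← hB i]
      simp
    have hco : ∀ I : Fin 4 → Fin 7, coordForm I (fun i => F (v i))
        = (Matrix.of B).det * coordForm I fun i => F (w i) := fun I => by
      rw [coordForm, coordForm, ← Matrix.det_mul]
      congr 1
      ext i b
      simp [hB', Matrix.mul_apply]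
    -- A 4-form on a 4-plane scales by `det B` and the Gram determinant by `(det B)²`, so the
    -- identity passes from the basis `w` to any `v`.
    have hstar : starPhi0 (fun i => F (v i)) = (Matrix.of B).det * starPhi0 fun i => F (w i) := by
      simp only [starPhi0, hco]
      ring
    have hadd : ∀ U V W : Ambient, metric lam p (U + V) W = metric lam p U W + metric lam p V W :=
      fun U V W => by
        simp [metric, vert, fibreInner, mul_add, add_mul]
        ring
    have hsmul : ∀ (c : ℝ) (U W : Ambient), metric lam p (c • U) W = c * metric lam p U W :=
      fun c U W => by
        simp [metric, vert, fibreInner]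
        ring
    have hsymm : ∀ U V : Ambient, metric lam p U V = metric lam p V U := fun U V => by
      have : fibreInner (vert p U) (vert p V) = fibreInner (vert p V) (vert p U) := by
        rw [fibreInner, fibreInner, ← Matrix.trace_transpose, transpose_mul, transpose_transpose]
      simp only [metric, this, dotProduct_comm U.1 V.1]
    let L : Ambient → Ambient →ₗ[ℝ] ℝ := fun W =>
      { toFun := fun U => metric lam p U W
        map_add' := fun U V => hadd U V W
        map_smul' := fun c U => hsmul c U W }
    have hsum : ∀ (b : Fin 4 → ℝ) (W : Ambient), metric lam p (∑ j, b j • (w j : Ambient)) W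
        = ∑ j, b j * metric lam p (w j) W := fun b W => by
      change L W _ = ∑ j, b j * L W _
      simp [map_sum]
    have hgram : (Matrix.of fun i j => metric lam p (v i : Ambient) (v j : Ambient))
        = Matrix.of B * (Matrix.of fun i j => metric lam p (w i : Ambient) (w j : Ambient))
          * (Matrix.of B)ᵀ := by
      ext i j
      simp only [Matrix.of_apply, Matrix.mul_apply, transpose_apply]
      have hk : ∀ k, metric lam p (w k) (v j) = ∑ l, B j l * metric lam p (w k) (w l) :=
        fun k => by
          rw [hsymm, ← hB j, hsum]
          exact Finset.sum_congr rfl fun l _ => by rw [hsymm]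
      rw [← hB i, hsum]
      simp only [hk, Finset.mul_sum, Finset.sum_mul]
      rw [Finset.sum_comm]
      refine Finset.sum_congr rfl fun k _ => Finset.sum_congr rfl fun l _ => ?_
      ring
    rw [hstar, hgram, Matrix.det_mul, Matrix.det_mul, Matrix.det_transpose, mul_pow, h]
    ring

/-- Coordinates of a basis of the tangent plane of `M_C`, at a point at which the coefficient of
`ω₁` is `a` and `(|(x₁, x₂, x₃)|, |(x₄, x₅)|) = (c, s)`. -/
def planeCoords (lam a c s : ℝ) : Fin 4 → Fin 7 → ℝ :=
  ![![0, 0, a * s, c, 0, 0, 0], ![0, a * s, 0, 0, c, 0, 0], ![0, 0, 0, 0, 0, 0, 1],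
    ![4 * (a * s) * c * (lam + a ^ 2), 0, 0, 0, 0, 2 * (lam + a ^ 2) * c ^ 2 - (a * s) ^ 2, 0]]

/-- The tangent plane of `M_C`, moved to a base point. -/
def basePlane (lam a c s : ℝ) : Submodule ℝ Ambient :=
  Submodule.span ℝ (Set.range fun i => baseTangent a (planeCoords lam a c s i))

lemma planeCoords_ne_zero {lam : ℝ} (hlam : 0 < lam) (a : ℝ) {c : ℝ} (hc : 0 < c) (s : ℝ)
    (h : 2 * (lam + a ^ 2) * c ^ 2 - (a * s) ^ 2 = 0) :
    4 * (a * s) * c * (lam + a ^ 2) ≠ 0 := by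
  have h1 := base_pos hlam a
  intro h2
  have h3 : a * s = 0 := by
    simpa [hc.ne', h1.ne'] using h2
  rw [h3] at h
  have : 0 < 2 * (lam + a ^ 2) * c ^ 2 := by positivity
  linarith

/-- The four vectors have disjoint supports, so they are orthogonal and the Gram determinant is the
product of their squared norms. With `f = sRad lam a`, the fourth vector is such that its squared
norm `2f² (8a²s²c²f⁴ + (2f⁴c² - a²s²)²)` is `2f² (2f⁴c² + a²s²)²`; this is what makes the
determinant a perfect square. -/
lemma isCoassociativePlane_basePlane {lam : ℝ} (hlam : 0 < lam) (a : ℝ) {c : ℝ} (hc : 0 < c)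
    (s : ℝ) : IsCoassociativePlane lam (basePoint a) (basePlane lam a c s) := by
  refine isCoassociativePlane_of_basis (isG2Frame_baseFrame hlam a)
    (fun i => ⟨baseTangent a (planeCoords lam a c s i), baseTangent_mem a _⟩) ?_ ?_
  · rw [Fintype.linearIndependent_iff]
    intro b hb
    simp only [← map_smul, ← map_sum] at hb
    have h0 : ∑ i, b i • planeCoords lam a c s i = 0 := by
      rw [← baseCoords_baseTangent a (∑ i, b i • planeCoords lam a c s i), hb]
      funext i; fin_cases i <;> simp [baseCoords]
    have e0 := congrFun h0 0
    have e3 := congrFun h0 3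
    have e4 := congrFun h0 4
    have e5 := congrFun h0 5
    have e6 := congrFun h0 6
    simp [Fin.sum_univ_four, planeCoords, hc.ne'] at e3 e4 e6
    simp [Fin.sum_univ_four, planeCoords, -mul_eq_zero] at e0 e5
    -- The two entries of the fourth vector cannot vanish together, although either of them may
    -- vanish alone.
    have e : b 3 = 0 := by
      by_contra hb3
      have h5 := (mul_eq_zero.1 e5).resolve_left hb3
      exact planeCoords_ne_zero hlam a hc s h5 ((mul_eq_zero.1 e0).resolve_left hb3)
    intro i
    fin_cases i
    exacts [e3, e4, e6, e]
  · have hF : ∀ y, baseFrame hlam a ⟨baseTangent a y, baseTangent_mem a y⟩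
        = fun j => scaling (sRad lam a) j * y j := fun y => by
      change (fun j => scaling (sRad lam a) j * baseCoords (baseTangent a y) j) = _
      rw [baseCoords_baseTangent]
    have hs := sRad_pos hlam a
    have h4 := sRad_pow_four hlam a
    have h2 : √2 ^ 2 = 2 := Real.sq_sqrt (by norm_num)
    simp only [hF, metric_baseTangent, starPhi0, coordForm_scale]
    simp [coordForm, det_succ_row_zero, Fin.sum_univ_succ, planeCoords, Fin.succAbove,
      Fin.prod_univ_four, scaling]
    -- With `λ + a²` replaced by `s_λ⁴`, the claim is a rational identity in `a`, `c`, `s`, `s_λ`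
    -- and `√2`; the relation `c² + s² = 1` plays no role.
    rw [← h4]
    generalize √2 = r at h2
    generalize sRad lam a = f at hs
    field_simp
    rw [show r ^ 4 = 4 by linear_combination (r ^ 2 + 2) * h2, h2]
    ring

/-! ### ### Transitivity of rotations on spheres -/

/-- A Householder reflection sends the first basis vector to `x`. If the determinant is `-1`, it is
corrected by first changing the sign of the last coordinate, which in dimension at least two fixes
that basis vector. -/
lemma exists_special_mulVec {n : ℕ} (x : Fin (n + 2) → ℝ) (hx : x ⬝ᵥ x = 1) :
    ∃ g ∈ Matrix.specialOrthogonalGroup (Fin (n + 2)) ℝ, g *ᵥ Pi.single 0 1 = x := by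
  suffices h : ∃ g : Matrix (Fin (n + 2)) (Fin (n + 2)) ℝ, gᵀ * g = 1 ∧ g *ᵥ Pi.single 0 1 = x by
    obtain ⟨g, hg, hgx⟩ := h
    have hdet : g.det = 1 ∨ g.det = -1 := by
      have := congrArg Matrix.det hg
      rw [det_mul, det_transpose, det_one] at this
      exact mul_self_eq_one_iff.1 this
    rcases hdet with hdet | hdet
    · exact ⟨g, mem_special_of hg hdet, hgx⟩
    · let d : Fin (n + 2) → ℝ := Function.update 1 (Fin.last _) (-1)
      have hd : ∀ i, d i * d i = 1 := fun i => by
        by_cases hi : i = Fin.last _ <;> simp [d, hi]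
      have hdd : (diagonal d)ᵀ * diagonal d = 1 := by
        rw [diagonal_transpose, diagonal_mul_diagonal]
        simp [hd]
      refine ⟨g * diagonal d, mem_special_of ?_ ?_, ?_⟩
      · rw [transpose_mul, Matrix.mul_assoc, ← Matrix.mul_assoc gᵀ, hg, Matrix.one_mul, hdd]
      · rw [det_mul, det_diagonal, hdet, Finset.prod_update_of_mem (Finset.mem_univ _)]
        simp
      · rw [← mulVec_mulVec, ← hgx]
        congr 1
        funext i
        rw [mulVec_diagonal]
        by_cases hi : i = 0
        · subst hi
          have : (0 : Fin (n + 2)) ≠ Fin.last _ := by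
            simp [Fin.ext_iff]
          simp [d, this]
        · simp [hi]
  by_cases hxe : x = Pi.single 0 1
  · exact ⟨1, by simp, by rw [one_mulVec, hxe]⟩
  -- The reflection in the hyperplane orthogonal to the difference of two unit vectors exchanges
  -- them.
  · set v : Fin (n + 2) → ℝ := Pi.single 0 1 - x with hv
    have hvv : v ⬝ᵥ v = 2 * (1 - x 0) := by
      simp [hv, sub_dotProduct, dotProduct_sub, hx]
      ring
    have hv0 : v ⬝ᵥ v ≠ 0 := fun h => by
      rw [dotProduct_self_eq_zero] at h
      exact hxe (sub_eq_zero.1 (hv ▸ h)).symm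
    refine ⟨1 - (2 / (v ⬝ᵥ v)) • vecMulVec v v, ?_, ?_⟩
    · have h1 : (vecMulVec v v)ᵀ = vecMulVec v v := transpose_vecMulVec v v
      have h2 : vecMulVec v v * vecMulVec v v = (v ⬝ᵥ v) • vecMulVec v v := by
        rw [vecMulVec_mul_vecMulVec]
        ext i j
        simp [vecMulVec_apply]
        ring
      rw [transpose_sub, transpose_one, transpose_smul, h1, Matrix.sub_mul, Matrix.one_mul,
        Matrix.mul_sub, Matrix.mul_one, Matrix.smul_mul, Matrix.mul_smul, h2, smul_smul, smul_smul,
        show 2 / (v ⬝ᵥ v) * (2 / (v ⬝ᵥ v)) * (v ⬝ᵥ v) = 2 / (v ⬝ᵥ v) + 2 / (v ⬝ᵥ v) by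
          field_simp; norm_num, add_smul]
      abel
    · rw [sub_mulVec, one_mulVec, smul_mulVec, vecMulVec_mulVec]
      have : v ⬝ᵥ Pi.single 0 1 = (v ⬝ᵥ v) / 2 := by
        rw [hvv]; simp [hv]
      rw [this]
      rw [op_smul_eq_smul, smul_smul, show 2 / (v ⬝ᵥ v) * ((v ⬝ᵥ v) / 2) = 1 by field_simp,
        one_smul, hv, sub_sub_cancel]


lemma dotProduct_self_nonneg {n : ℕ} (w : Fin n → ℝ) : 0 ≤ w ⬝ᵥ w :=
  Finset.sum_nonneg fun i _ => mul_self_nonneg (w i)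

lemma exists_special_mulVec_norm (w : Fin 2 → ℝ) :
    ∃ k ∈ Matrix.specialOrthogonalGroup (Fin 2) ℝ, k *ᵥ ![√(w ⬝ᵥ w), 0] = w := by
  by_cases hw : w = 0
  · exact ⟨1, one_mem _, by funext i; fin_cases i <;> simp [hw]⟩
  · have hpos : 0 < w ⬝ᵥ w := (dotProduct_self_nonneg w).lt_of_ne
      fun h => hw (dotProduct_self_eq_zero.1 h.symm)
    have hs : √(w ⬝ᵥ w) * √(w ⬝ᵥ w) = w ⬝ᵥ w := Real.mul_self_sqrt hpos.le
    have hs0 : √(w ⬝ᵥ w) ≠ 0 := (Real.sqrt_pos.2 hpos).ne'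
    obtain ⟨k, hk, hkw⟩ := exists_special_mulVec ((√(w ⬝ᵥ w))⁻¹ • w) (by
      rw [smul_dotProduct, dotProduct_smul, smul_eq_mul, smul_eq_mul, ← mul_assoc, ← mul_inv, hs,
        inv_mul_cancel₀ hpos.ne'])
    refine ⟨k, hk, ?_⟩
    have : (![√(w ⬝ᵥ w), 0] : Fin 2 → ℝ) = √(w ⬝ᵥ w) • Pi.single 0 1 := by
      funext i; fin_cases i <;> simp
    rw [this, mulVec_smul, hkw, smul_smul, mul_inv_cancel₀ hs0, one_smul]

/-! ### The sets `M_C` in coordinates -/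

/-- The form `⋆u + u ∧ J w - c e⁴⁵`, for `u ∈ ℝ³` and `w ∈ ℝ²`. -/
def orbitForm (u : Fin 3 → ℝ) (w : Fin 2 → ℝ) (c : ℝ) : Matrix (Fin 5) (Fin 5) ℝ :=
  !![0, u 2, -u 1, -(u 0 * w 1), u 0 * w 0; -u 2, 0, u 0, -(u 1 * w 1), u 1 * w 0;
    u 1, -u 0, 0, -(u 2 * w 1), u 2 * w 0; u 0 * w 1, u 1 * w 1, u 2 * w 1, 0, -c;
    -(u 0 * w 0), -(u 1 * w 0), -(u 2 * w 0), c, 0]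

/-- The derivative of `orbitForm`. -/
def orbitFormDeriv (u : Fin 3 → ℝ) (w : Fin 2 → ℝ) (u' : Fin 3 → ℝ) (w' : Fin 2 → ℝ) (c' : ℝ) :
    Matrix (Fin 5) (Fin 5) ℝ :=
  !![0, u' 2, -u' 1, -(u' 0 * w 1 + u 0 * w' 1), u' 0 * w 0 + u 0 * w' 0;
    -u' 2, 0, u' 0, -(u' 1 * w 1 + u 1 * w' 1), u' 1 * w 0 + u 1 * w' 0;
    u' 1, -u' 0, 0, -(u' 2 * w 1 + u 2 * w' 1), u' 2 * w 0 + u 2 * w' 0;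
    u' 0 * w 1 + u 0 * w' 1, u' 1 * w 1 + u 1 * w' 1, u' 2 * w 1 + u 2 * w' 1, 0, -c';
    -(u' 0 * w 0 + u 0 * w' 0), -(u' 1 * w 0 + u 1 * w' 0), -(u' 2 * w 0 + u 2 * w' 0), c', 0]

/-- The point `((c u, w), a (⋆u + u ∧ J w - c e⁴⁵))`. -/
def orbitPoint (u : Fin 3 → ℝ) (w : Fin 2 → ℝ) (c a : ℝ) : Ambient :=
  (![c * u 0, c * u 1, c * u 2, w 0, w 1], a • orbitForm u w c)

/-- The derivative of `orbitPoint`. -/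
def orbitPointDeriv (u : Fin 3 → ℝ) (w : Fin 2 → ℝ) (c a : ℝ) (u' : Fin 3 → ℝ) (w' : Fin 2 → ℝ)
    (c' a' : ℝ) : Ambient :=
  (![c' * u 0 + c * u' 0, c' * u 1 + c * u' 1, c' * u 2 + c * u' 2, w' 0, w' 1],
    a • orbitFormDeriv u w u' w' c' + a' • orbitForm u w c)

/-- Leibniz rule for the bilinear term `u ∧ J w`; the bracket is `u ∧ J w'` alone, with `⋆u`
cancelled. Equivariance and skewness of `orbitForm` thereby carry over to its derivative. -/
lemma orbitFormDeriv_eq (u : Fin 3 → ℝ) (w : Fin 2 → ℝ) (u' : Fin 3 → ℝ) (w' : Fin 2 → ℝ)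
    (c' : ℝ) : orbitFormDeriv u w u' w' c'
      = orbitForm u' w c' + (orbitForm u w' 0 - orbitForm u 0 0) := by
  ext i j
  fin_cases i <;> fin_cases j <;> simp [orbitForm, orbitFormDeriv] <;> ring

lemma blockEmbed_eq (h : Matrix (Fin 3) (Fin 3) ℝ) (k : Matrix (Fin 2) (Fin 2) ℝ) :
    blockEmbed h k = !![h 0 0, h 0 1, h 0 2, 0, 0; h 1 0, h 1 1, h 1 2, 0, 0;
      h 2 0, h 2 1, h 2 2, 0, 0; 0, 0, 0, k 0 0, k 0 1; 0, 0, 0, k 1 0, k 1 1] := by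
  ext i j
  fin_cases i <;> fin_cases j <;> rfl

lemma blockEmbed_mem {h : Matrix (Fin 3) (Fin 3) ℝ} {k : Matrix (Fin 2) (Fin 2) ℝ}
    (hh : h ∈ Matrix.specialOrthogonalGroup (Fin 3) ℝ)
    (hk : k ∈ Matrix.specialOrthogonalGroup (Fin 2) ℝ) :
    blockEmbed h k ∈ Matrix.specialOrthogonalGroup (Fin 5) ℝ := by
  refine mem_special_of ?_ ?_
  · rw [blockEmbed, reindex_apply, transpose_submatrix, submatrix_mul_equiv, fromBlocks_transpose,
      fromBlocks_multiply]
    simp [transpose_mul_of_special hh, transpose_mul_of_special hk]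
  · rw [blockEmbed, det_reindex_self, det_fromBlocks_zero₂₁,
      (Matrix.mem_specialOrthogonalGroup_iff.1 hh).2,
      (Matrix.mem_specialOrthogonalGroup_iff.1 hk).2, one_mul]

lemma adjugate_of_special {n : ℕ} {g : Matrix (Fin n) (Fin n) ℝ}
    (hg : g ∈ Matrix.specialOrthogonalGroup (Fin n) ℝ) : g.adjugate = gᵀ := by
  have h := Matrix.mul_adjugate g
  rw [(Matrix.mem_specialOrthogonalGroup_iff.1 hg).2, one_smul] at h
  calc g.adjugate = gᵀ * g * g.adjugate := by rw [transpose_mul_of_special hg, Matrix.one_mul]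
    _ = gᵀ := by rw [Matrix.mul_assoc, h, Matrix.mul_one]

lemma blockEmbed_mulVec (h : Matrix (Fin 3) (Fin 3) ℝ) (k : Matrix (Fin 2) (Fin 2) ℝ)
    (u : Fin 3 → ℝ) (w : Fin 2 → ℝ) :
    blockEmbed h k *ᵥ ![u 0, u 1, u 2, w 0, w 1]
      = ![(h *ᵥ u) 0, (h *ᵥ u) 1, (h *ᵥ u) 2, (k *ᵥ w) 0, (k *ᵥ w) 1] := by
  funext i
  fin_cases i <;> simp [blockEmbed_eq, mulVec, dotProduct, Fin.sum_univ_five, Fin.sum_univ_three]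

lemma special_two {k : Matrix (Fin 2) (Fin 2) ℝ}
    (hk : k ∈ Matrix.specialOrthogonalGroup (Fin 2) ℝ) :
    k 1 1 = k 0 0 ∧ k 0 1 = -k 1 0 ∧ k 0 0 ^ 2 + k 1 0 ^ 2 = 1 := by
  have h2 := adjugate_of_special hk
  have hd := (Matrix.mem_specialOrthogonalGroup_iff.1 hk).2
  rw [adjugate_fin_two] at h2
  rw [det_fin_two] at hd
  have k01 := congrFun (congrFun h2 0) 1
  have k00 := congrFun (congrFun h2 0) 0
  simp at k01 k00
  have k01' : k 0 1 = -k 1 0 := by linarith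
  rw [k00, k01'] at hd
  exact ⟨k00, k01', by linarith⟩

lemma ext_of_skew {A B : Matrix (Fin 5) (Fin 5) ℝ} (hA : Aᵀ = -A) (hB : Bᵀ = -B)
    (h01 : A 0 1 = B 0 1) (h02 : A 0 2 = B 0 2) (h03 : A 0 3 = B 0 3) (h04 : A 0 4 = B 0 4)
    (h12 : A 1 2 = B 1 2) (h13 : A 1 3 = B 1 3) (h14 : A 1 4 = B 1 4) (h23 : A 2 3 = B 2 3)
    (h24 : A 2 4 = B 2 4) (h34 : A 3 4 = B 3 4) : A = B := by
  have hs := skew_apply hA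
  have ks := skew_apply hB
  have hd : ∀ i, A i i = B i i := fun i => by linarith [hs i i, ks i i]
  have hl : ∀ {i j}, A i j = B i j → A j i = B j i := fun {i j} h => by rw [hs j i, h, ← ks]
  ext i j
  fin_cases i <;> fin_cases j
  exacts [hd 0, h01, h02, h03, h04, hl h01, hd 1, h12, h13, h14, hl h02, hl h12, hd 2, h23, h24,
    hl h03, hl h13, hl h23, hd 3, h34, hl h04, hl h14, hl h24, hl h34, hd 4]

lemma orbitForm_skew (u : Fin 3 → ℝ) (w : Fin 2 → ℝ) (c : ℝ) :
    (orbitForm u w c)ᵀ = -orbitForm u w c := by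
  ext i j; fin_cases i <;> fin_cases j <;> simp [orbitForm]

/-- Rotations of `ℝ³` commute with `⋆`, and rotations of `ℝ²` commute with `J` and preserve `e⁴⁵`.
The first fact is the equality of the adjugate and the transpose of `h`, used through its
contractions `f0`, `f1`, `f2` with `u`. -/
lemma orbitForm_conj {h : Matrix (Fin 3) (Fin 3) ℝ} {k : Matrix (Fin 2) (Fin 2) ℝ}
    (hh : h ∈ Matrix.specialOrthogonalGroup (Fin 3) ℝ)
    (hk : k ∈ Matrix.specialOrthogonalGroup (Fin 2) ℝ) (u : Fin 3 → ℝ) (w : Fin 2 → ℝ) (c : ℝ) :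
    blockEmbed h k * orbitForm u w c * (blockEmbed h k)ᵀ = orbitForm (h *ᵥ u) (k *ᵥ w) c := by
  obtain ⟨k00, k01, hd⟩ := special_two hk
  have h3 := adjugate_of_special hh
  rw [adjugate_fin_three] at h3
  have e := fun i j => congrFun (congrFun h3 i) j
  have e00 := e 0 0
  have e01 := e 0 1
  have e02 := e 0 2
  have e10 := e 1 0
  have e11 := e 1 1
  have e12 := e 1 2
  have e20 := e 2 0
  have e21 := e 2 1
  have e22 := e 2 2
  simp at e00 e01 e02 e10 e11 e12 e20 e21 e22
  have f0 := congrArg₂ (· + ·) (congrArg₂ (· + ·) (congrArg (u 0 * ·) e00)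
    (congrArg (u 1 * ·) e10)) (congrArg (u 2 * ·) e20)
  have f1 := congrArg₂ (· + ·) (congrArg₂ (· + ·) (congrArg (u 0 * ·) e01)
    (congrArg (u 1 * ·) e11)) (congrArg (u 2 * ·) e21)
  have f2 := congrArg₂ (· + ·) (congrArg₂ (· + ·) (congrArg (u 0 * ·) e02)
    (congrArg (u 1 * ·) e12)) (congrArg (u 2 * ·) e22)
  have f3 := congrArg (c * ·) hd
  clear e e00 e01 e02 e10 e11 e12 e20 e21 e22 h3
  beta_reduce at f0 f1 f2 f3
  refine ext_of_skew ?_ (orbitForm_skew _ _ _) ?_ ?_ ?_ ?_ ?_ ?_ ?_ ?_ ?_ ?_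
  · rw [transpose_conj, orbitForm_skew]; simp
  all_goals
    simp only [blockEmbed_eq, orbitForm, Matrix.mul_apply, Fin.sum_univ_five, mulVec, dotProduct,
      Fin.sum_univ_three, Fin.sum_univ_two, transpose_apply, of_apply, cons_val, k00, k01]
  · linear_combination f2
  · linear_combination -f1
  · ring
  · ring
  · linear_combination f0
  · ring
  · ring
  · ring
  · ring
  · linear_combination -f3

lemma act_orbitPoint {h : Matrix (Fin 3) (Fin 3) ℝ} {k : Matrix (Fin 2) (Fin 2) ℝ}
    (hh : h ∈ Matrix.specialOrthogonalGroup (Fin 3) ℝ)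
    (hk : k ∈ Matrix.specialOrthogonalGroup (Fin 2) ℝ) (u : Fin 3 → ℝ) (w : Fin 2 → ℝ)
    (c a : ℝ) :
    act (blockEmbed h k) (orbitPoint u w c a) = orbitPoint (h *ᵥ u) (k *ᵥ w) c a := by
  refine Prod.ext ?_ ?_
  · have := blockEmbed_mulVec h k (c • u) w
    simpa [act, orbitPoint, mulVec_smul] using this
  · simp only [act, orbitPoint, Matrix.mul_smul, Matrix.smul_mul, orbitForm_conj hh hk]

lemma act_orbitPointDeriv {h : Matrix (Fin 3) (Fin 3) ℝ} {k : Matrix (Fin 2) (Fin 2) ℝ}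
    (hh : h ∈ Matrix.specialOrthogonalGroup (Fin 3) ℝ)
    (hk : k ∈ Matrix.specialOrthogonalGroup (Fin 2) ℝ) (u : Fin 3 → ℝ) (w : Fin 2 → ℝ)
    (c a : ℝ) (u' : Fin 3 → ℝ) (w' : Fin 2 → ℝ) (c' a' : ℝ) :
    act (blockEmbed h k) (orbitPointDeriv u w c a u' w' c' a')
      = orbitPointDeriv (h *ᵥ u) (k *ᵥ w) c a (h *ᵥ u') (k *ᵥ w') c' a' := by
  refine Prod.ext ?_ ?_
  · have := blockEmbed_mulVec h k (c' • u + c • u') w'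
    simpa [act, orbitPointDeriv, mulVec_smul, mulVec_add] using this
  · simp only [act, orbitPointDeriv, orbitFormDeriv_eq, Matrix.mul_smul, Matrix.smul_mul,
      Matrix.mul_add, Matrix.add_mul, Matrix.mul_sub, Matrix.sub_mul, orbitForm_conj hh hk,
      mulVec_zero]

/-- Where the last coordinate vanishes the frame needs no normalisation, and `ω₁` can be read off
from its entries, with `c² + s² = 1`. -/
lemma fibrePoint_eq {c : ℝ} (hc : 0 ≤ 1 - c ^ 2) (a : ℝ) :
    fibrePoint ![c, 0, 0, √(1 - c ^ 2), 0] ![a, 0, 0]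
    = orbitPoint ![1, 0, 0] ![√(1 - c ^ 2), 0] c a := by
  have hs := Real.mul_self_sqrt hc
  refine Prod.ext ?_ ?_
  · funext i; fin_cases i <;> simp [fibrePoint, orbitPoint]
  · ext i j
    fin_cases i <;> fin_cases j <;>
      simp [fibrePoint, orbitPoint, orbitForm, omega, frameForm, frame, Fin.sum_univ_three] <;>
      first
        | exact Or.inr (by ring)
        | linear_combination a * hs
        | linear_combination -a * hs

/-- The set `orbitSet` in coordinates. -/
lemma mem_orbitSet {lam C : ℝ} {S : Set ℝ} {p : Ambient} : p ∈ orbitSet lam C S ↔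
    ∃ (u : Fin 3 → ℝ) (w : Fin 2 → ℝ) (c a : ℝ), u ⬝ᵥ u = 1 ∧ 0 < c ∧ c ^ 2 + w ⬝ᵥ w = 1 ∧
      a ∈ S ∧ G lam a c = C ∧ p = orbitPoint u w c a := by
  constructor
  · rintro ⟨h, hh, k, hk, a, ha, c, hc, hc1, hG, rfl⟩
    refine ⟨h *ᵥ ![1, 0, 0], k *ᵥ ![√(1 - c ^ 2), 0], c, a, ?_, hc, ?_, ha, hG, ?_⟩
    · rw [dotProduct_mulVec_special hh]
      simp
    · have : 0 ≤ 1 - c ^ 2 := by nlinarith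
      rw [dotProduct_mulVec_special hk]
      simp [Real.mul_self_sqrt this]
    · have : 0 ≤ 1 - c ^ 2 := by nlinarith
      rw [fibrePoint_eq this, act_orbitPoint hh hk]
  · rintro ⟨u, w, c, a, hu, hc, hw, ha, hG, rfl⟩
    obtain ⟨h, hh, hhu⟩ := exists_special_mulVec u hu
    obtain ⟨k, hk, hkw⟩ := exists_special_mulVec_norm w
    refine ⟨h, hh, k, hk, a, ha, c, hc, ?_, hG, ?_⟩
    · nlinarith [dotProduct_self_nonneg w]
    · have : 0 ≤ 1 - c ^ 2 := by linarith [dotProduct_self_nonneg w]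
      rw [fibrePoint_eq this, act_orbitPoint hh hk, show 1 - c ^ 2 = w ⬝ᵥ w by linarith, hkw, ← hhu]
      congr 2
      funext i; fin_cases i <;> rfl

/-! ### Tangent planes -/

/-- The rotation in the `(x₁, x₄)`-plane. -/
def rotation (c s : ℝ) : Matrix (Fin 5) (Fin 5) ℝ :=
  !![c, 0, 0, -s, 0; 0, 1, 0, 0, 0; 0, 0, 1, 0, 0; s, 0, 0, c, 0; 0, 0, 0, 0, 1]

lemma rotation_mem {c s : ℝ} (h : c ^ 2 + s ^ 2 = 1) :
    rotation c s ∈ Matrix.specialOrthogonalGroup (Fin 5) ℝ := by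
  refine mem_special_of ?_ ?_
  · ext i j
    fin_cases i <;> fin_cases j <;>
      simp [rotation, Matrix.mul_apply, Fin.sum_univ_five] <;> linarith
  · simp [rotation, det_succ_row_zero, Fin.sum_univ_succ, Fin.succAbove]
    linarith

lemma act_rotation_basePoint (c s a : ℝ) :
    act (rotation c s) (basePoint a) = orbitPoint ![1, 0, 0] ![s, 0] c a := by
  refine Prod.ext ?_ ?_
  · funext i
    fin_cases i <;>
      simp [act, rotation, basePoint, orbitPoint]
  · refine ext_of_skew ?_ ?_ ?_ ?_ ?_ ?_ ?_ ?_ ?_ ?_ ?_ ?_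
    · simp only [act, basePoint]
      rw [transpose_conj, baseForm_skew]
      simp
    · simp only [orbitPoint]
      rw [transpose_smul, orbitForm_skew, smul_neg]
    all_goals
      simp only [act, rotation, basePoint, baseForm, orbitPoint, orbitForm, Matrix.mul_apply,
        Fin.sum_univ_five, transpose_apply, of_apply, cons_val, Matrix.smul_apply, smul_eq_mul]
      ring

lemma orbitFormDeriv_skew (u : Fin 3 → ℝ) (w : Fin 2 → ℝ) (u' : Fin 3 → ℝ) (w' : Fin 2 → ℝ)
    (c' : ℝ) : (orbitFormDeriv u w u' w' c')ᵀ = -orbitFormDeriv u w u' w' c' := by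
  rw [orbitFormDeriv_eq, transpose_add, transpose_sub]
  simp only [orbitForm_skew]
  abel

/-- Here `β`, `γ` are the velocities of `u` in `S²`, `τ` is the angular velocity of the pair (`c`,
length of `w`), `θ` is the velocity of `w` across its own direction, and `α` is the velocity of `a`.
These are the directions that `planeCoords` combines. -/
lemma act_rotation_baseTangent (c s a : ℝ) (h : c ^ 2 + s ^ 2 = 1) (α β γ τ θ : ℝ) :
    act (rotation c s) (baseTangent a ![α, a * s * γ, a * s * β, c * β, c * γ, τ, θ])
      = orbitPointDeriv ![1, 0, 0] ![s, 0] c a ![0, β, γ] ![c * τ, θ] (-(s * τ)) α := by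
  refine Prod.ext ?_ ?_
  · funext i
    fin_cases i <;>
      simp [act, rotation, baseTangent, orbitPointDeriv, mul_comm]
  · refine ext_of_skew ?_ ?_ ?_ ?_ ?_ ?_ ?_ ?_ ?_ ?_ ?_ ?_
    · simp only [act]
      rw [transpose_conj, baseTangent_skew]
      simp
    · simp only [orbitPointDeriv]
      rw [transpose_add, transpose_smul, transpose_smul, orbitForm_skew, orbitFormDeriv_skew,
        smul_neg, smul_neg, neg_add]
    all_goals
      simp only [act, rotation, baseTangent, LinearMap.coe_mk, AddHom.coe_mk, orbitPointDeriv,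
        orbitForm, orbitFormDeriv, Matrix.mul_apply, Fin.sum_univ_five, transpose_apply, of_apply,
        cons_val, Matrix.smul_apply, Matrix.add_apply, smul_eq_mul]
      first
        | ring1
        | linear_combination (a * γ) * h
        | linear_combination (-a * γ) * h
        | linear_combination (a * β) * h
        | linear_combination (-a * β) * h
        | linear_combination (a * τ) * h
        | linear_combination (-a * τ) * h
        | linear_combination (a * θ) * h
        | linear_combination (-a * θ) * h

/-- The velocities of curves in `M_C` lie in a coassociative plane. -/
lemma exists_plane {lam : ℝ} (hlam : 0 < lam) {u : Fin 3 → ℝ} {w : Fin 2 → ℝ} {c : ℝ} (a : ℝ)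
    (hu : u ⬝ᵥ u = 1) (hc : 0 < c) (hw : c ^ 2 + w ⬝ᵥ w = 1) :
    ∃ W : Submodule ℝ Ambient, IsCoassociativePlane lam (orbitPoint u w c a) W ∧
      ∀ (u' : Fin 3 → ℝ) (w' : Fin 2 → ℝ) (c' a' : ℝ), u ⬝ᵥ u' = 0 → c * c' + w ⬝ᵥ w' = 0 →
        (2 * (lam + a ^ 2) * c ^ 2 - a ^ 2 * (w ⬝ᵥ w)) * a'
          = 4 * a * (lam + a ^ 2) * (w ⬝ᵥ w') →
        orbitPointDeriv u w c a u' w' c' a' ∈ W := by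
  obtain ⟨h, hh, hhu⟩ := exists_special_mulVec u hu
  obtain ⟨k, hk, hkw⟩ := exists_special_mulVec_norm w
  set s := √(w ⬝ᵥ w) with hs
  have hss : s ^ 2 = w ⬝ᵥ w := Real.sq_sqrt (dotProduct_self_nonneg w)
  have hcs : c ^ 2 + s ^ 2 = 1 := by rw [hss, hw]
  have hg := Submonoid.mul_mem _ (blockEmbed_mem hh hk) (rotation_mem hcs)
  have he : (Pi.single 0 1 : Fin 3 → ℝ) = ![1, 0, 0] := by
    funext i; fin_cases i <;> rfl
  rw [he] at hhu
  have hp : act (blockEmbed h k * rotation c s) (basePoint a) = orbitPoint u w c a := by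
    rw [← act_act, act_rotation_basePoint c s a, act_orbitPoint hh hk, hhu, hkw]
  refine ⟨(basePlane lam a c s).map (actLin (blockEmbed h k * rotation c s)), ?_, ?_⟩
  · rw [← hp]
    exact (isCoassociativePlane_basePlane hlam a hc s).act hg
  · intro u' w' c' a' hu' hw' ha'
    have hhu' : h *ᵥ (hᵀ *ᵥ u') = u' := by
      rw [mulVec_mulVec, mul_transpose_of_special hh, one_mulVec]
    have hkw' : k *ᵥ (kᵀ *ᵥ w') = w' := by
      rw [mulVec_mulVec, mul_transpose_of_special hk, one_mulVec]
    set v := hᵀ *ᵥ u' with hv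
    set z := kᵀ *ᵥ w' with hz
    have hv0 : v 0 = 0 := by
      rw [← hhu, ← hhu', dotProduct_mulVec_special hh] at hu'
      simpa [dotProduct, Fin.sum_univ_three] using hu'
    have hz0 : w ⬝ᵥ w' = s * z 0 := by
      rw [← hkw', ← hkw, dotProduct_mulVec_special hk]
      simp [dotProduct]
    rw [hz0] at hw' ha'
    rw [← hss] at ha'
    have hv' : v = ![0, v 1, v 2] := by
      funext i; fin_cases i
      exacts [hv0, rfl, rfl]
    have hz' : z = ![c * (z 0 / c), z 1] := by
      funext i; fin_cases i
      · simp [mul_div_cancel₀ _ hc.ne']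
      · rfl
    have hc' : c' = -(s * (z 0 / c)) := by
      field_simp
      linarith
    have key : act (blockEmbed h k * rotation c s) (baseTangent a
        ![a', a * s * v 2, a * s * v 1, c * v 1, c * v 2, z 0 / c, z 1])
        = orbitPointDeriv u w c a u' w' c' a' := by
      rw [← act_act, act_rotation_baseTangent c s a hcs, ← hv', ← hz', ← hc',
        act_orbitPointDeriv hh hk, hhu, hkw, hhu', hkw']
    rw [← key]
    refine Submodule.mem_map_of_mem ?_
    -- The linearised equation for `G` says that `(a', z 0 / c)` is proportional to the two entries
    -- of the fourth vector of `planeCoords`. The factor `t` is found by dividing by whichever entry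
    -- is nonzero.
    obtain ⟨t, ht1, ht2⟩ : ∃ t, t * (4 * (a * s) * c * (lam + a ^ 2)) = a' ∧
        t * (2 * (lam + a ^ 2) * c ^ 2 - (a * s) ^ 2) = z 0 / c := by
      by_cases h0 : 2 * (lam + a ^ 2) * c ^ 2 - (a * s) ^ 2 = 0
      · have h1 := planeCoords_ne_zero hlam a hc s h0
        refine ⟨a' / (4 * (a * s) * c * (lam + a ^ 2)), div_mul_cancel₀ _ h1, ?_⟩
        have h2 : 4 * a * (lam + a ^ 2) * (s * z 0) = 0 := by
          rw [← ha']
          linear_combination a' * h0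
        have h3 : z 0 * (4 * (a * s) * c * (lam + a ^ 2)) = 0 := by
          linear_combination c * h2
        rw [h0, (mul_eq_zero.1 h3).resolve_right h1]
        simp
      · refine ⟨z 0 / c / (2 * (lam + a ^ 2) * c ^ 2 - (a * s) ^ 2), ?_, div_mul_cancel₀ _ h0⟩
        rw [div_mul_eq_mul_div, div_eq_iff h0]
        linear_combination (4 * a * s * (lam + a ^ 2)) * div_mul_cancel₀ (z 0) hc.ne' - ha'
    have hy : baseTangent a ![a', a * s * v 2, a * s * v 1, c * v 1, c * v 2, z 0 / c, z 1]
        = ∑ i, (![v 1, v 2, z 1, t] : Fin 4 → ℝ) i • baseTangent a (planeCoords lam a c s i) := by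
      simp only [← map_smul, ← map_sum]
      congr 1
      funext i
      simp only [Finset.sum_apply, Pi.smul_apply, Fin.sum_univ_four, planeCoords, smul_eq_mul,
        cons_val]
      fin_cases i <;> simp only [Fin.zero_eta, Fin.mk_one, Fin.reduceFinMk, cons_val] <;>
        first
          | ring1
          | linear_combination -ht1
          | linear_combination -ht2
    rw [hy]
    exact Submodule.sum_mem _ fun i _ => Submodule.smul_mem _ _ (Submodule.subset_span ⟨i, rfl⟩)

lemma plane_of_range_le {lam : ℝ} {p : Ambient} {W : Submodule ℝ Ambient}
    (hW : IsCoassociativePlane lam p W) {L : (Fin 4 → ℝ) →ₗ[ℝ] Ambient}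
    (hL : Function.Injective L) (hLW : LinearMap.range L ≤ W) :
    IsCoassociativePlane lam p (LinearMap.range L) := by
  have : LinearMap.range L = W := by
    refine Submodule.eq_of_le_of_finrank_eq hLW ?_
    rw [LinearMap.finrank_range_of_inj hL, hW.2.1, Module.finrank_fin_fun]
  rwa [this]

lemma hasDerivAt_orbitPoint {u : ℝ → Fin 3 → ℝ} {w : ℝ → Fin 2 → ℝ} {c a : ℝ → ℝ}
    {u' : Fin 3 → ℝ} {w' : Fin 2 → ℝ} {c' a' t : ℝ} (hu : HasDerivAt u u' t)
    (hw : HasDerivAt w w' t) (hc : HasDerivAt c c' t) (ha : HasDerivAt a a' t) :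
    HasDerivAt (fun t => orbitPoint (u t) (w t) (c t) (a t))
      (orbitPointDeriv (u t) (w t) (c t) (a t) u' w' c' a') t := by
  have hu := hasDerivAt_pi.1 hu
  have hw := hasDerivAt_pi.1 hw
  have hform : HasDerivAt (fun t => orbitForm (u t) (w t) (c t))
      (orbitFormDeriv (u t) (w t) u' w' c') t := by
    refine hasDerivAt_pi.2 fun i => hasDerivAt_pi.2 fun j => ?_
    fin_cases i <;> fin_cases j <;>
      first
        | exact hasDerivAt_const t 0
        | exact hu 0
        | exact hu 1
        | exact hu 2
        | exact (hu 0).neg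
        | exact (hu 1).neg
        | exact (hu 2).neg
        | exact hc
        | exact hc.neg
        | exact (hu 0).mul (hw 0)
        | exact (hu 1).mul (hw 0)
        | exact (hu 2).mul (hw 0)
        | exact (hu 0).mul (hw 1)
        | exact (hu 1).mul (hw 1)
        | exact (hu 2).mul (hw 1)
        | exact ((hu 0).mul (hw 0)).neg
        | exact ((hu 1).mul (hw 0)).neg
        | exact ((hu 2).mul (hw 0)).neg
        | exact ((hu 0).mul (hw 1)).neg
        | exact ((hu 1).mul (hw 1)).neg
        | exact ((hu 2).mul (hw 1)).neg
  refine HasDerivAt.prodMk (hasDerivAt_pi.2 fun i => ?_) (ha.smul hform)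
  fin_cases i
  exacts [hc.mul (hu 0), hc.mul (hu 1), hc.mul (hu 2), hw 0, hw 1]

/-! ### Local parametrisations -/

/-- `L` is a coassociative submanifold near `p`. -/
def IsCoassociativeAt (lam : ℝ) (L : Set Ambient) (p : Ambient) : Prop :=
  ∃ (V : Set (Fin 4 → ℝ)) (ψ : (Fin 4 → ℝ) → Ambient),
    IsLocalParametrization L V ψ ∧ p ∈ ψ '' V ∧
      ∀ q ∈ V, IsCoassociativePlane lam (ψ q) (LinearMap.range (fderiv ℝ ψ q).toLinearMap)

/-- Being coassociative is local. -/
lemma IsCoassociativeAt.congr {lam : ℝ} {L L' O' : Set Ambient} {p : Ambient}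
    (h : IsCoassociativeAt lam L p) (hO' : IsOpen O') (hp : p ∈ O') (hL : L ∩ O' = L' ∩ O') :
    IsCoassociativeAt lam L' p := by
  obtain ⟨V, ψ, ⟨hV, hψ, hinj, hemb, O, hO, himg⟩, ⟨q, hq, rfl⟩, hplane⟩ := h
  refine ⟨V ∩ ψ ⁻¹' O', ψ, ⟨hψ.continuousOn.isOpen_inter_preimage hV hO',
    hψ.mono Set.inter_subset_left, fun q hq => hinj q hq.1,
    hemb.comp (Topology.IsEmbedding.inclusion Set.inter_subset_left), O ∩ O', hO.inter hO', ?_⟩,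
    ⟨q, ⟨hq, hp⟩, rfl⟩, fun q hq => hplane q hq.1⟩
  rw [Set.image_inter_preimage, himg]
  calc L ∩ O ∩ O' = L ∩ O' ∩ O := by rw [Set.inter_right_comm]
    _ = L' ∩ (O ∩ O') := by rw [hL, Set.inter_assoc, Set.inter_comm O']

lemma IsCoassociativeAt.act {lam : ℝ} {L : Set Ambient} {p : Ambient}
    {g : Matrix (Fin 5) (Fin 5) ℝ} (hg : g ∈ Matrix.specialOrthogonalGroup (Fin 5) ℝ)
    (h : IsCoassociativeAt lam L p) : IsCoassociativeAt lam (act g '' L) (act g p) := by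
  obtain ⟨V, ψ, ⟨hV, hψ, hinj, hemb, O, hO, himg⟩, ⟨q, hq, rfl⟩, hplane⟩ := h
  let A : Ambient ≃L[ℝ] Ambient := (actEquiv hg).toContinuousLinearEquiv
  have hA : ∀ p, A p = BryantSalamon.act g p := fun p => rfl
  have hfd : ∀ q, fderiv ℝ (fun q => BryantSalamon.act g (ψ q)) q
      = (A : Ambient →L[ℝ] Ambient).comp (fderiv ℝ ψ q) := fun q => A.comp_fderiv
  refine ⟨V, fun q => BryantSalamon.act g (ψ q), ⟨hV, A.contDiff.comp_contDiffOn hψ, ?_, ?_,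
    A '' O, A.toHomeomorph.isOpenMap O hO, ?_⟩, ⟨q, hq, rfl⟩, ?_⟩
  · intro q hq
    rw [hfd]
    exact A.injective.comp (hinj q hq)
  · exact A.toHomeomorph.isEmbedding.comp hemb
  · change (fun q => A (ψ q)) '' V = A '' L ∩ A '' O
    rw [← Set.image_inter A.injective, ← himg, Set.image_image]
  · intro q hq
    have := (hplane q hq).act hg
    rw [hfd]
    convert this using 1
    ext U
    simp only [LinearMap.mem_range, Submodule.mem_map]
    constructor
    · rintro ⟨v, rfl⟩
      exact ⟨_, ⟨v, rfl⟩, rfl⟩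
    · rintro ⟨_, ⟨v, rfl⟩, rfl⟩
      exact ⟨v, rfl⟩

/-- A smooth map with a differentiable left inverse is a local parametrisation. -/
lemma isLocalParametrization_of_leftInverse {L : Set Ambient} {V : Set (Fin 4 → ℝ)}
    {ψ : (Fin 4 → ℝ) → Ambient} (hV : IsOpen V) (hψ : ContDiffOn ℝ ∞ ψ V)
    (ξ : Ambient → Fin 4 → ℝ) (hξ : ∀ q ∈ V, ξ (ψ q) = q)
    (hd : ∀ q ∈ V, DifferentiableAt ℝ ξ (ψ q))
    (hO : ∃ O : Set Ambient, IsOpen O ∧ ψ '' V = L ∩ O) : IsLocalParametrization L V ψ := by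
  refine ⟨hV, hψ, fun q hq => ?_, ⟨⟨?_⟩, ?_⟩, hO⟩
  · have h1 : HasFDerivAt ψ (fderiv ℝ ψ q) q :=
      ((hψ.contDiffAt (hV.mem_nhds hq)).differentiableAt (by simp)).hasFDerivAt
    -- By the chain rule for `ξ ∘ ψ = id`, the derivative of `ξ` is a left inverse of that of `ψ`.
    have h2 := (hd q hq).hasFDerivAt.comp q h1
    have h3 : HasFDerivAt (ξ ∘ ψ) (ContinuousLinearMap.id ℝ (Fin 4 → ℝ)) q :=
      (hasFDerivAt_id q).congr_of_eventuallyEq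
        (Filter.eventually_of_mem (hV.mem_nhds hq) fun x hx => hξ x hx)
    have h4 := h2.unique h3
    exact Function.LeftInverse.injective (g := fderiv ℝ ξ (ψ q)) fun v =>
      congrArg (fun T : (Fin 4 → ℝ) →L[ℝ] (Fin 4 → ℝ) => T v) h4
  · refine (Topology.isInducing_iff_nhds.2 fun q => le_antisymm ?_ ?_).eq_induced
    · exact ((continuousOn_iff_continuous_domRestrict.1 hψ.continuousOn).tendsto q).le_comap
    · have hc := (hd q q.2).continuousAt.tendsto
      rw [hξ q q.2] at hc
      rw [nhds_subtype_eq_comap]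
      calc Filter.comap (V.domRestrict ψ) (nhds (V.domRestrict ψ q))
          ≤ Filter.comap (V.domRestrict ψ) (Filter.comap ξ (nhds (q : Fin 4 → ℝ))) :=
            Filter.comap_mono hc.le_comap
        _ = Filter.comap (Subtype.val) (nhds (q : Fin 4 → ℝ)) := by
            rw [Filter.comap_comap]
            congr 1
            funext x
            exact hξ x x.2
  · intro x y hxy
    refine Subtype.ext ?_
    rw [← hξ x x.2, ← hξ y y.2]
    exact congrArg ξ hxy

lemma hasDerivAt_dotProduct {n : ℕ} {u v : ℝ → Fin n → ℝ} {u' v' : Fin n → ℝ} {t : ℝ}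
    (hu : HasDerivAt u u' t) (hv : HasDerivAt v v' t) :
    HasDerivAt (fun t => u t ⬝ᵥ v t) (u' ⬝ᵥ v t + u t ⬝ᵥ v') t := by
  have := HasDerivAt.fun_sum (u := Finset.univ) fun i _ =>
    (hasDerivAt_pi.1 hu i).mul (hasDerivAt_pi.1 hv i)
  rw [Finset.sum_add_distrib] at this
  exact this

lemma eventually_line {E : Type*} [NormedAddCommGroup E] [NormedSpace ℝ E] {q : E} (v : E)
    {P : E → Prop} (h : ∀ᶠ x in nhds q, P x) : ∀ᶠ t : ℝ in nhds 0, P (q + t • v) := by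
  have : Filter.Tendsto (fun t : ℝ => q + t • v) (nhds 0) (nhds q) := by
    have hc : Continuous fun t : ℝ => q + t • v := by fun_prop
    simpa using hc.tendsto 0
  exact this.eventually h

/-- The tangent planes of a submanifold parametrised by `orbitPoint` on which `G` is constant. -/
lemma isCoassociativePlane_of_orbitPoint {lam : ℝ} (hlam : 0 < lam) {C : ℝ}
    {ψ : (Fin 4 → ℝ) → Ambient} {u : (Fin 4 → ℝ) → Fin 3 → ℝ} {w : (Fin 4 → ℝ) → Fin 2 → ℝ}
    {c a : (Fin 4 → ℝ) → ℝ} {q : Fin 4 → ℝ} (hdu : DifferentiableAt ℝ u q)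
    (hdw : DifferentiableAt ℝ w q) (hdc : DifferentiableAt ℝ c q) (hda : DifferentiableAt ℝ a q)
    (hψ : DifferentiableAt ℝ ψ q)
    (hev : ∀ᶠ x in nhds q, ψ x = orbitPoint (u x) (w x) (c x) (a x) ∧ u x ⬝ᵥ u x = 1 ∧
      c x ^ 2 + w x ⬝ᵥ w x = 1 ∧ G lam (a x) (c x) = C)
    (hc : 0 < c q) (hinj : Function.Injective (fderiv ℝ ψ q)) :
    IsCoassociativePlane lam (ψ q) (LinearMap.range (fderiv ℝ ψ q).toLinearMap) := by
  obtain ⟨hψq, huq, hcq, hGq⟩ := hev.self_of_nhds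
  obtain ⟨W, hW, hmem⟩ := exists_plane hlam (a q) huq hc hcq
  rw [← hψq] at hW
  refine plane_of_range_le hW hinj ?_
  rintro _ ⟨v, rfl⟩
  have hline := eventually_line v hev
  have hu := hdu.hasFDerivAt.hasLineDerivAt v
  have hw := hdw.hasFDerivAt.hasLineDerivAt v
  have hc' := hdc.hasFDerivAt.hasLineDerivAt v
  have ha := hda.hasFDerivAt.hasLineDerivAt v
  have hp := hψ.hasFDerivAt.hasLineDerivAt v
  unfold HasLineDerivAt at hu hw hc' ha hp
  set u' := fderiv ℝ u q v
  set w' := fderiv ℝ w q v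
  set c' := fderiv ℝ c q v
  set a' := fderiv ℝ a q v
  have e1 : fderiv ℝ ψ q v = orbitPointDeriv (u q) (w q) (c q) (a q) u' w' c' a' := by
    have h1 := hasDerivAt_orbitPoint hu hw hc' ha
    have h2 := hp.congr_of_eventuallyEq (hline.mono fun t ht => ht.1.symm)
    have h3 := h1.unique h2
    simp only [zero_smul, add_zero] at h3
    exact h3.symm
  have e2 : u q ⬝ᵥ u' = 0 := by
    have h1 := hasDerivAt_dotProduct hu hu
    have h2 := (hasDerivAt_const (0 : ℝ) (1 : ℝ)).congr_of_eventuallyEq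
      (hline.mono fun t ht => ht.2.1)
    have h3 := h1.unique h2
    simp only [zero_smul, add_zero] at h3
    rw [dotProduct_comm u'] at h3
    linarith
  have e3 : c q * c' + w q ⬝ᵥ w' = 0 := by
    have h1 := (hc'.pow 2).add (hasDerivAt_dotProduct hw hw)
    have h2 := (hasDerivAt_const (0 : ℝ) (1 : ℝ)).congr_of_eventuallyEq
      (hline.mono fun t ht => ht.2.2.1)
    have h3 := h1.unique h2
    simp only [zero_smul, add_zero] at h3
    rw [dotProduct_comm w'] at h3
    simp only [Nat.cast_ofNat, Nat.reduceSub, pow_one] at h3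
    linarith
  have e4 : (2 * (lam + a q ^ 2) * c q ^ 2 - a q ^ 2 * (w q ⬝ᵥ w q)) * a'
      = 4 * a q * (lam + a q ^ 2) * (w q ⬝ᵥ w') := by
    -- Differentiation of `P(a) - 2 a s (1 - c²) = C`. Clearing the denominator `s³`, with `s⁴ = λ +
    -- a²` and `c c' = -w · w'`, gives the relation required by `exists_plane`.
    have hP := (hasDerivAt_primP hlam (a (q + (0 : ℝ) • v))).comp 0 ha
    have hS := (hasDerivAt_sRad hlam (a (q + (0 : ℝ) • v))).comp 0 ha
    have h1 := hP.sub (((ha.const_mul 2).mul hS).mul ((hc'.pow 2).const_sub 1))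
    have h2 := (hasDerivAt_const (0 : ℝ) C).congr_of_eventuallyEq
      (hline.mono fun t ht => by rw [← ht.2.2.2, G_eq hlam])
    have h3 := h1.unique h2
    have hs := sRad_pos hlam (a q)
    have h4 := sRad_pow_four hlam (a q)
    have hcw : w q ⬝ᵥ w q = 1 - c q ^ 2 := by linarith
    have hcw' : w q ⬝ᵥ w' = -(c q * c') := by linarith
    simp at h3
    rw [← h4, hcw, hcw']
    field_simp at h3
    linear_combination h3
  change fderiv ℝ ψ q v ∈ W
  rw [e1]
  exact hmem u' w' c' a' e2 e3 e4

/-! ### The zero section -/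

lemma isCoassociative_iff {lam : ℝ} {L : Set Ambient} :
    IsCoassociative lam L ↔ L ⊆ Y ∧ ∀ p ∈ L, IsCoassociativeAt lam L p := Iff.rfl

lemma basePoint_zero : basePoint 0 = (Pi.single 0 1, 0) := by
  refine Prod.ext ?_ ?_
  · funext i; fin_cases i <;> simp [basePoint]
  · ext i j; fin_cases i <;> fin_cases j <;> simp [basePoint, baseForm]

lemma exists_special_basePoint {x : Fin 5 → ℝ} (hx : x ⬝ᵥ x = 1) :
    ∃ g ∈ Matrix.specialOrthogonalGroup (Fin 5) ℝ, g *ᵥ Pi.single 0 1 = x ∧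
      act g (basePoint 0) = (x, 0) := by
  obtain ⟨g, hg, hgx⟩ := exists_special_mulVec x hx
  exact ⟨g, hg, hgx, by simp only [basePoint_zero, act, hgx, Matrix.mul_zero, Matrix.zero_mul]⟩

lemma zeroSection_subset_Y : zeroSection ⊆ Y := by
  rintro ⟨x, A⟩ ⟨hx, hA⟩
  obtain ⟨g, hg, -, hgx⟩ := exists_special_basePoint hx
  rw [show (x, A) = act g (basePoint 0) from (Prod.ext rfl hA : (x, A) = (x, 0)).trans hgx.symm]
  exact act_mem_Y hg (basePoint_mem_Y 0)

/-- For `a = 0`, `c = 1`, `s = 0` the calibrated plane degenerates to the horizontal space, the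
tangent space of the zero section. Its fourth spanning vector then has length `2λ`, whence the
divisor. -/
lemma baseTangent_mem_basePlane {lam : ℝ} (hlam : 0 < lam) (h : Fin 5 → ℝ) :
    baseTangent 0 ![0, 0, 0, h 1, h 2, h 3, h 4] ∈ basePlane lam 0 1 0 := by
  have hy : baseTangent 0 ![0, 0, 0, h 1, h 2, h 3, h 4]
      = ∑ i, (![h 1, h 2, h 4, h 3 / (2 * lam)] : Fin 4 → ℝ) i •
        baseTangent 0 (planeCoords lam 0 1 0 i) := by
    simp only [← map_smul, ← map_sum]
    congr 1
    funext i
    fin_cases i <;> simp [Fin.sum_univ_four, planeCoords, hlam.ne']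
  rw [hy]
  exact Submodule.sum_mem _ fun i _ => Submodule.smul_mem _ _ (Submodule.subset_span ⟨i, rfl⟩)

lemma exists_plane_zeroSection {lam : ℝ} (hlam : 0 < lam) {x : Fin 5 → ℝ} (hx : x ⬝ᵥ x = 1) :
    ∃ W : Submodule ℝ Ambient, IsCoassociativePlane lam (x, 0) W ∧
      ∀ x', x ⬝ᵥ x' = 0 → ((x', 0) : Ambient) ∈ W := by
  obtain ⟨g, hg, hgx, hgp⟩ := exists_special_basePoint hx
  refine ⟨(basePlane lam 0 1 0).map (actLin g), ?_, fun x' hx' => ?_⟩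
  · rw [← hgp]
    exact (isCoassociativePlane_basePlane hlam 0 one_pos 0).act hg
  · have hgx' : g *ᵥ (gᵀ *ᵥ x') = x' := by
      rw [mulVec_mulVec, mul_transpose_of_special hg, one_mulVec]
    set h := gᵀ *ᵥ x'
    have h0 : h 0 = 0 := by
      rw [← hgx, ← hgx', dotProduct_mulVec_special hg] at hx'
      simpa using hx'
    refine ⟨_, baseTangent_mem_basePlane hlam h, ?_⟩
    have h1 : (![0, h 1, h 2, h 3, h 4] : Fin 5 → ℝ) = h := by
      funext i; fin_cases i <;> simp [h0]
    have h2 : baseTangent 0 ![0, 0, 0, h 1, h 2, h 3, h 4] = (h, 0) := by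
      refine Prod.ext ?_ ?_
      · exact h1
      · ext i j; fin_cases i <;> fin_cases j <;> simp [baseTangent]
    rw [h2]
    change (g *ᵥ h, g * 0 * gᵀ) = _
    rw [hgx', Matrix.mul_zero, Matrix.zero_mul]

/-- The parametrisation of the hemisphere `x₁ > 0` of the zero section. -/
def zeroChart (q : Fin 4 → ℝ) : Ambient := (![√(1 - q ⬝ᵥ q), q 0, q 1, q 2, q 3], 0)

lemma continuous_dotProduct_self {n : ℕ} : Continuous fun q : Fin n → ℝ => q ⬝ᵥ q := by
  unfold dotProduct
  fun_prop

lemma contDiff_dotProduct_self {n : ℕ} : ContDiff ℝ ∞ fun q : Fin n → ℝ => q ⬝ᵥ q := by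
  unfold dotProduct
  fun_prop

lemma contDiffOn_zeroChart : ContDiffOn ℝ ∞ zeroChart {q | q ⬝ᵥ q < 1} := by
  refine ContDiffOn.prodMk (contDiffOn_pi.2 fun i => ?_) contDiffOn_const
  have h0 : ContDiffOn ℝ ∞ (fun q : Fin 4 → ℝ => √(1 - q ⬝ᵥ q)) {q | q ⬝ᵥ q < 1} :=
    ContDiffOn.sqrt (contDiff_const.sub contDiff_dotProduct_self).contDiffOn
      fun q hq => (sub_pos.2 hq).ne'
  have h1 : ∀ j : Fin 4, ContDiffOn ℝ ∞ (fun q : Fin 4 → ℝ => q j) {q | q ⬝ᵥ q < 1} :=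
    fun j => (contDiff_apply ℝ ℝ j).contDiffOn
  fin_cases i
  exacts [h0, h1 0, h1 1, h1 2, h1 3]

lemma zeroChart_norm {q : Fin 4 → ℝ} (hq : q ⬝ᵥ q < 1) :
    (zeroChart q).1 ⬝ᵥ (zeroChart q).1 = 1 := by
  have h := Real.mul_self_sqrt (sub_pos.2 hq).le
  simp only [zeroChart]
  simp only [dotProduct, Fin.sum_univ_five, Fin.sum_univ_four, cons_val] at h ⊢
  linarith

lemma isLocalParametrization_zeroChart :
    IsLocalParametrization zeroSection {q | q ⬝ᵥ q < 1} zeroChart := by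
  refine isLocalParametrization_of_leftInverse
    (isOpen_lt continuous_dotProduct_self continuous_const) contDiffOn_zeroChart
    (fun p => ![p.1 1, p.1 2, p.1 3, p.1 4]) (fun q _ => ?_) (fun q _ => ?_)
    ⟨{p | 0 < p.1 0}, isOpen_lt continuous_const (by fun_prop), ?_⟩
  · funext i; fin_cases i <;> simp [zeroChart]
  · have h : ∀ j : Fin 5, DifferentiableAt ℝ (fun p : Ambient => p.1 j) (zeroChart q) :=
      fun j => by fun_prop
    refine differentiableAt_pi.2 fun i => ?_
    fin_cases i
    exacts [h 1, h 2, h 3, h 4]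
  · ext ⟨x, A⟩
    constructor
    · rintro ⟨q, hq, h⟩
      rw [← h]
      exact ⟨⟨zeroChart_norm hq, rfl⟩, Real.sqrt_pos.2 (sub_pos.2 hq)⟩
    · rintro ⟨⟨hx, hA⟩, hx0⟩
      simp only at hA hx
      simp only [Set.mem_ofPred_eq] at hx0
      have h1 : (![x 1, x 2, x 3, x 4] : Fin 4 → ℝ) ⬝ᵥ ![x 1, x 2, x 3, x 4] = 1 - x 0 ^ 2 := by
        simp only [dotProduct, Fin.sum_univ_five, Fin.sum_univ_four, cons_val] at hx ⊢
        linarith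
      refine ⟨![x 1, x 2, x 3, x 4], ?_, ?_⟩
      · simp only [Set.mem_ofPred_eq, h1]
        nlinarith
      · refine Prod.ext ?_ hA.symm
        simp only [zeroChart, h1, sub_sub_cancel, Real.sqrt_sq hx0.le]
        funext i; fin_cases i <;> rfl

lemma isCoassociativeAt_zeroSection_basePoint {lam : ℝ} (hlam : 0 < lam) :
    IsCoassociativeAt lam zeroSection (basePoint 0) := by
  refine ⟨_, _, isLocalParametrization_zeroChart, ⟨0, by simp, ?_⟩, fun q hq => ?_⟩
  · rw [basePoint_zero]
    refine Prod.ext ?_ rfl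
    funext i; fin_cases i <;> simp [zeroChart]
  · have hV : IsOpen {q : Fin 4 → ℝ | q ⬝ᵥ q < 1} :=
      isOpen_lt continuous_dotProduct_self continuous_const
    have hd : DifferentiableAt ℝ zeroChart q :=
      (contDiffOn_zeroChart.contDiffAt (hV.mem_nhds hq)).differentiableAt (by simp)
    obtain ⟨W, hW, hmem⟩ := exists_plane_zeroSection hlam (zeroChart_norm hq)
    refine plane_of_range_le hW (isLocalParametrization_zeroChart.2.2.1 q hq) ?_
    rintro _ ⟨v, rfl⟩
    have hp := hd.hasFDerivAt.hasLineDerivAt v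
    unfold HasLineDerivAt at hp
    have hp1 : HasDerivAt (fun t : ℝ => (zeroChart (q + t • v)).1) (fderiv ℝ zeroChart q v).1 0 := by
      exact hp.hasFDerivAt.fst.hasDerivAt.congr_deriv (by simp; rfl)
    have hp2 : HasDerivAt (fun t : ℝ => (zeroChart (q + t • v)).2) (fderiv ℝ zeroChart q v).2 0 := by
      exact hp.hasFDerivAt.snd.hasDerivAt.congr_deriv (by simp; rfl)
    have h1 := hasDerivAt_dotProduct hp1 hp1
    have h2 := (hasDerivAt_const (0 : ℝ) (1 : ℝ)).congr_of_eventuallyEq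
      ((eventually_line v (hV.mem_nhds hq)).mono fun t ht => zeroChart_norm ht)
    have h3 := h1.unique h2
    have h4 := hp2.unique (hasDerivAt_const (0 : ℝ) (0 : Matrix (Fin 5) (Fin 5) ℝ))
    simp only [zero_smul, add_zero] at h3
    change fderiv ℝ zeroChart q v ∈ W
    rw [show fderiv ℝ zeroChart q v = ((fderiv ℝ zeroChart q v).1, 0) from Prod.ext rfl h4]
    refine hmem _ ?_
    rw [dotProduct_comm (fderiv ℝ zeroChart q v).1] at h3
    linarith

lemma image_act_zeroSection {g : Matrix (Fin 5) (Fin 5) ℝ}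
    (hg : g ∈ Matrix.specialOrthogonalGroup (Fin 5) ℝ) : act g '' zeroSection = zeroSection := by
  have h : ∀ {g : Matrix (Fin 5) (Fin 5) ℝ}, g ∈ Matrix.specialOrthogonalGroup (Fin 5) ℝ →
      ∀ p ∈ zeroSection, act g p ∈ zeroSection := by
    rintro g hg ⟨x, A⟩ ⟨hx, hA⟩
    refine ⟨?_, ?_⟩ <;> simp only [act] at *
    · rw [dotProduct_mulVec_special hg, hx]
    · rw [hA, Matrix.mul_zero, Matrix.zero_mul]
  refine Set.Subset.antisymm (Set.image_subset_iff.2 (h hg)) fun p hp =>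
    ⟨act gᵀ p, h (transpose_mem_special hg) p hp, act_act_transpose hg p⟩

lemma isCoassociative_zeroSection {lam : ℝ} (hlam : 0 < lam) : IsCoassociative lam zeroSection := by
  refine isCoassociative_iff.2 ⟨zeroSection_subset_Y, ?_⟩
  rintro ⟨x, A⟩ ⟨hx, hA⟩
  obtain ⟨g, hg, -, hgx⟩ := exists_special_basePoint hx
  have := (isCoassociativeAt_zeroSection_basePoint hlam).act hg
  rw [image_act_zeroSection hg, hgx] at this
  rwa [show (x, A) = (x, 0) from Prod.ext rfl hA]

/-! ### Parametrisation of the part of `M_C` on which `a₁` has a fixed sign -/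

section Parametrization

variable {lam : ℝ} (hlam : 0 < lam)

/-- `|a₁|` as a function of `W ∈ ℝ²`. -/
def alphaOf (σ : ℝ) (W : Fin 2 → ℝ) : ℝ := invP hlam (σ + W ⬝ᵥ W)

/-- The ratio between `W` and `(x₄, x₅)`. -/
def stretch (lam α : ℝ) : ℝ := √(2 * α * sRad lam α)

/-- The domain of the parameter `W`. -/
def paramDomain (σ : ℝ) : Set (Fin 2 → ℝ) :=
  {W | W ⬝ᵥ W < 2 * alphaOf hlam σ W * sRad lam (alphaOf hlam σ W)}

/-- `(x₄, x₅)` as a function of `W`. -/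
def planePart (σ : ℝ) (W : Fin 2 → ℝ) : Fin 2 → ℝ := (stretch lam (alphaOf hlam σ W))⁻¹ • W

/-- `|(x₁, x₂, x₃)|` as a function of `W`. -/
def radius (σ : ℝ) (W : Fin 2 → ℝ) : ℝ := √(1 - planePart hlam σ W ⬝ᵥ planePart hlam σ W)

/-- The parametrisation by `(u, W)` of the part of `M_C` on which `a₁` has the sign `ε`, for
`σ = ε C`. -/
def param (σ ε : ℝ) (u : Fin 3 → ℝ) (W : Fin 2 → ℝ) : Ambient :=
  orbitPoint u (planePart hlam σ W) (radius hlam σ W) (ε * alphaOf hlam σ W)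

lemma stretch_pos {lam : ℝ} (hlam : 0 < lam) {α : ℝ} (h : 0 < α) : 0 < stretch lam α := by
  have := sRad_pos hlam α
  exact Real.sqrt_pos.2 (by positivity)

lemma stretch_mul_self {lam : ℝ} (hlam : 0 < lam) {α : ℝ} (h : 0 < α) :
    stretch lam α * stretch lam α = 2 * α * sRad lam α := by
  have := sRad_pos hlam α
  exact Real.mul_self_sqrt (by positivity)

lemma smul_dotProduct_smul {n : ℕ} (r : ℝ) (w : Fin n → ℝ) :
    (r • w) ⬝ᵥ (r • w) = r * r * (w ⬝ᵥ w) := by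
  rw [smul_dotProduct, dotProduct_smul, smul_eq_mul, smul_eq_mul, mul_assoc]

variable {hlam}

/-- A product that exceeds `|W|² ≥ 0` is positive, and `s` is positive. -/
lemma alphaOf_pos {σ : ℝ} {W : Fin 2 → ℝ} (hW : W ∈ paramDomain hlam σ) :
    0 < alphaOf hlam σ W := by
  have h1 : 0 < 2 * alphaOf hlam σ W * sRad lam (alphaOf hlam σ W) :=
    (dotProduct_self_nonneg W).trans_lt hW
  have h2 := pos_of_mul_pos_left h1 (sRad_pos hlam _).le
  linarith

lemma planePart_norm {σ : ℝ} {W : Fin 2 → ℝ} (hW : W ∈ paramDomain hlam σ) :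
    2 * alphaOf hlam σ W * sRad lam (alphaOf hlam σ W)
      * (planePart hlam σ W ⬝ᵥ planePart hlam σ W) = W ⬝ᵥ W := by
  have h := (stretch_pos hlam (alphaOf_pos hW)).ne'
  rw [← stretch_mul_self hlam (alphaOf_pos hW), planePart, smul_dotProduct_smul]
  field_simp

lemma planePart_norm_lt {σ : ℝ} {W : Fin 2 → ℝ} (hW : W ∈ paramDomain hlam σ) :
    planePart hlam σ W ⬝ᵥ planePart hlam σ W < 1 := by
  have h0 := alphaOf_pos hW
  have h1 := sRad_pos hlam (alphaOf hlam σ W)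
  have h2 : 0 < 2 * alphaOf hlam σ W * sRad lam (alphaOf hlam σ W) := by positivity
  refine lt_of_mul_lt_mul_left ?_ h2.le
  rw [planePart_norm hW, mul_one]
  exact hW

lemma radius_pos {σ : ℝ} {W : Fin 2 → ℝ} (hW : W ∈ paramDomain hlam σ) :
    0 < radius hlam σ W := Real.sqrt_pos.2 (sub_pos.2 (planePart_norm_lt hW))

lemma radius_sq_add {σ : ℝ} {W : Fin 2 → ℝ} (hW : W ∈ paramDomain hlam σ) :
    radius hlam σ W ^ 2 + planePart hlam σ W ⬝ᵥ planePart hlam σ W = 1 := by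
  rw [radius, Real.sq_sqrt (sub_pos.2 (planePart_norm_lt hW)).le, sub_add_cancel]

/-- `P` is odd and `s` is even, so `G` is odd in its first variable. This lets both signs of `a` be
treated at once, with `σ = ε C`. -/
lemma G_sign_mul {lam : ℝ} (hlam : 0 < lam) {ε : ℝ} (hε : ε * ε = 1) (α c : ℝ) :
    G lam (ε * α) c = ε * (primP lam α - 2 * α * sRad lam α * (1 - c ^ 2)) := by
  rw [G_eq hlam]
  rcases mul_self_eq_one_iff.1 hε with rfl | rfl
  · simp
  · rw [neg_one_mul, primP_neg, sRad_neg]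
    ring

lemma G_param {σ ε : ℝ} (hε : ε * ε = 1) {W : Fin 2 → ℝ} (hW : W ∈ paramDomain hlam σ) :
    G lam (ε * alphaOf hlam σ W) (radius hlam σ W) = ε * σ := by
  have h1 := radius_sq_add hW
  have h2 := planePart_norm hW
  rw [G_sign_mul hlam hε, show 1 - radius hlam σ W ^ 2
    = planePart hlam σ W ⬝ᵥ planePart hlam σ W by linarith, h2]
  conv_lhs => rw [alphaOf, primP_invP]
  ring

/-- Points of `M_C` come from the parametrisation. -/
lemma recover_param {σ ε : ℝ} (hε : ε * ε = 1) {w : Fin 2 → ℝ} {c a : ℝ} (hc : 0 < c)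
    (hw : c ^ 2 + w ⬝ᵥ w = 1) (ha : 0 < ε * a) (hG : G lam a c = ε * σ) :
    stretch lam (ε * a) • w ∈ paramDomain hlam σ ∧
      alphaOf hlam σ (stretch lam (ε * a) • w) = ε * a ∧
      planePart hlam σ (stretch lam (ε * a) • w) = w ∧
      radius hlam σ (stretch lam (ε * a) • w) = c := by
  have hs := stretch_mul_self hlam ha
  have hs0 := (stretch_pos hlam ha).ne'
  have hn : (stretch lam (ε * a) • w) ⬝ᵥ (stretch lam (ε * a) • w)
      = 2 * (ε * a) * sRad lam (ε * a) * (w ⬝ᵥ w) := by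
    rw [smul_dotProduct_smul, hs]
  -- After the substitution for `W`, the equation for `G` reads `P(ε a) = σ + |W|²`, which is solved
  -- by inverting `P`.
  have hα : alphaOf hlam σ (stretch lam (ε * a) • w) = ε * a := by
    have h1 : a = ε * (ε * a) := by rw [← mul_assoc, hε, one_mul]
    rw [h1, G_sign_mul hlam hε] at hG
    have h2 := mul_left_cancel₀ (left_ne_zero_of_mul (hε.trans_ne one_ne_zero)) hG
    rw [alphaOf, hn, show w ⬝ᵥ w = 1 - c ^ 2 by linarith,
      show σ + 2 * (ε * a) * sRad lam (ε * a) * (1 - c ^ 2) = primP lam (ε * a) by linarith,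
      invP_primP]
  have hp : planePart hlam σ (stretch lam (ε * a) • w) = w := by
    rw [planePart, hα, smul_smul, inv_mul_cancel₀ hs0, one_smul]
  refine ⟨?_, hα, hp, ?_⟩
  · have h1 := sRad_pos hlam (ε * a)
    have h2 : 0 < 2 * (ε * a) * sRad lam (ε * a) := by positivity
    have h3 : w ⬝ᵥ w < 1 := by nlinarith
    rw [paramDomain, Set.mem_ofPred_eq, hn, hα]
    nlinarith
  · rw [radius, hp, show 1 - w ⬝ᵥ w = c ^ 2 by linarith, Real.sqrt_sq hc.le]

/-! ### Coordinate functions on the ambient space -/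

/-- `|(x₁, x₂, x₃)|`. -/
def coordC (p : Ambient) : ℝ := √(p.1 0 ^ 2 + p.1 1 ^ 2 + p.1 2 ^ 2)

/-- The fibre coordinate `a₁`. -/
def coordA (p : Ambient) : ℝ := -p.2 3 4 * (coordC p)⁻¹

/-- The point of `S²`. -/
def coordU (p : Ambient) : Fin 3 → ℝ := (coordC p)⁻¹ • ![p.1 0, p.1 1, p.1 2]

/-- The parameter `W`. -/
def coordW (lam ε : ℝ) (p : Ambient) : Fin 2 → ℝ :=
  stretch lam (ε * coordA p) • ![p.1 3, p.1 4]

section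

variable {u : Fin 3 → ℝ} {w : Fin 2 → ℝ} {c : ℝ} (a : ℝ)

lemma coordC_orbitPoint (hu : u ⬝ᵥ u = 1) (hc : 0 < c) : coordC (orbitPoint u w c a) = c := by
  have h : (c * u 0) ^ 2 + (c * u 1) ^ 2 + (c * u 2) ^ 2 = c ^ 2 := by
    simp only [dotProduct, Fin.sum_univ_three] at hu
    linear_combination c ^ 2 * hu
  simp only [coordC, orbitPoint, cons_val]
  rw [h, Real.sqrt_sq hc.le]

/-- As `c > 0` on `M_C`, this single entry determines the sign of `a`, and with `c` also its value.
-/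
lemma orbitPoint_entry : (orbitPoint u w c a).2 3 4 = -(a * c) := by
  simp [orbitPoint, orbitForm]

lemma coordA_orbitPoint (hu : u ⬝ᵥ u = 1) (hc : 0 < c) : coordA (orbitPoint u w c a) = a := by
  rw [coordA, coordC_orbitPoint a hu hc, orbitPoint_entry, neg_neg, mul_inv_cancel_right₀ hc.ne']

lemma coordU_orbitPoint (hu : u ⬝ᵥ u = 1) (hc : 0 < c) : coordU (orbitPoint u w c a) = u := by
  rw [coordU, coordC_orbitPoint a hu hc]
  funext i
  fin_cases i <;> simp [orbitPoint, hc.ne']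

lemma coordW_orbitPoint (lam ε : ℝ) (hu : u ⬝ᵥ u = 1) (hc : 0 < c) :
    coordW lam ε (orbitPoint u w c a) = stretch lam (ε * a) • w := by
  rw [coordW, coordA_orbitPoint a hu hc]
  congr 1
  funext i
  fin_cases i <;> simp [orbitPoint]

end

lemma coordU_param {σ ε : ℝ} {u : Fin 3 → ℝ} (hu : u ⬝ᵥ u = 1) {W : Fin 2 → ℝ}
    (hW : W ∈ paramDomain hlam σ) : coordU (param hlam σ ε u W) = u :=
  coordU_orbitPoint _ hu (radius_pos hW)

lemma coordW_param {σ ε : ℝ} (hε : ε * ε = 1) {u : Fin 3 → ℝ} (hu : u ⬝ᵥ u = 1)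
    {W : Fin 2 → ℝ} (hW : W ∈ paramDomain hlam σ) :
    coordW lam ε (param hlam σ ε u W) = W := by
  rw [param, coordW_orbitPoint _ _ _ hu (radius_pos hW), ← mul_assoc, hε, one_mul, planePart,
    smul_smul, mul_inv_cancel₀ (stretch_pos hlam (alphaOf_pos hW)).ne', one_smul]

/-- The part of `M_C` on which `a₁` has the sign `ε`. -/
abbrev signPart (lam C ε : ℝ) : Set Ambient := orbitSet lam C {a | 0 < ε * a}

lemma param_mem {σ ε C : ℝ} (hε : ε * ε = 1) (hσ : C = ε * σ) {u : Fin 3 → ℝ} (hu : u ⬝ᵥ u = 1)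
    {W : Fin 2 → ℝ} (hW : W ∈ paramDomain hlam σ) : param hlam σ ε u W ∈ signPart lam C ε := by
  refine mem_orbitSet.2 ⟨u, _, _, _, hu, radius_pos hW, radius_sq_add hW, ?_, ?_, rfl⟩
  · change 0 < ε * (ε * _)
    rw [← mul_assoc, hε, one_mul]
    exact alphaOf_pos hW
  · rw [G_param hε hW, hσ]

lemma coord_mem {σ ε C : ℝ} (hε : ε * ε = 1) (hσ : C = ε * σ) {p : Ambient}
    (hp : p ∈ signPart lam C ε) : coordU p ⬝ᵥ coordU p = 1 ∧ coordW lam ε p ∈ paramDomain hlam σ ∧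
      param hlam σ ε (coordU p) (coordW lam ε p) = p ∧ 0 < coordC p ∧ 0 < ε * coordA p := by
  obtain ⟨u, w, c, a, hu, hc, hw, ha, hG, rfl⟩ := mem_orbitSet.1 hp
  obtain ⟨h1, h2, h3, h4⟩ := recover_param (hlam := hlam) hε hc hw ha (hG.trans hσ)
  rw [coordU_orbitPoint a hu hc, coordW_orbitPoint a lam ε hu hc, coordC_orbitPoint a hu hc,
    coordA_orbitPoint a hu hc, param, h2, h3, h4, ← mul_assoc, hε, one_mul]
  exact ⟨hu, h1, rfl, hc, ha⟩

/-! ### Smoothness -/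

lemma contDiff_orbitPoint : ContDiff ℝ ∞ fun x : (Fin 3 → ℝ) × (Fin 2 → ℝ) × ℝ × ℝ =>
    orbitPoint x.1 x.2.1 x.2.2.1 x.2.2.2 := by
  refine ContDiff.prodMk (contDiff_pi.2 fun i => ?_)
    (contDiff_pi.2 fun i => contDiff_pi.2 fun j => ?_)
  · fin_cases i <;> simp <;> fun_prop
  · fin_cases i <;> fin_cases j <;> simp [orbitForm] <;> fun_prop

lemma contDiff_alphaOf (σ : ℝ) : ContDiff ℝ ∞ (alphaOf hlam σ) :=
  (contDiff_invP hlam).comp (contDiff_const.add contDiff_dotProduct_self)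

lemma isOpen_paramDomain (σ : ℝ) : IsOpen (paramDomain hlam σ) :=
  isOpen_lt continuous_dotProduct_self
    ((continuous_const.mul (contDiff_alphaOf σ).continuous).mul
      ((contDiff_sRad hlam).continuous.comp (contDiff_alphaOf σ).continuous))

lemma contDiffOn_planePart (σ : ℝ) :
    ContDiffOn ℝ ∞ (planePart hlam σ) (paramDomain hlam σ) := by
  have h : ContDiffOn ℝ ∞ (fun W => stretch lam (alphaOf hlam σ W)) (paramDomain hlam σ) :=
    ContDiffOn.sqrt ((contDiff_const.mul (contDiff_alphaOf σ)).mul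
      ((contDiff_sRad hlam).comp (contDiff_alphaOf σ))).contDiffOn fun W hW =>
        ((dotProduct_self_nonneg W).trans_lt hW).ne'
  exact (h.inv fun _ hW => (stretch_pos hlam (alphaOf_pos hW)).ne').smul contDiffOn_id

lemma contDiffOn_radius (σ : ℝ) : ContDiffOn ℝ ∞ (radius hlam σ) (paramDomain hlam σ) :=
  ContDiffOn.sqrt (contDiffOn_const.sub
    (contDiff_dotProduct_self.comp_contDiffOn (contDiffOn_planePart σ)))
      fun _ hW => (sub_pos.2 (planePart_norm_lt hW)).ne'

lemma contDiffOn_param (σ ε : ℝ) : ContDiffOn ℝ ∞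
    (fun x : (Fin 3 → ℝ) × (Fin 2 → ℝ) => param hlam σ ε x.1 x.2)
    (Prod.snd ⁻¹' paramDomain hlam σ) := by
  have hm : Set.MapsTo (Prod.snd : (Fin 3 → ℝ) × (Fin 2 → ℝ) → _)
    (Prod.snd ⁻¹' paramDomain hlam σ) (paramDomain hlam σ) := fun x hx => hx
  exact contDiff_orbitPoint.comp_contDiffOn
    (contDiffOn_fst.prodMk (((contDiffOn_planePart σ).comp contDiffOn_snd hm).prodMk
      (((contDiffOn_radius σ).comp contDiffOn_snd hm).prodMk
        (contDiffOn_const.mul ((contDiff_alphaOf σ).comp_contDiffOn contDiffOn_snd)))))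

lemma differentiableAt_coordC {p : Ambient} (hp : 0 < coordC p) : DifferentiableAt ℝ coordC p :=
  DifferentiableAt.sqrt (by fun_prop) (Real.sqrt_pos.1 hp).ne'

lemma differentiableAt_coordU {p : Ambient} (hp : 0 < coordC p) : DifferentiableAt ℝ coordU p := by
  refine ((differentiableAt_coordC hp).inv hp.ne').smul (differentiableAt_pi.2 fun i => ?_)
  fin_cases i <;> simp <;> fun_prop

lemma differentiableAt_coordA {p : Ambient} (hp : 0 < coordC p) : DifferentiableAt ℝ coordA p := by
  have h : DifferentiableAt ℝ (fun p : Ambient => p.2 3 4) p :=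
    differentiableAt_pi.1 (differentiableAt_pi.1 differentiableAt_snd 3) 4
  exact h.neg.mul ((differentiableAt_coordC hp).inv hp.ne')

lemma differentiableAt_coordW {lam : ℝ} (hlam : 0 < lam) {ε : ℝ} {p : Ambient} (hp : 0 < coordC p)
    (ha : 0 < ε * coordA p) : DifferentiableAt ℝ (coordW lam ε) p := by
  have h1 : DifferentiableAt ℝ (fun p => ε * coordA p) p :=
    (differentiableAt_coordA hp).const_mul ε
  have h2 : DifferentiableAt ℝ (fun p => stretch lam (ε * coordA p)) p :=
    DifferentiableAt.sqrt ((h1.const_mul 2).mul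
      (((contDiff_sRad hlam).differentiable (by simp)).differentiableAt.comp p h1))
      (by have := sRad_pos hlam (ε * coordA p); positivity)
  refine h2.smul (differentiableAt_pi.2 fun i => ?_)
  fin_cases i <;> simp <;> fun_prop

end Parametrization

/-! ### Charts of `M_C` -/

/-- The parametrisation of the hemisphere `u₁ > 0` of `S²` by its central projection. -/
def spherePart (q : Fin 4 → ℝ) : Fin 3 → ℝ :=
  (√(1 + q 0 ^ 2 + q 1 ^ 2))⁻¹ • ![1, q 0, q 1]

lemma spherePart_pos (q : Fin 4 → ℝ) : 0 < √(1 + q 0 ^ 2 + q 1 ^ 2) :=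
  Real.sqrt_pos.2 (by positivity)

lemma spherePart_norm (q : Fin 4 → ℝ) : spherePart q ⬝ᵥ spherePart q = 1 := by
  have h : √(1 + q 0 ^ 2 + q 1 ^ 2) * √(1 + q 0 ^ 2 + q 1 ^ 2) = 1 + q 0 ^ 2 + q 1 ^ 2 :=
    Real.mul_self_sqrt (by positivity)
  have h0 := spherePart_pos q
  rw [spherePart, smul_dotProduct_smul, ← mul_inv, h]
  simp only [dotProduct, Fin.sum_univ_three, cons_val]
  field_simp

lemma contDiff_spherePart : ContDiff ℝ ∞ spherePart := by
  have h : ContDiff ℝ ∞ fun q : Fin 4 → ℝ => √(1 + q 0 ^ 2 + q 1 ^ 2) :=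
    ContDiff.sqrt (by fun_prop) fun q => by positivity
  refine (h.inv fun q => (spherePart_pos q).ne').smul (contDiff_pi.2 fun i => ?_)
  fin_cases i <;> simp <;> fun_prop

lemma contDiff_lastPart : ContDiff ℝ ∞ fun q : Fin 4 → ℝ => (![q 2, q 3] : Fin 2 → ℝ) := by
  refine contDiff_pi.2 fun i => ?_
  fin_cases i <;> simp <;> fun_prop

section Charts

variable {lam : ℝ} {hlam : 0 < lam}

/-- The chart domain. -/
def chartDomain (hlam : 0 < lam) (σ : ℝ) : Set (Fin 4 → ℝ) :=
  {q | (![q 2, q 3] : Fin 2 → ℝ) ∈ paramDomain hlam σ}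

/-- The chart. -/
def chart (hlam : 0 < lam) (σ ε : ℝ) (q : Fin 4 → ℝ) : Ambient :=
  param hlam σ ε (spherePart q) ![q 2, q 3]

lemma isOpen_chartDomain (σ : ℝ) : IsOpen (chartDomain hlam σ) :=
  (isOpen_paramDomain σ).preimage contDiff_lastPart.continuous

lemma contDiffOn_chart (σ ε : ℝ) : ContDiffOn ℝ ∞ (chart hlam σ ε) (chartDomain hlam σ) :=
  (contDiffOn_param (hlam := hlam) σ ε).comp
    (f := fun q : Fin 4 → ℝ => ((spherePart q, ![q 2, q 3]) : (Fin 3 → ℝ) × (Fin 2 → ℝ)))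
    (contDiff_spherePart.prodMk contDiff_lastPart).contDiffOn fun _ hq => hq

lemma chart_fst_pos {σ ε : ℝ} {q : Fin 4 → ℝ} (hq : q ∈ chartDomain hlam σ) :
    0 < (chart hlam σ ε q).1 0 := by
  have h1 := radius_pos hq
  have h2 := spherePart_pos q
  simp only [chart, param, orbitPoint, cons_val, spherePart, Pi.smul_apply, smul_eq_mul, mul_one]
  positivity

lemma image_chart {σ ε C : ℝ} (hε : ε * ε = 1) (hσ : C = ε * σ) :
    chart hlam σ ε '' chartDomain hlam σ = signPart lam C ε ∩ {p | 0 < p.1 0} := by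
  ext p
  constructor
  · rintro ⟨q, hq, rfl⟩
    exact ⟨param_mem hε hσ (spherePart_norm q) hq, chart_fst_pos hq⟩
  · rintro ⟨hp, hp0⟩
    obtain ⟨hu, hW, hpp, hc, -⟩ := coord_mem (hlam := hlam) hε hσ hp
    rw [Set.mem_ofPred_eq] at hp0
    set u := coordU p with hudef
    set W := coordW lam ε p
    have hu0 : 0 < u 0 := by
      simp only [hudef, coordU, Pi.smul_apply, cons_val, smul_eq_mul]
      positivity
    have hWeq : (![W 0, W 1] : Fin 2 → ℝ) = W := by
      funext i; fin_cases i <;> rfl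
    have hs : spherePart ![u 1 / u 0, u 2 / u 0, W 0, W 1] = u := by
      have h1 : 1 + (u 1 / u 0) ^ 2 + (u 2 / u 0) ^ 2 = (u 0)⁻¹ ^ 2 := by
        simp only [dotProduct, Fin.sum_univ_three] at hu
        field_simp
        linear_combination hu
      simp only [spherePart, cons_val, h1, Real.sqrt_sq (inv_pos.2 hu0).le, inv_inv]
      funext i
      fin_cases i <;> simp [mul_div_cancel₀ _ hu0.ne']
    refine ⟨![u 1 / u 0, u 2 / u 0, W 0, W 1], ?_, ?_⟩
    · simpa only [chartDomain, Set.mem_ofPred_eq, cons_val, hWeq] using hW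
    · rw [← hpp, chart, hs]
      simp only [cons_val, hWeq]

lemma isLocalParametrization_chart {σ ε C : ℝ} (hε : ε * ε = 1) (hσ : C = ε * σ) :
    IsLocalParametrization (signPart lam C ε) (chartDomain hlam σ) (chart hlam σ ε) := by
  refine isLocalParametrization_of_leftInverse (isOpen_chartDomain σ) (contDiffOn_chart σ ε)
    (fun p => ![p.1 1 * (p.1 0)⁻¹, p.1 2 * (p.1 0)⁻¹, coordW lam ε p 0, coordW lam ε p 1])
    (fun q hq => ?_) (fun q hq => ?_)
    ⟨{p | 0 < p.1 0}, isOpen_lt continuous_const (by fun_prop), image_chart hε hσ⟩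
  · have h1 := radius_pos hq
    have h2 := spherePart_pos q
    have h3 : coordW lam ε (chart hlam σ ε q) = ![q 2, q 3] :=
      coordW_param hε (spherePart_norm q) hq
    simp only [h3]
    simp only [chart, param, orbitPoint, cons_val, spherePart, Pi.smul_apply, smul_eq_mul, mul_one]
    funext i
    fin_cases i
    · simp only [Fin.zero_eta, cons_val]; field_simp
    · simp only [Fin.mk_one, cons_val]; field_simp
    · rfl
    · rfl
  · have h0 := chart_fst_pos (ε := ε) hq
    obtain ⟨-, -, -, hc, ha⟩ := coord_mem (hlam := hlam) hε hσ
      (param_mem hε hσ (spherePart_norm q) hq)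
    have h1 : ∀ j : Fin 5, DifferentiableAt ℝ (fun p : Ambient => p.1 j) (chart hlam σ ε q) :=
      fun j => by fun_prop
    have h2 := differentiableAt_pi.1 (differentiableAt_coordW hlam hc ha)
    refine differentiableAt_pi.2 fun i => ?_
    fin_cases i
    exacts [(h1 1).mul ((h1 0).inv h0.ne'), (h1 2).mul ((h1 0).inv h0.ne'), h2 0, h2 1]
lemma isCoassociativeAt_chart (hlam : 0 < lam) {σ ε C : ℝ} (hε : ε * ε = 1) (hσ : C = ε * σ)
    {p : Ambient} (hp : p ∈ signPart lam C ε) (hp0 : 0 < p.1 0) :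
    IsCoassociativeAt lam (signPart lam C ε) p := by
  have hpar := isLocalParametrization_chart (hlam := hlam) hε hσ
  refine ⟨_, _, hpar, (image_chart hε hσ).symm.subset ⟨hp, hp0⟩, fun q hq => ?_⟩
  · have hnhds := (isOpen_chartDomain (hlam := hlam) σ).mem_nhds hq
    have hpd : paramDomain hlam σ ∈ nhds (![q 2, q 3] : Fin 2 → ℝ) :=
      (isOpen_paramDomain σ).mem_nhds hq
    have hl : DifferentiableAt ℝ (fun q : Fin 4 → ℝ => (![q 2, q 3] : Fin 2 → ℝ)) q :=
      contDiff_lastPart.differentiable (by simp) q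
    refine isCoassociativePlane_of_orbitPoint hlam (C := C) (u := spherePart)
      (w := fun q => planePart hlam σ ![q 2, q 3]) (c := fun q => radius hlam σ ![q 2, q 3])
      (a := fun q => ε * alphaOf hlam σ ![q 2, q 3]) ?_ ?_ ?_ ?_ ?_ ?_ (radius_pos hq)
      (hpar.2.2.1 q hq)
    · exact contDiff_spherePart.differentiable (by simp) q
    · exact DifferentiableAt.comp (g := planePart hlam σ) q
        (((contDiffOn_planePart σ).contDiffAt hpd).differentiableAt (by simp)) hl
    · exact DifferentiableAt.comp (g := radius hlam σ) q
        (((contDiffOn_radius σ).contDiffAt hpd).differentiableAt (by simp)) hl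
    · exact (DifferentiableAt.comp (g := alphaOf hlam σ) q
        ((contDiff_alphaOf σ).differentiable (by simp) _) hl).const_mul ε
    · exact ((contDiffOn_chart σ ε).contDiffAt hnhds).differentiableAt (by simp)
    · filter_upwards [hnhds] with x hx
      exact ⟨rfl, spherePart_norm x, radius_sq_add hx, by rw [G_param hε hx, hσ]⟩

lemma image_act_orbitSet {h : Matrix (Fin 3) (Fin 3) ℝ} {k : Matrix (Fin 2) (Fin 2) ℝ}
    (hh : h ∈ Matrix.specialOrthogonalGroup (Fin 3) ℝ)
    (hk : k ∈ Matrix.specialOrthogonalGroup (Fin 2) ℝ) (lam C : ℝ) (S : Set ℝ) :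
    act (blockEmbed h k) '' orbitSet lam C S = orbitSet lam C S := by
  have key : ∀ {h : Matrix (Fin 3) (Fin 3) ℝ} {k : Matrix (Fin 2) (Fin 2) ℝ},
      h ∈ Matrix.specialOrthogonalGroup (Fin 3) ℝ → k ∈ Matrix.specialOrthogonalGroup (Fin 2) ℝ →
      ∀ p ∈ orbitSet lam C S, act (blockEmbed h k) p ∈ orbitSet lam C S := by
    intro h k hh hk p hp
    obtain ⟨u, w, c, a, hu, hc, hw, ha, hG, rfl⟩ := mem_orbitSet.1 hp
    exact mem_orbitSet.2 ⟨h *ᵥ u, k *ᵥ w, c, a, by rw [dotProduct_mulVec_special hh, hu], hc,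
      by rw [dotProduct_mulVec_special hk, hw], ha, hG, act_orbitPoint hh hk u w c a⟩
  have ht : (blockEmbed h k)ᵀ = blockEmbed hᵀ kᵀ := by
    rw [blockEmbed_eq, blockEmbed_eq]
    ext i j
    fin_cases i <;> fin_cases j <;> rfl
  refine Set.Subset.antisymm (Set.image_subset_iff.2 (key hh hk)) fun p hp =>
    ⟨act (blockEmbed h k)ᵀ p, ?_, act_act_transpose (blockEmbed_mem hh hk) p⟩
  rw [ht]
  exact key (transpose_mem_special hh) (transpose_mem_special hk) p hp

/-- The chart reaches only the points with positive first coordinate; the others are moved there by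
`SO(3)`, which preserves the set. -/
lemma isCoassociativeAt_signPart (hlam : 0 < lam) {ε : ℝ} (hε : ε * ε = 1) (C : ℝ)
    {p : Ambient} (hp : p ∈ signPart lam C ε) :
    IsCoassociativeAt lam (signPart lam C ε) p := by
  obtain ⟨u, w, c, a, hu, hc, hw, ha, hG, rfl⟩ := mem_orbitSet.1 hp
  obtain ⟨h, hh, hhu⟩ := exists_special_mulVec u hu
  have h1 : orbitPoint (Pi.single 0 1) w c a ∈ signPart lam C ε :=
    mem_orbitSet.2 ⟨_, w, c, a, by simp, hc, hw, ha, hG, rfl⟩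
  have h2 := (isCoassociativeAt_chart hlam hε (σ := ε * C) (by rw [← mul_assoc, hε, one_mul]) h1
    (by simpa [orbitPoint] using hc)).act (blockEmbed_mem hh (one_mem _))
  rwa [image_act_orbitSet hh (one_mem _), act_orbitPoint hh (one_mem _), hhu, one_mulVec] at h2

end Charts

lemma orbitSet_subset_Y (lam C : ℝ) (S : Set ℝ) : orbitSet lam C S ⊆ Y := by
  intro p hp
  obtain ⟨u, w, c, a, hu, hc, hw, ha, hG, rfl⟩ := mem_orbitSet.1 hp
  obtain ⟨h, hh, hhu⟩ := exists_special_mulVec u hu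
  obtain ⟨k, hk, hkw⟩ := exists_special_mulVec_norm w
  have he : (Pi.single 0 1 : Fin 3 → ℝ) = ![1, 0, 0] := by
    funext i; fin_cases i <;> rfl
  have hcs : c ^ 2 + √(w ⬝ᵥ w) ^ 2 = 1 := by rw [Real.sq_sqrt (dotProduct_self_nonneg w), hw]
  rw [← hhu, ← hkw, ← act_orbitPoint hh hk, he, ← act_rotation_basePoint]
  exact act_mem_Y (blockEmbed_mem hh hk) (act_mem_Y (rotation_mem hcs) (basePoint_mem_Y a))

/-! ### The decomposition of `M_C` -/

lemma MPos_eq (lam C : ℝ) : MPos lam C = signPart lam C 1 := by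
  simp only [MPos, signPart, one_mul]
  rfl

lemma MNeg_eq (lam C : ℝ) : MNeg lam C = signPart lam C (-1) := by
  simp only [MNeg, signPart, neg_one_mul, Left.neg_pos_iff]
  rfl

/-- The region of the ambient space on which `a₁` has the sign `ε`. -/
def signRegion (ε : ℝ) : Set Ambient := {p | ε * p.2 3 4 < 0}

/-- A neighbourhood of the complement of `Σ` in the zero section. -/
def zeroRegion (lam : ℝ) : Set Ambient :=
  {p | p.2 3 4 ^ 2 < lam * (p.1 0 ^ 2 + p.1 1 ^ 2 + p.1 2 ^ 2) ^ 2}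

lemma continuous_entry : Continuous fun p : Ambient => p.2 3 4 :=
  continuous_snd.matrix_elem 3 4

lemma isOpen_signRegion (ε : ℝ) : IsOpen (signRegion ε) :=
  isOpen_lt (continuous_const.mul continuous_entry) continuous_const

lemma isOpen_zeroRegion (lam : ℝ) : IsOpen (zeroRegion lam) :=
  isOpen_lt (continuous_entry.pow 2) (by fun_prop)

lemma orbitPoint_mem_signRegion {u : Fin 3 → ℝ} {w : Fin 2 → ℝ} {c a ε : ℝ} (hc : 0 < c) :
    orbitPoint u w c a ∈ signRegion ε ↔ 0 < ε * a := by
  rw [signRegion, Set.mem_ofPred_eq, orbitPoint_entry, ← mul_pos_iff_of_pos_right hc, mul_neg,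
    neg_lt_zero, mul_assoc]

lemma orbitPoint_mem_zeroRegion {lam : ℝ} {u : Fin 3 → ℝ} {w : Fin 2 → ℝ} {c a : ℝ}
    (hu : u ⬝ᵥ u = 1) : orbitPoint u w c a ∈ zeroRegion lam ↔ (a * c) ^ 2 < lam * c ^ 4 := by
  have h : (c * u 0) ^ 2 + (c * u 1) ^ 2 + (c * u 2) ^ 2 = c ^ 2 := by
    simp only [dotProduct, Fin.sum_univ_three] at hu
    linear_combination c ^ 2 * hu
  rw [zeroRegion, Set.mem_ofPred_eq, orbitPoint_entry]
  simp only [orbitPoint, cons_val]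
  rw [h, neg_sq, ← pow_mul]

lemma M_inter_signRegion (lam C ε : ℝ) : M lam C ∩ signRegion ε = signPart lam C ε := by
  ext p
  constructor
  · rintro ⟨hp, hε⟩
    obtain ⟨u, w, c, a, hu, hc, hw, -, hG, rfl⟩ := mem_orbitSet.1 hp
    exact mem_orbitSet.2 ⟨u, w, c, a, hu, hc, hw, (orbitPoint_mem_signRegion hc).1 hε, hG, rfl⟩
  · intro hp
    obtain ⟨u, w, c, a, hu, hc, hw, ha, hG, rfl⟩ := mem_orbitSet.1 hp
    exact ⟨mem_orbitSet.2 ⟨u, w, c, a, hu, hc, hw, trivial, hG, rfl⟩,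
      (orbitPoint_mem_signRegion hc).2 ha⟩

/-- With `α = |a|`, the equation says `-Q(α) = 2 α s(α) c²`, and the cubic bound on `-Q` gives `2 λ
c² ≤ α²`. So such points lie outside `zeroRegion`, which therefore separates the zero section from
the rest of `M_0`. -/
lemma mul_pow_four_lt {lam : ℝ} (hlam : 0 < lam) {a c : ℝ} (ha : a ≠ 0) (hc : 0 < c)
    (hG : G lam a c = 0) : lam * c ^ 4 < (a * c) ^ 2 := by
  have key : ∀ α, 0 < α → primP lam α - 2 * α * sRad lam α * (1 - c ^ 2) = 0 →
      lam * c ^ 4 < (α * c) ^ 2 := by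
    intro α hα h
    have h1 := neg_primQ_le hlam hα.le
    have hs := sRad_pos hlam α
    rw [primQ, show -(primP lam α - 2 * α * sRad lam α) = 2 * α * sRad lam α * c ^ 2 by
      linear_combination -h] at h1
    have h2 : 2 * (lam * c ^ 2) ≤ α ^ 2 := by
      refine le_of_mul_le_mul_left (a := α * sRad lam α) ?_ (by positivity)
      calc _ = _ := by ring
        _ ≤ _ := h1
        _ = _ := by ring
    have h3 : 0 < lam * c ^ 4 := by positivity
    have h4 := mul_le_mul_of_nonneg_right h2 (sq_nonneg c)
    calc _ < 2 * (lam * c ^ 2) * c ^ 2 := by linarith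
      _ ≤ _ := h4
      _ = _ := by ring
  rcases ha.lt_or_gt with h | h
  · have h1 := key (-a) (by linarith)
    rw [primP_neg, sRad_neg] at h1
    rw [G_eq hlam] at hG
    rw [← neg_sq (a * c), ← neg_mul]
    exact h1 (by linear_combination -hG)
  · exact key a h ((G_eq hlam a c).symm.trans hG)

lemma orbitPoint_zero_mem {u : Fin 3 → ℝ} {w : Fin 2 → ℝ} {c : ℝ} (hu : u ⬝ᵥ u = 1)
    (hw : c ^ 2 + w ⬝ᵥ w = 1) : orbitPoint u w c 0 ∈ zeroSection := by
  refine ⟨?_, zero_smul ℝ _⟩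
  simp only [dotProduct, Fin.sum_univ_three, Fin.sum_univ_two] at hu hw
  simp only [orbitPoint, dotProduct, Fin.sum_univ_five, cons_val]
  linear_combination c ^ 2 * hu + hw

lemma G_zero {lam : ℝ} (hlam : 0 < lam) (c : ℝ) : G lam 0 c = 0 := by
  rw [G_eq hlam, primP_zero]
  ring

lemma mem_M_zero {lam : ℝ} (hlam : 0 < lam) {p : Ambient} (hp : p ∈ zeroSection)
    (h : ¬(p.1 0 = 0 ∧ p.1 1 = 0 ∧ p.1 2 = 0)) : p ∈ M lam 0 := by
  obtain ⟨h1, h2⟩ := hp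
  have hpos : 0 < p.1 0 ^ 2 + p.1 1 ^ 2 + p.1 2 ^ 2 := by
    by_contra! hle
    refine h ⟨?_, ?_, ?_⟩ <;> nlinarith [sq_nonneg (p.1 0), sq_nonneg (p.1 1), sq_nonneg (p.1 2)]
  have hc : 0 < coordC p := Real.sqrt_pos.2 hpos
  have hc2 : coordC p * coordC p = p.1 0 ^ 2 + p.1 1 ^ 2 + p.1 2 ^ 2 := Real.mul_self_sqrt hpos.le
  simp only [dotProduct, Fin.sum_univ_five] at h1
  refine mem_orbitSet.2 ⟨coordU p, ![p.1 3, p.1 4], coordC p, 0, ?_, hc, ?_, trivial,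
    G_zero hlam _, Prod.ext ?_ ?_⟩
  · rw [coordU, smul_dotProduct_smul, ← mul_inv, hc2]
    simp only [dotProduct, Fin.sum_univ_three, cons_val]
    field_simp
  · simp only [dotProduct, Fin.sum_univ_two, cons_val]
    linear_combination hc2 + h1
  · funext i
    fin_cases i <;> simp [orbitPoint, coordU, mul_inv_cancel_left₀ hc.ne']
  · rw [h2]
    exact (zero_smul ℝ _).symm

lemma entry_eq_zero {p : Ambient} (hp : p ∈ zeroSection) : p.2 3 4 = 0 := by
  rw [hp.2, Matrix.zero_apply]

lemma M_zero_inter_zeroSection {lam : ℝ} (hlam : 0 < lam) : M lam 0 ∩ zeroSection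
    = {p ∈ zeroSection | ¬(p.1 0 = 0 ∧ p.1 1 = 0 ∧ p.1 2 = 0)} := by
  ext p
  constructor
  · rintro ⟨hp, hz⟩
    obtain ⟨u, w, c, a, hu, hc, hw, -, hG, rfl⟩ := mem_orbitSet.1 hp
    refine ⟨hz, fun h => ?_⟩
    simp only [orbitPoint, cons_val, mul_eq_zero, hc.ne', false_or] at h
    simp [dotProduct, Fin.sum_univ_three, h] at hu
  · exact fun hp => ⟨mem_M_zero hlam hp.1 hp.2, hp.1⟩

lemma M_zero_inter_zeroRegion {lam : ℝ} (hlam : 0 < lam) :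
    M lam 0 ∩ zeroRegion lam = {p ∈ zeroSection | ¬(p.1 0 = 0 ∧ p.1 1 = 0 ∧ p.1 2 = 0)} := by
  rw [← M_zero_inter_zeroSection hlam]
  ext p
  refine and_congr_right fun hp => ?_
  obtain ⟨u, w, c, a, hu, hc, hw, -, hG, rfl⟩ := mem_orbitSet.1 hp
  rw [orbitPoint_mem_zeroRegion hu]
  constructor
  · intro h
    have ha : a = 0 := by
      by_contra ha
      exact lt_asymm h (mul_pow_four_lt hlam ha hc hG)
    rw [ha]
    exact orbitPoint_zero_mem hu hw
  · intro h
    have ha := entry_eq_zero h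
    rw [orbitPoint_entry, neg_eq_zero] at ha
    rw [ha, zero_pow two_ne_zero]
    positivity

lemma zeroSection_inter_zeroRegion (lam : ℝ) :
    zeroSection ∩ zeroRegion lam ⊆ {p ∈ zeroSection | ¬(p.1 0 = 0 ∧ p.1 1 = 0 ∧ p.1 2 = 0)} := by
  rintro p ⟨hz, hp⟩
  refine ⟨hz, fun h => ?_⟩
  simp [zeroRegion, h, hz.2] at hp

/-- `G(0, c) = 0` for all `c`, so `a` cannot vanish when `C ≠ 0`. -/
lemma M_eq_union {lam : ℝ} (C : ℝ) (hC : C ≠ 0) (hlam : 0 < lam) {ε : ℝ} (hε : ε * ε = 1) :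
    M lam C = signPart lam C ε ∪ signPart lam C (-ε) := by
  rw [← M_inter_signRegion, ← M_inter_signRegion, ← Set.inter_union_distrib_left, eq_comm,
    Set.inter_eq_left]
  intro p hp
  obtain ⟨u, w, c, a, hu, hc, hw, -, hG, rfl⟩ := mem_orbitSet.1 hp
  have ha : a ≠ 0 := by
    rintro rfl
    exact hC (hG.symm.trans (G_zero hlam c))
  have hε0 : ε ≠ 0 := left_ne_zero_of_mul (hε.trans_ne one_ne_zero)
  rw [Set.mem_union, orbitPoint_mem_signRegion hc, orbitPoint_mem_signRegion hc, neg_mul,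
    Left.neg_pos_iff]
  exact (mul_ne_zero hε0 ha).lt_or_gt.symm

lemma M_zero_eq_union {lam : ℝ} (hlam : 0 < lam) :
    M lam 0 = {p ∈ zeroSection | ¬(p.1 0 = 0 ∧ p.1 1 = 0 ∧ p.1 2 = 0)} ∪
      (MPos lam 0 ∪ MNeg lam 0) := by
  rw [← M_zero_inter_zeroSection hlam, MPos_eq, MNeg_eq, ← M_inter_signRegion,
    ← M_inter_signRegion, ← Set.inter_union_distrib_left, ← Set.inter_union_distrib_left, eq_comm,
    Set.inter_eq_left]
  intro p hp
  obtain ⟨u, w, c, a, hu, hc, hw, -, hG, rfl⟩ := mem_orbitSet.1 hp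
  rw [Set.mem_union, Set.mem_union, orbitPoint_mem_signRegion hc, orbitPoint_mem_signRegion hc,
    neg_one_mul, one_mul, Left.neg_pos_iff]
  rcases lt_trichotomy a 0 with h | rfl | h
  exacts [Or.inr (Or.inr h), Or.inl (orbitPoint_zero_mem hu hw), Or.inr (Or.inl h)]

lemma disjoint_zeroSection_signRegion (ε : ℝ) : Disjoint zeroSection (signRegion ε) := by
  refine Set.disjoint_left.2 fun p hp h => ?_
  rw [signRegion, Set.mem_ofPred_eq, entry_eq_zero hp, mul_zero] at h
  exact lt_irrefl 0 h

lemma disjoint_signRegion (ε : ℝ) : Disjoint (signRegion ε) (signRegion (-ε)) := by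
  refine Set.disjoint_left.2 fun p hp h => ?_
  simp only [signRegion, Set.mem_ofPred_eq] at hp h
  linarith

lemma signPart_subset (lam C ε : ℝ) : signPart lam C ε ⊆ signRegion ε := by
  rw [← M_inter_signRegion]
  exact Set.inter_subset_right

lemma M_zero_union {lam : ℝ} (hlam : 0 < lam) :
    M lam 0 ∪ {p ∈ zeroSection | p.1 0 = 0 ∧ p.1 1 = 0 ∧ p.1 2 = 0}
      = zeroSection ∪ MPos lam 0 ∪ MNeg lam 0 := by
  rw [M_zero_eq_union hlam, Set.union_right_comm, ← Set.union_assoc]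
  congr 2
  ext p
  simp only [Set.mem_union, Set.mem_ofPred_eq]
  tauto

lemma isCoassociative_signPart {lam : ℝ} (hlam : 0 < lam) (C : ℝ) {ε : ℝ} (hε : ε * ε = 1) :
    IsCoassociative lam (signPart lam C ε) :=
  isCoassociative_iff.2 ⟨orbitSet_subset_Y _ _ _, fun _ hp =>
    isCoassociativeAt_signPart hlam hε C hp⟩

/-- Each piece is cut out of `M_C` by an open set, so the local statements for the pieces apply. At
points of the zero section the open set is `zeroRegion`, in which `M_0` and the zero section
coincide. -/
lemma isCoassociative_M {lam : ℝ} (hlam : 0 < lam) (C : ℝ) : IsCoassociative lam (M lam C) := by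
  have hsign : ∀ {p : Ambient} {ε : ℝ}, ε * ε = 1 → p ∈ signPart lam C ε →
      IsCoassociativeAt lam (M lam C) p := fun {p ε} hε hp =>
    (isCoassociativeAt_signPart hlam hε C hp).congr (isOpen_signRegion ε)
      (signPart_subset lam C ε hp) (by
        rw [M_inter_signRegion, Set.inter_eq_left]
        exact signPart_subset lam C ε)
  refine isCoassociative_iff.2 ⟨orbitSet_subset_Y _ _ _, fun p hp => ?_⟩
  rcases eq_or_ne C 0 with rfl | hC
  · have hp' := hp
    rw [M_zero_eq_union hlam] at hp'
    rcases hp' with h | h | h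
    · have h1 := M_zero_inter_zeroRegion hlam
      refine (isCoassociative_iff.1 (isCoassociative_zeroSection hlam)).2 p h.1 |>.congr
        (isOpen_zeroRegion lam) (h1.symm.subset h).2 (Set.Subset.antisymm ?_ ?_)
      · rw [h1]
        exact zeroSection_inter_zeroRegion lam
      · exact fun q hq => ⟨(h1.subset hq).1, hq.2⟩
    · exact hsign (one_mul 1) (MPos_eq lam 0 ▸ h)
    · exact hsign (by norm_num) (MNeg_eq lam 0 ▸ h)
  · rw [M_eq_union C hC hlam (one_mul 1)] at hp
    rcases hp with h | h
    exacts [hsign (one_mul 1) h, hsign (by norm_num) h]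

/-! ### The topology of the pieces -/

/-- A set that is the disjoint union of two relatively open subsets is their topological sum. -/
lemma nonempty_homeomorph_sum {X : Type*} [TopologicalSpace X] {L A B O₁ O₂ : Set X}
    (h₁ : IsOpen O₁) (h₂ : IsOpen O₂) (hA : L ∩ O₁ = A) (hB : L ∩ O₂ = B) (hL : L = A ∪ B)
    (hd : Disjoint A B) : Nonempty (L ≃ₜ A ⊕ B) := by
  have hAL : A ⊆ L := hA ▸ Set.inter_subset_left
  have hBL : B ⊆ L := hB ▸ Set.inter_subset_left
  have hoA : IsOpenMap (Set.inclusion hAL) := (Topology.IsEmbedding.inclusion hAL).isOpenMap <| by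
    rw [Set.range_inclusion]
    convert h₁.preimage (continuous_subtype_val (p := (· ∈ L))) using 1
    ext ⟨x, hx⟩
    simp [← hA]
  have hoB : IsOpenMap (Set.inclusion hBL) := (Topology.IsEmbedding.inclusion hBL).isOpenMap <| by
    rw [Set.range_inclusion]
    convert h₂.preimage (continuous_subtype_val (p := (· ∈ L))) using 1
    ext ⟨x, hx⟩
    simp [← hB]
  have hbij : Function.Bijective (Sum.elim (Set.inclusion hAL) (Set.inclusion hBL)) := by
    refine ⟨Function.Injective.sumElim (Set.inclusion_injective hAL)
      (Set.inclusion_injective hBL) fun a b hab => ?_, ?_⟩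
    · exact Set.disjoint_left.1 hd a.2 ((congrArg Subtype.val hab : (a : X) = b) ▸ b.2)
    · rintro ⟨x, hx⟩
      rcases (hL ▸ hx : x ∈ A ∪ B) with h | h
      exacts [⟨Sum.inl ⟨x, h⟩, rfl⟩, ⟨Sum.inr ⟨x, h⟩, rfl⟩]
  exact ⟨((Equiv.ofBijective _ hbij).toHomeomorphOfContinuousOpen
    ((continuous_inclusion hAL).sumElim (continuous_inclusion hBL)) (hoA.sumElim hoB)).symm⟩

lemma mem_sphere_iff_dotProduct {n : ℕ} (x : EuclideanSpace ℝ (Fin n)) :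
    x ∈ Metric.sphere (0 : EuclideanSpace ℝ (Fin n)) 1 ↔ x.ofLp ⬝ᵥ x.ofLp = 1 := by
  have h : x.ofLp ⬝ᵥ x.ofLp = ‖x‖ ^ 2 := by
    rw [EuclideanSpace.real_norm_sq_eq, dotProduct]
    exact Finset.sum_congr rfl fun i _ => (sq _).symm
  rw [mem_sphere_zero_iff_norm, h, pow_eq_one_iff_of_nonneg (norm_nonneg x) two_ne_zero]

/-- The unit sphere in terms of the dot product. -/
def sphHomeomorph (n : ℕ) : {x : Fin (n + 1) → ℝ | x ⬝ᵥ x = 1} ≃ₜ Sph n :=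
  ((EuclideanSpace.equiv (Fin (n + 1)) ℝ).toHomeomorph.subtype mem_sphere_iff_dotProduct).symm

/-- The zero section is the base. -/
def zeroSectionHomeomorph : zeroSection ≃ₜ Sph 4 where
  toFun p := sphHomeomorph 4 ⟨p.1.1, p.2.1⟩
  invFun x := ⟨(((sphHomeomorph 4).symm x : Fin 5 → ℝ), 0), ((sphHomeomorph 4).symm x).2, rfl⟩
  left_inv p := by
    refine Subtype.ext (Prod.ext ?_ p.2.2.symm)
    simp
  right_inv x := by simp
  continuous_toFun := by fun_prop
  continuous_invFun := by fun_prop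

/-- The complement of `Σ` in the zero section. -/
def zeroSectionComplHomeomorph :
    {p ∈ zeroSection | ¬(p.1 0 = 0 ∧ p.1 1 = 0 ∧ p.1 2 = 0)} ≃ₜ
      {x : Sph 4 // ¬(x.1 0 = 0 ∧ x.1 1 = 0 ∧ x.1 2 = 0)} where
  toFun p := ⟨zeroSectionHomeomorph ⟨p.1, p.2.1⟩, p.2.2⟩
  invFun x := ⟨zeroSectionHomeomorph.symm x.1, (zeroSectionHomeomorph.symm x.1).2, x.2⟩
  left_inv p := by simp
  right_inv x := by simp
  continuous_toFun := by fun_prop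
  continuous_invFun := by fun_prop

/-- Polar coordinates on the complement of a disc. -/
def polarHomeomorph {r : ℝ} (hr : 0 ≤ r) :
    {W : Fin 2 → ℝ | r ^ 2 < W ⬝ᵥ W} ≃ₜ {x : Fin 2 → ℝ | x ⬝ᵥ x = 1} × Set.Ioi (0 : ℝ) where
  toFun W := (⟨(√(W.1 ⬝ᵥ W.1))⁻¹ • W.1, by
    have h : 0 < W.1 ⬝ᵥ W.1 := (sq_nonneg r).trans_lt W.2
    rw [Set.mem_ofPred_eq, smul_dotProduct_smul, ← mul_inv, Real.mul_self_sqrt h.le,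
      inv_mul_cancel₀ h.ne']⟩, ⟨√(W.1 ⬝ᵥ W.1) - r, sub_pos.2 (Real.lt_sqrt_of_sq_lt W.2)⟩)
  invFun x := ⟨(x.2.1 + r) • x.1.1, by
    have h := x.2.2
    rw [Set.mem_Ioi] at h
    rw [Set.mem_ofPred_eq, smul_dotProduct_smul, x.1.2]
    nlinarith⟩
  left_inv W := by
    have h : 0 < √(W.1 ⬝ᵥ W.1) := Real.sqrt_pos.2 ((sq_nonneg r).trans_lt W.2)
    refine Subtype.ext ?_
    simp only [sub_add_cancel, smul_smul, mul_inv_cancel₀ h.ne', one_smul]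
  right_inv x := by
    have h0 : 0 < x.2.1 + r := add_pos_of_pos_of_nonneg x.2.2 hr
    have h : √(((x.2.1 + r) • x.1.1) ⬝ᵥ ((x.2.1 + r) • x.1.1)) = x.2.1 + r := by
      rw [smul_dotProduct_smul, x.1.2, mul_one, Real.sqrt_mul_self h0.le]
    refine Prod.ext (Subtype.ext ?_) (Subtype.ext ?_)
    · simp only [h, smul_smul, inv_mul_cancel₀ h0.ne', one_smul]
    · simp only [h, add_sub_cancel_right]
  continuous_toFun := by
    have h1 : Continuous fun W : {W : Fin 2 → ℝ | r ^ 2 < W ⬝ᵥ W} => √(W.1 ⬝ᵥ W.1) :=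
      (continuous_dotProduct_self.comp continuous_subtype_val).sqrt
    have h2 : ∀ W : {W : Fin 2 → ℝ | r ^ 2 < W ⬝ᵥ W}, √(W.1 ⬝ᵥ W.1) ≠ 0 := fun W =>
      (Real.sqrt_pos.2 ((sq_nonneg r).trans_lt W.2)).ne'
    exact (((h1.inv₀ h2).smul continuous_subtype_val).subtype_mk _).prodMk
      ((h1.sub continuous_const).subtype_mk _)
  continuous_invFun := by fun_prop

section

variable {lam : ℝ} {hlam : 0 < lam}

/-- Since `P(α) = σ + |W|²`, the inequality `|W|² < 2 α s(α)` is the inequality `P(α) - 2 α s(α) <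
σ`. -/
lemma mem_paramDomain {σ : ℝ} {W : Fin 2 → ℝ} :
    W ∈ paramDomain hlam σ ↔ primQ lam (alphaOf hlam σ W) < σ := by
  have h : primP lam (alphaOf hlam σ W) = σ + W ⬝ᵥ W := primP_invP hlam _
  rw [paramDomain, Set.mem_ofPred_eq, primQ, h]
  constructor <;> intro h <;> linarith

lemma paramDomain_of_pos {σ : ℝ} (hσ : 0 < σ) : paramDomain hlam σ = Set.univ := by
  refine Set.eq_univ_of_forall fun W => mem_paramDomain.2 ?_
  have h : primP lam (alphaOf hlam σ W) = σ + W ⬝ᵥ W := primP_invP hlam _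
  have h1 := dotProduct_self_nonneg W
  have h2 : 0 < alphaOf hlam σ W := by
    rw [← (strictMono_primP hlam).lt_iff_lt, h, primP_zero]
    linarith
  have h3 := strictAntiOn_primQ hlam Set.self_mem_Ici h2.le h2
  rw [primQ_zero] at h3
  exact h3.trans hσ

/-- Let `α ≥ 0` solve `Q(α) = σ`. As `Q` decreases, membership means that `alphaOf` exceeds `α`. As
`P` increases and `P(α) = σ + 2 α s(α)`, this means `|W|² > 2 α s(α)`. For `σ = 0` only the origin
is removed. -/
lemma exists_paramDomain_eq {σ : ℝ} (hσ : σ ≤ 0) :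
    ∃ r, 0 ≤ r ∧ paramDomain hlam σ = {W | r ^ 2 < W ⬝ᵥ W} := by
  obtain ⟨α, hα, hαq⟩ := exists_primQ_eq hlam hσ
  have hs := sRad_pos hlam α
  have hr : 0 ≤ 2 * α * sRad lam α := by positivity
  refine ⟨√(2 * α * sRad lam α), Real.sqrt_nonneg _, Set.ext fun W => ?_⟩
  have h : primP lam (alphaOf hlam σ W) = σ + W ⬝ᵥ W := primP_invP hlam _
  have hP := (strictMono_primP hlam).lt_iff_lt (a := α) (b := alphaOf hlam σ W)
  rw [Set.mem_ofPred_eq, Real.sq_sqrt hr]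
  have h1 : 2 * α * sRad lam α < W ⬝ᵥ W ↔ α < alphaOf hlam σ W := by
    rw [← hP, h, ← hαq, primQ]
    constructor <;> intro h <;> linarith
  rw [h1]
  constructor
  · intro hW
    exact ((strictAntiOn_primQ hlam).lt_iff_gt (alphaOf_pos hW).le hα).1
      ((mem_paramDomain.1 hW).trans_eq hαq.symm)
  · intro hW
    exact mem_paramDomain.2 ((strictAntiOn_primQ hlam hα (hα.trans hW.le) hW).trans_eq hαq)

/-- The part of `M_C` on which `a₁` has a fixed sign. -/
def signPartHomeomorph {σ ε C : ℝ} (hε : ε * ε = 1) (hσ : C = ε * σ) :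
    signPart lam C ε ≃ₜ {u : Fin 3 → ℝ | u ⬝ᵥ u = 1} × paramDomain hlam σ where
  toFun p := (⟨coordU p, (coord_mem (hlam := hlam) hε hσ p.2).1⟩,
    ⟨coordW lam ε p, (coord_mem hε hσ p.2).2.1⟩)
  invFun x := ⟨param hlam σ ε x.1.1 x.2.1, param_mem hε hσ x.1.2 x.2.2⟩
  left_inv p := Subtype.ext (coord_mem hε hσ p.2).2.2.1
  right_inv x := Prod.ext (Subtype.ext (coordU_param x.1.2 x.2.2))
    (Subtype.ext (coordW_param hε x.1.2 x.2.2))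
  continuous_toFun := by
    refine (Continuous.subtype_mk (continuous_iff_continuousAt.2 fun p => ?_) _).prodMk
      (Continuous.subtype_mk (continuous_iff_continuousAt.2 fun p => ?_) _)
    · exact (differentiableAt_coordU
        (coord_mem (hlam := hlam) hε hσ p.2).2.2.2.1).continuousAt.comp
          continuous_subtype_val.continuousAt
    · obtain ⟨-, -, -, hc, ha⟩ := coord_mem (hlam := hlam) hε hσ p.2
      exact (differentiableAt_coordW hlam hc ha).continuousAt.comp
        continuous_subtype_val.continuousAt
  continuous_invFun := by
    refine Continuous.subtype_mk ?_ _
    exact (contDiffOn_param σ ε).continuousOn.comp_continuous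
      (f := fun x : {u : Fin 3 → ℝ | u ⬝ᵥ u = 1} × paramDomain hlam σ =>
        ((x.1.1, x.2.1) : (Fin 3 → ℝ) × (Fin 2 → ℝ))) (by fun_prop) fun x => x.2.2

end

/-! ### ### Homeomorphism types of `M_C` and its parts -/

lemma nonempty_homeomorph_of_pos {lam : ℝ} (hlam : 0 < lam) {ε C : ℝ} (hε : ε * ε = 1)
    (hC : 0 < ε * C) : Nonempty (signPart lam C ε ≃ₜ Sph 2 × EuclideanSpace ℝ (Fin 2)) := by
  have h := signPartHomeomorph (lam := lam) (hlam := hlam) hε (C := C) (σ := ε * C)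
    (by rw [← mul_assoc, hε, one_mul])
  rw [paramDomain_of_pos hC] at h
  exact ⟨h.trans ((sphHomeomorph 2).prodCongr ((Homeomorph.Set.univ _).trans
    (EuclideanSpace.equiv (Fin 2) ℝ).toHomeomorph.symm))⟩

lemma nonempty_homeomorph_of_nonpos {lam : ℝ} (hlam : 0 < lam) {ε C : ℝ} (hε : ε * ε = 1)
    (hC : ε * C ≤ 0) : Nonempty (signPart lam C ε ≃ₜ SphereCircleRay) := by
  have h := signPartHomeomorph (lam := lam) (hlam := hlam) hε (C := C) (σ := ε * C)
    (by rw [← mul_assoc, hε, one_mul])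
  obtain ⟨r, hr, hrW⟩ := exists_paramDomain_eq (hlam := hlam) hC
  rw [hrW] at h
  exact ⟨h.trans ((sphHomeomorph 2).prodCongr ((polarHomeomorph hr).trans
    ((sphHomeomorph 1).prodCongr (Homeomorph.refl _))))⟩

lemma nonempty_homeomorph_M {lam : ℝ} (hlam : 0 < lam) {C : ℝ} (hC : C ≠ 0) :
    Nonempty (M lam C ≃ₜ (Sph 2 × EuclideanSpace ℝ (Fin 2)) ⊕ SphereCircleRay) := by
  -- The part on which `a` has the sign of `C` has `σ > 0` and is `S² × ℝ²`; the opposite sign has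
  -- `σ < 0`.
  obtain ⟨ε, hε, hεC⟩ : ∃ ε : ℝ, ε * ε = 1 ∧ 0 < ε * C := by
    rcases hC.lt_or_gt with h | h
    exacts [⟨-1, by norm_num, by linarith⟩, ⟨1, one_mul 1, by linarith⟩]
  obtain ⟨e⟩ := nonempty_homeomorph_sum (isOpen_signRegion ε) (isOpen_signRegion (-ε))
    (M_inter_signRegion lam C ε) (M_inter_signRegion lam C (-ε)) (M_eq_union C hC hlam hε)
    ((disjoint_signRegion ε).mono (signPart_subset _ _ _) (signPart_subset _ _ _))
  obtain ⟨e₁⟩ := nonempty_homeomorph_of_pos hlam hε hεC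
  obtain ⟨e₂⟩ := nonempty_homeomorph_of_nonpos hlam (ε := -ε) (C := C) (by rw [neg_mul_neg, hε])
    (by linarith)
  exact ⟨e.trans (e₁.sumCongr e₂)⟩

lemma nonempty_homeomorph_MPos {lam : ℝ} (hlam : 0 < lam) :
    Nonempty (MPos lam 0 ≃ₜ SphereCircleRay) := by
  rw [MPos_eq]
  exact nonempty_homeomorph_of_nonpos hlam (one_mul 1) (by simp)

lemma nonempty_homeomorph_MNeg {lam : ℝ} (hlam : 0 < lam) :
    Nonempty (MNeg lam 0 ≃ₜ SphereCircleRay) := by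
  rw [MNeg_eq]
  exact nonempty_homeomorph_of_nonpos hlam (by norm_num) (by simp)

lemma disjoint_zeroSection_MPos (lam C : ℝ) : Disjoint zeroSection (MPos lam C) :=
  MPos_eq lam C ▸ (disjoint_zeroSection_signRegion 1).mono_right (signPart_subset _ _ _)

lemma disjoint_zeroSection_MNeg (lam C : ℝ) : Disjoint zeroSection (MNeg lam C) :=
  MNeg_eq lam C ▸ (disjoint_zeroSection_signRegion (-1)).mono_right (signPart_subset _ _ _)

lemma disjoint_MPos_MNeg (lam C : ℝ) : Disjoint (MPos lam C) (MNeg lam C) := by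
  rw [MPos_eq, MNeg_eq]
  exact (disjoint_signRegion 1).mono (signPart_subset _ _ _) (signPart_subset _ _ _)

lemma nonempty_homeomorph_M_zero {lam : ℝ} (hlam : 0 < lam) : Nonempty (M lam 0 ≃ₜ
    {x : Sph 4 // ¬(x.1 0 = 0 ∧ x.1 1 = 0 ∧ x.1 2 = 0)} ⊕ (SphereCircleRay ⊕ SphereCircleRay)) := by
  have hsub : {p ∈ zeroSection | ¬(p.1 0 = 0 ∧ p.1 1 = 0 ∧ p.1 2 = 0)} ⊆ zeroSection :=
    fun p hp => hp.1
  have hP : M lam 0 ∩ signRegion 1 = MPos lam 0 := by rw [M_inter_signRegion, MPos_eq]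
  have hN : M lam 0 ∩ signRegion (-1) = MNeg lam 0 := by rw [M_inter_signRegion, MNeg_eq]
  have hPN : M lam 0 ∩ (signRegion 1 ∪ signRegion (-1)) = MPos lam 0 ∪ MNeg lam 0 := by
    rw [Set.inter_union_distrib_left, hP, hN]
  have hdis := disjoint_MPos_MNeg lam 0
  -- `zeroRegion` may meet the sign regions in the ambient space; it is only within `M_0` that it
  -- isolates the part with `a = 0`.
  obtain ⟨e⟩ := nonempty_homeomorph_sum (isOpen_zeroRegion lam)
    ((isOpen_signRegion 1).union (isOpen_signRegion (-1))) (M_zero_inter_zeroRegion hlam) hPN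
    (M_zero_eq_union hlam) (((disjoint_zeroSection_MPos lam 0).union_right
      (disjoint_zeroSection_MNeg lam 0)).mono_left hsub)
  obtain ⟨e'⟩ := nonempty_homeomorph_sum (L := MPos lam 0 ∪ MNeg lam 0) (A := MPos lam 0)
    (B := MNeg lam 0) (isOpen_signRegion 1) (isOpen_signRegion (-1))
    (by
      rw [Set.union_inter_distrib_right, ← hP, ← hN, Set.inter_assoc, Set.inter_assoc,
        Set.inter_self, (disjoint_signRegion 1).symm.inter_eq, Set.inter_empty, Set.union_empty])
    (by
      rw [Set.union_inter_distrib_right, ← hP, ← hN, Set.inter_assoc, Set.inter_assoc,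
        Set.inter_self, (disjoint_signRegion 1).inter_eq, Set.inter_empty, Set.empty_union])
    rfl hdis
  obtain ⟨e₁⟩ := nonempty_homeomorph_MPos hlam
  obtain ⟨e₂⟩ := nonempty_homeomorph_MNeg hlam
  exact ⟨e.trans (zeroSectionComplHomeomorph.sumCongr (e'.trans (e₁.sumCongr e₂)))⟩

end BryantSalamon

end

theorem mainTheorem4 (lam : ℝ) (hlam : 0 < lam) :
    -- each `M_C` is a coassociative submanifold
    (∀ C : ℝ, BryantSalamon.IsCoassociative lam (BryantSalamon.M lam C)) ∧
    -- the topology for `C ≠ 0`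
    (∀ C : ℝ, C ≠ 0 → Nonempty (BryantSalamon.M lam C ≃ₜ
      (BryantSalamon.Sph 2 × EuclideanSpace ℝ (Fin 2)) ⊕ BryantSalamon.SphereCircleRay)) ∧
    -- `M_0` with the circle `x₁ = x₂ = x₃ = 0` of the zero section added is the disjoint union of
    -- three coassociative submanifolds: the zero section, and the parts `a₁ > 0`, `a₁ < 0`
    (BryantSalamon.M lam 0 ∪ {p ∈ BryantSalamon.zeroSection | p.1 0 = 0 ∧ p.1 1 = 0 ∧ p.1 2 = 0} =
        BryantSalamon.zeroSection ∪ BryantSalamon.MPos lam 0 ∪ BryantSalamon.MNeg lam 0 ∧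
      Disjoint BryantSalamon.zeroSection (BryantSalamon.MPos lam 0) ∧
      Disjoint BryantSalamon.zeroSection (BryantSalamon.MNeg lam 0) ∧
      Disjoint (BryantSalamon.MPos lam 0) (BryantSalamon.MNeg lam 0) ∧
      BryantSalamon.IsCoassociative lam BryantSalamon.zeroSection ∧
      BryantSalamon.IsCoassociative lam (BryantSalamon.MPos lam 0) ∧
      BryantSalamon.IsCoassociative lam (BryantSalamon.MNeg lam 0) ∧
      Nonempty (BryantSalamon.zeroSection ≃ₜ BryantSalamon.Sph 4) ∧
      Nonempty (BryantSalamon.MPos lam 0 ≃ₜ BryantSalamon.SphereCircleRay) ∧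
      Nonempty (BryantSalamon.MNeg lam 0 ≃ₜ BryantSalamon.SphereCircleRay)) ∧
    -- `M_0` itself meets the zero section in the complement of that circle, and as a subspace it
    -- is the topological disjoint union of that part and the two other parts
    (BryantSalamon.M lam 0 ∩ BryantSalamon.zeroSection =
        {p ∈ BryantSalamon.zeroSection | ¬(p.1 0 = 0 ∧ p.1 1 = 0 ∧ p.1 2 = 0)} ∧
      Nonempty (BryantSalamon.M lam 0 ≃ₜ
        {x : BryantSalamon.Sph 4 // ¬(x.1 0 = 0 ∧ x.1 1 = 0 ∧ x.1 2 = 0)} ⊕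
          (BryantSalamon.SphereCircleRay ⊕ BryantSalamon.SphereCircleRay))) := by
  open BryantSalamon in
  exact ⟨isCoassociative_M hlam, fun C hC => nonempty_homeomorph_M hlam hC,
    ⟨M_zero_union hlam, disjoint_zeroSection_MPos lam 0, disjoint_zeroSection_MNeg lam 0,
      disjoint_MPos_MNeg lam 0, isCoassociative_zeroSection hlam,
      MPos_eq lam 0 ▸ isCoassociative_signPart hlam 0 (one_mul 1),
      MNeg_eq lam 0 ▸ isCoassociative_signPart hlam 0 (by norm_num), ⟨zeroSectionHomeomorph⟩,
      nonempty_homeomorph_MPos hlam, nonempty_homeomorph_MNeg hlam⟩,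
    M_zero_inter_zeroSection hlam, nonempty_homeomorph_M_zero hlam⟩
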